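/- **Setting.** Data values are natural numbers. A *method event* $m(x)$ is a method $m$ with a data value $x$; a *sequential execution* is a finite sequence of method events. A *(completed) execution* $e$ is a finite sequence of actions $\mathrm{call}_o\,m(x)$ and $\mathrm{ret}_o\,m(x)$ ($o$ an operation identifier) in which every identifier that occurs is used by exactly one call and exactly one return, with the same $m(x)$, the call coming first. Operation $o_1$ *happens before* $o_2$ in $e$ if the return of $o_1$ precedes the call of $o_2$. We write $e\sqsubseteq u$ ($e$ is linearizable w.r.t. the sequential execution $u$) if there is a bijection from the operations of $e$ to the positions of $u$ that preserves happens-before and labels, and $e\sqsubseteq U$ if $e\sqsubseteq u$ for some $u\in U$. A projection of an execution or sequential execution to a set $D$ of values erases everything with a value outside $D$; $\mathrm{proj}(e)$ is the set of projections of $e$, and $w\setminus x$ is $w$ without the events of value $x$. **Specifications.** Each is given by rules $u_1\cdots u_k\in S\wedge \mathrm{Guard}\Rightarrow \mathrm{Expr}\in S$, where $\mathrm{matched}(m,u)$ means that for each event $m(x)$ of $u$ there is another event of $u$ with value $x$: * Queue (input method $Enq$): $R_0:\ \epsilon$; $\ R_{Enq}:\ u\in Enq^*\Rightarrow u\cdot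 Enq$; $\ R_{EnqDeq}:\ u\in Enq^*,\ v\in\{Enq,Deq\}^*\Rightarrow Enq\cdot u\cdot Deq\cdot v$; $\ R_{DeqEmpty}:\ \mathrm{matched}(Enq,u)\Rightarrow u\cdot DeqEmpty\cdot v$. * Stack (input method $Push$): $R_0:\ \epsilon$; $\ R_{PushPop}:\ \mathrm{matched}(Push,u),\ \mathrm{matched}(Push,v),\ u,v\in\{Push,Pop\}^*\Rightarrow Push\cdot u\cdot Pop\cdot v$; $\ R_{Push}:\ \mathrm{matched}(Push,u),\ u,v\in\{Push,Pop\}^*\Rightarrow u\cdot Push\cdot v$; $\ R_{PopEmpty}:\ \mathrm{matched}(Push,u)\Rightarrow u\cdot PopEmpty\cdot v$. * Register (input method $Write$): $R_0:\ \epsilon$; $\ R_{WR}:\ Write\cdot Read^*\cdot u$. * Mutex (input method $Lock$): $R_0:\ \epsilon$; $\ R_{Lock}:\ Lock$; $\ R_{LU}:\ Lock\cdot Unlock\cdot u$. The *matching set* $M_R$ of a rule $R$ consists of the sequential executions $w$ for which there are a value $x$ and a decomposition $w\setminus x=u_1\cdots u_k$ satisfying the guard of $R$ such that $w$ is obtained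 from $\mathrm{Expr}(u_1,\dots,u_k)$ by giving all methods in it the value $x$ (and replacing $m^*$ by zero or more events $m(x)$). The *last rule* is as follows, the first case that applies being taken. Queue: $R_{DeqEmpty}$ if there is a $DeqEmpty$, $R_{EnqDeq}$ if there is a $Deq$, $R_{Enq}$ if there is an $Enq$, else $R_0$. Stack: $R_{PopEmpty}$ if there is a $PopEmpty$, $R_{Push}$ if there is an unmatched $Push$, $R_{PushPop}$ if there is a $Pop$, else $R_0$. Register: $R_{WR}$ if non-empty, else $R_0$. Mutex: $R_{LU}$ if there is an $Unlock$, $R_{Lock}$ if non-empty, else $R_0$. The last rule of an execution is that of its linearizations. **Data independence.** A (sequential) execution is *differentiated* if for each input method $m$ and value $x$ at most one operation is labelled $m(x)$, and the (unused, dummy) value of each $DeqEmpty$ or $PopEmpty$ operation is carried by no other operation. An *implementation* $I$ is a set of completed executions, and $I_{\neq}$ is the set of its differentiated ones. $I$ is *data independent* if it is closed under all renamings of data values by functions $r:\mathbb N\to\mathbb N$ and each of its executions is $r(e')$ for some $r$ and some $e'\in I_{\neq}$. **Co-regularity.** A rule $R$ is *co-regular* (respectively co-regular on a class of implementations) if there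 are a finite set $D\subset\mathbb N$ and a finite automaton $A$ over the alphabet of actions $\mathrm{call}\,m(x)$, $\mathrm{ret}\,m(x)$ with $x\in D$ such that for every data-independent implementation $I$ (respectively, every such $I$ in the class) $$A\cap I\neq\emptyset\iff \exists e\in I_{\neq},\ \exists e'\in\mathrm{proj}(e):\ \text{the last rule of } e' \text{ is } R \text{ and } e'\not\sqsubseteq M_R,$$ where operation identifiers are ignored in $A\cap I$. **Theorem.** All rules of Queue, Stack, Register and Mutex are co-regular, where for the three rules $R_{DeqEmpty}$, $R_{Push}$ and $R_{PopEmpty}$ co-regularity is on the implementations that never remove a value twice, i.e. no execution in $I_{\neq}$ has two operations $Deq(x)$ (for Queue), respectively $Pop(x)$ (for Stack), with the same $x$. That is: * Queue: $R_0$, $R_{Enq}$, $R_{EnqDeq}$ are co-regular, and $R_{DeqEmpty}$ is co-regular on the implementations that never dequeue a value twice. * Stack: $R_0$, $R_{PushPop}$ are co-regular, and $R_{Push}$, $R_{PopEmpty}$ are co-regular on the implementations that never pop a value twice. * Register: $R_0$, $R_{WR}$ are co-regular. * Mutex: $R_0$, $R_{Lock}$, $R_{LU}$ are co-regular. -/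

import Mathlib

namespace CoReg

/-! ### Sequential executions -/

/-- A method event `m(x)`; data values are natural numbers. -/
abbrev Event (M : Type) := M × ℕ

/-- The projection of a sequential execution to a set `D` of data values. -/
noncomputable def seqProj {M : Type} (D : Set ℕ) (u : List (Event M)) : List (Event M) :=
  open Classical in u.filter (fun p => p.2 ∈ D)

/-- `matched(m, u)`: for every event `m(x)` of `u` there is another event of `u` (at another
position) with the same data value `x`. -/
def Matched {M : Type} (m : M) (u : List (Event M)) : Prop :=
  ∀ i : Fin u.length, (u.get i).1 = m → ∃ j : Fin u.length, j ≠ i ∧ (u.get j).2 = (u.get i).2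

/-- `u` contains an event of method `m`. -/
def Contains {M : Type} (m : M) (u : List (Event M)) : Prop := ∃ x, (m, x) ∈ u

/-! ### Rules
A rule `u₁ ⋯ u_k ∈ S ∧ Guard(u₁, …, u_k) ⇒ Expr(u₁, …, u_k) ∈ S`, given syntactically. -/

/-- Atoms of a guard: `u_i ∈ A*` for a set `A` of methods, or `matched(m, u_i)`. -/
inductive Atom (M : Type) : Type
  | methods (i : ℕ) (A : Set M) : Atom M
  | matched (m : M) (i : ℕ) : Atom M

def Atom.Holds {M : Type} (us : ℕ → List (Event M)) : Atom M → Prop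
  | .methods i A => ∀ p ∈ us i, p.1 ∈ A
  | .matched m i => Matched m (us i)

/-- Factors of an expression: a variable `u_i`, a method `m`, or a Kleene closure `m*`. -/
inductive Term (M : Type) : Type
  | var (i : ℕ) : Term M
  | meth (m : M) : Term M
  | star (m : M) : Term M

/-- The words denoted by a factor, when all new events use the data value `x`. -/
def Term.den {M : Type} (us : ℕ → List (Event M)) (x : ℕ) :
    Term M → Language (Event M)
  | .var i => {us i}
  | .meth m => {[(m, x)]}
  | .star m => {w | ∃ n : ℕ, w = List.replicate n (m, x)}

/-- A rule with `k` variables, numbered `0, …, k - 1`. -/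
structure Rule (M : Type) where
  k : ℕ
  guard : List (Atom M)
  expr : List (Term M)

/-- `w` matches `R` with witness `x`: the word `w ∖ x` (`w` without the events of value `x`)
decomposes as `u₁ ⋯ u_k` such that the guard holds and `w ∈ ⟦Expr(u₁, …, u_k)⟧`, where the
methods of the expression are instantiated with `x`. The product is that of languages, i.e.
concatenation. -/
def Rule.Matches {M : Type} (R : Rule M) (w : List (Event M)) (x : ℕ) : Prop :=
  ∃ us : ℕ → List (Event M),
    (∀ a ∈ R.guard, a.Holds us) ∧
    ((List.range R.k).map us).flatten = seqProj {x}ᶜ w ∧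
    w ∈ (R.expr.map (Term.den us x)).prod

/-- The matching set of a rule. -/
def Rule.matchingSet {M : Type} (R : Rule M) : Set (List (Event M)) :=
  {w | ∃ x, R.Matches w x}

/-! ### Data structures
`ι` is the type of names of the rules, `input` the set of input methods, `unused` the set of
methods whose parameter is not used, `last u` the name of the last rule of `u`. -/

structure DataStructure (M ι : Type) where
  input : Set M
  unused : Set M
  rule : ι → Rule M
  last : List (Event M) → ι

/-- Differentiated: an input method occurs at most once with any given data value, and the (unused)
parameter of an event of an `unused` method is a value that no other event has. -/
def DataStructure.Differentiated {M ι : Type} (S : DataStructure M ι)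
    (u : List (Event M)) : Prop :=
  (∀ i j : Fin u.length, (u.get i).1 ∈ S.input → u.get i = u.get j → i = j) ∧
  (∀ i j : Fin u.length, (u.get i).1 ∈ S.unused → (u.get i).2 = (u.get j).2 → i = j)

/-! ### Concurrent executions -/

/-- Call and return actions of method `m` with data value `x` and operation identifier `o`. -/
inductive Action (M V O : Type*) : Type _
  | call (o : O) (m : M) (x : V) : Action M V O
  | ret (o : O) (m : M) (x : V) : Action M V O

/-- Apply a function to the data value and one to the operation identifier. -/
def Action.map {M V V' O O' : Type*} (f : V → V') (g : O → O') : Action M V O → Action M V' O'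
  | .call o m x => .call (g o) m (f x)
  | .ret o m x => .ret (g o) m (f x)

def Action.op {M V O : Type*} : Action M V O → O
  | .call o _ _ => o
  | .ret o _ _ => o

def Action.val {M V O : Type*} : Action M V O → V
  | .call _ _ x => x
  | .ret _ _ x => x

def Action.isCall {M V O : Type*} : Action M V O → Bool
  | .call _ _ _ => true
  | .ret _ _ _ => false

/-- Well-formed completed executions: no operation identifier is used by two calls or by two
returns, every return is preceded by its call (same operation, method and value), every call has
its return. -/
def IsExecution {M O : Type*} (e : List (Action M ℕ O)) : Prop :=
  ((e.filter (fun a => a.isCall)).map Action.op).Nodup ∧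
  ((e.filter (fun a => !a.isCall)).map Action.op).Nodup ∧
  (∀ e₁ e₂ o m x, e = e₁ ++ Action.ret o m x :: e₂ → Action.call o m x ∈ e₁) ∧
  (∀ o m x, Action.call o m x ∈ e → Action.ret o m x ∈ e)

/-- The operations of an execution. -/
def ops {M O : Type*} (e : List (Action M ℕ O)) : Set O := {o | ∃ m x, Action.call o m x ∈ e}

/-- Happens-before: the return of `o₁` is before the call of `o₂`. -/
def HappensBefore {M O : Type*} (e : List (Action M ℕ O)) (o₁ o₂ : O) : Prop :=
  ∃ e₁ e₂ e₃ m₁ x₁ m₂ x₂,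
    e = e₁ ++ Action.ret o₁ m₁ x₁ :: e₂ ++ Action.call o₂ m₂ x₂ :: e₃

/-- The execution `e` is linearizable with respect to the sequential execution `u`: a bijection
from operations to positions that respects happens-before and the labels. -/
def LinearizableTo {M : Type} {O : Type*} (e : List (Action M ℕ O)) (u : List (Event M)) : Prop :=
  ∃ f : ops e ≃ Fin u.length,
    (∀ o₁ o₂ : ops e, HappensBefore e o₁ o₂ → f o₁ < f o₂) ∧
    (∀ (o : ops e) (m : M) (x : ℕ), Action.call (o : O) m x ∈ e → u.get (f o) = (m, x))

/-- Linearizability with respect to a set of sequential executions. -/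
def Linearizable {M : Type} {O : Type*} (e : List (Action M ℕ O)) (U : Set (List (Event M))) :
    Prop :=
  ∃ u ∈ U, LinearizableTo e u

/-- The projection of an execution to a set `D` of data values. -/
noncomputable def proj {M O : Type*} (D : Set ℕ) (e : List (Action M ℕ O)) :
    List (Action M ℕ O) :=
  open Classical in e.filter (fun a => a.val ∈ D)

/-- Renaming the data values of an execution. -/
def rename {M O : Type*} (r : ℕ → ℕ) (e : List (Action M ℕ O)) : List (Action M ℕ O) :=
  e.map (Action.map r id)

/-- The method events of an execution, in the order of their calls. This is one of the
linearizations of a well-formed execution. -/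
def events {M : Type} {O : Type*} (e : List (Action M ℕ O)) : List (Event M) :=
  e.filterMap fun a =>
    match a with
    | .call _ m x => some (m, x)
    | .ret _ _ _ => none

/-- A set of (well-formed, completed) executions. -/
def IsImplementation {M O : Type*} (I : Set (List (Action M ℕ O))) : Prop :=
  ∀ e ∈ I, IsExecution e

/-- Every execution of `I` is a renaming of a differentiated one of `I`, and `I` is closed under
all renamings. -/
def DataStructure.DataIndependent {M ι : Type} {O : Type*} (S : DataStructure M ι)
    (I : Set (List (Action M ℕ O))) : Prop :=
  (∀ e ∈ I, ∃ e' ∈ I, S.Differentiated (events e') ∧ ∃ r : ℕ → ℕ, e = rename r e') ∧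
  (∀ e ∈ I, ∀ r : ℕ → ℕ, rename r e ∈ I)

/-- No differentiated execution of `I` has two operations `m(x)` with the same value `x`. -/
def DataStructure.AtMostOnce {M ι : Type} {O : Type*} (S : DataStructure M ι) (m : M)
    (I : Set (List (Action M ℕ O))) : Prop :=
  ∀ e ∈ I, S.Differentiated (events e) →
    ∀ i j : Fin (events e).length,
      ((events e).get i).1 = m → (events e).get i = (events e).get j → i = j

/-! ### Co-regularity -/

/-- The execution `e` has a projection whose last rule is `R` and which is not linearizable with
respect to the matching set of `R`. The last rule of an execution is that of its linearizations;
`events` is one of them. -/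
def DataStructure.Violates {M ι : Type} {O : Type*} (S : DataStructure M ι) (R : ι)
    (e : List (Action M ℕ O)) : Prop :=
  ∃ D : Set ℕ, S.last (events (proj D e)) = R ∧ ¬ Linearizable (proj D e) (S.rule R).matchingSet

/-- The automaton `A`, which reads actions without operation identifiers and with data values in
the finite set `D`, accepts some execution of `I`. -/
def Meets {M : Type} {O : Type*} {D : Finset ℕ} {σ : Type} (A : NFA (Action M D Unit) σ)
    (I : Set (List (Action M ℕ O))) : Prop :=
  ∃ e ∈ I, ∃ w ∈ A.accepts,
    w.map (Action.map (fun x : D => (x : ℕ)) id) = e.map (Action.map id (fun _ => ()))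

/-- Co-regularity of the rule `R`, for the implementations in the class `P`. -/
def DataStructure.CoRegularOn {M ι : Type} {O : Type*} (S : DataStructure M ι)
    (P : Set (List (Action M ℕ O)) → Prop) (R : ι) : Prop :=
  ∃ (D : Finset ℕ) (σ : Type) (_ : Finite σ) (A : NFA (Action M D Unit) σ),
    ∀ I : Set (List (Action M ℕ O)), IsImplementation I → S.DataIndependent I → P I →
      (Meets A I ↔ ∃ e ∈ I, S.Differentiated (events e) ∧ S.Violates R e)

/-- Co-regularity of the rule `R` (operation identifiers taken from `O`). -/
def DataStructure.CoRegular {M ι : Type} (O : Type*) (S : DataStructure M ι) (R : ι) : Prop :=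
  S.CoRegularOn (fun _ : Set (List (Action M ℕ O)) => True) R

/-! ### Queue -/

inductive QueueMethod | enq | deq | deqEmpty

inductive QueueRule | r0 | rEnq | rEnqDeq | rDeqEmpty

open Classical in
noncomputable def queue : DataStructure QueueMethod QueueRule where
  input := {.enq}
  unused := {.deqEmpty}
  rule
    | .r0 => ⟨0, [], []⟩
    | .rEnq => ⟨1, [.methods 0 {.enq}], [.var 0, .meth .enq]⟩
    | .rEnqDeq => ⟨2, [.methods 0 {.enq}, .methods 1 {.enq, .deq}],
        [.meth .enq, .var 0, .meth .deq, .var 1]⟩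
    | .rDeqEmpty => ⟨2, [.matched .enq 0], [.var 0, .meth .deqEmpty, .var 1]⟩
  last u :=
    if Contains .deqEmpty u then .rDeqEmpty
    else if Contains .deq u then .rEnqDeq
    else if Contains .enq u then .rEnq
    else .r0

/-! ### Stack -/

inductive StackMethod | push | pop | popEmpty

inductive StackRule | r0 | rPushPop | rPush | rPopEmpty

open Classical in
noncomputable def stack : DataStructure StackMethod StackRule where
  input := {.push}
  unused := {.popEmpty}
  rule
    | .r0 => ⟨0, [], []⟩
    | .rPushPop => ⟨2, [.matched .push 0, .matched .push 1,
          .methods 0 {.push, .pop}, .methods 1 {.push, .pop}],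
        [.meth .push, .var 0, .meth .pop, .var 1]⟩
    | .rPush => ⟨2, [.matched .push 0, .methods 0 {.push, .pop}, .methods 1 {.push, .pop}],
        [.var 0, .meth .push, .var 1]⟩
    | .rPopEmpty => ⟨2, [.matched .push 0], [.var 0, .meth .popEmpty, .var 1]⟩
  last u :=
    if Contains .popEmpty u then .rPopEmpty
    else if ¬ Matched .push u then .rPush
    else if Contains .pop u then .rPushPop
    else .r0

/-! ### Register -/

inductive RegisterMethod | write | read

inductive RegisterRule | r0 | rWR

open Classical in
noncomputable def register : DataStructure RegisterMethod RegisterRule where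
  input := {.write}
  unused := ∅
  rule
    | .r0 => ⟨0, [], []⟩
    | .rWR => ⟨1, [], [.meth .write, .star .read, .var 0]⟩
  last u := if u ≠ [] then .rWR else .r0

/-! ### Mutex -/

inductive MutexMethod | lock | unlock

inductive MutexRule | r0 | rLock | rLU

open Classical in
noncomputable def mutex : DataStructure MutexMethod MutexRule where
  input := {.lock}
  unused := ∅
  rule
    | .r0 => ⟨0, [], []⟩
    | .rLock => ⟨0, [], [.meth .lock]⟩
    | .rLU => ⟨1, [], [.meth .lock, .meth .unlock, .var 0]⟩
  last u :=
    if Contains .unlock u then .rLU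
    else if u ≠ [] then .rLock
    else .r0

end CoReg

/-!
A data-independent implementation consists of the renamings of its differentiated executions.
Hence a rule is co-regular as soon as some automaton that reads the values `0, 1, 2, 3` accepts a
colouring of each differentiated execution with a violation, and only colourings of executions of
implementations with a violation (`coRegularOn_of_recognizable`). It remains to express the
violations of each rule by recognizable properties of colourings.

An execution is regarded as a finite family of intervals, one for each operation (`History`). A
linearization is then an enumeration of the operations in which no operation returns before the call
of an earlier one (`History.Of.linearizable_proj_iff`).

* The rules `R₀` and `Enq` are never violated, and `Lock` is violated by any two `Lock`s of values
  that are not unlocked.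
* Violations of `WR`, `LU` and `EnqDeq` are due to a defect of a single value (it is read or removed
  without being inserted, or before that, or it is removed twice), or to two values neither of which
  can be placed first. For `WR` and `LU`, one of the two is the value with the first return, which
  precedes every value that is preceded at all (`exists_preceding_pair`). For `EnqDeq`, they are the
  value with the first return and the value with the first return of a `Deq` (`exists_enqDeq_pair`).
* The rules `DeqEmpty`, `PopEmpty` and `Push` put one operation `o` between two words, the first of
  which is matched. This is possible if and only if some point in time between the call and the
  return of `o` is not covered, that is, no value is certainly present then
  (`linearizable_mid_iff`). If all these points are covered, a cover with the least number of
  values has multiplicity at most two (`exists_minimal_cover`). Colouring its values alike, an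
  automaton that counts insertions minus removals needs to count up to two only, and recognizes that
  `o` is covered (`CoverWord`). Conversely, since each value is inserted once, a positive count means
  that some value is present (`covered_of_bal_pos`). For `Push`, the values of the cover have to be
  matched; if the automaton has counted a `Pop` without `Push` instead, a renaming that merges values
  leads to another execution of the implementation, which does have a violation
  (`exists_all_pops_pushed`).
* For `PushPop`, a value can be pushed first and popped at an uncovered time unless some operation
  returns before its `Push` is called, or its `Pop` is covered. If this fails for all values, then
  the value with the first return together with a minimal cover of the time from the call of its
  `Pop` to the first uncovered time is a violation that can be recognized as above
  (`exists_pushPopWord`): the values of the cover either are pushed after the first return, or have a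
  `Pop` that returns before the end of the cover.
-/

namespace CoReg

/-! ### Predicates on words decided by finite automata -/

/-- A predicate on words is recognizable if it is decided by a deterministic automaton with finitely
many states, given by its transition function, initial state and accepting states. -/
def Recognizable {α : Type} (P : List α → Prop) : Prop :=
  ∃ (σ : Type) (_ : Finite σ) (step : σ → α → σ) (s : σ) (acc : σ → Prop),
    ∀ w, P w ↔ acc (w.foldl step s)

namespace Recognizable

variable {α β : Type} {P Q : List α → Prop}

theorem const (p : Prop) : Recognizable (fun _ : List α => p) :=
  ⟨Unit, inferInstance, fun s _ => s, (), fun _ => p, fun _ => Iff.rfl⟩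

theorem not (h : Recognizable P) : Recognizable (fun w => ¬ P w) := by
  obtain ⟨σ, hσ, step, s, acc, h⟩ := h
  exact ⟨σ, hσ, step, s, fun q => ¬ acc q, fun w => not_congr (h w)⟩

theorem and (hP : Recognizable P) (hQ : Recognizable Q) :
    Recognizable (fun w => P w ∧ Q w) := by
  obtain ⟨σ, hσ, f, s, acc, h⟩ := hP
  obtain ⟨τ, hτ, g, t, acc', h'⟩ := hQ
  refine ⟨σ × τ, inferInstance, fun q a => (f q.1 a, g q.2 a), (s, t),
    fun q => acc q.1 ∧ acc' q.2, fun w => ?_⟩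
  have key : ∀ (w : List α) (s : σ) (t : τ),
      w.foldl (fun (q : σ × τ) a => (f q.1 a, g q.2 a)) (s, t) = (w.foldl f s, w.foldl g t) := by
    intro w
    induction w with
    | nil => intros; rfl
    | cons a w ih => intro s t; exact ih _ _
  beta_reduce
  rw [h, h', key]

theorem or (hP : Recognizable P) (hQ : Recognizable Q) :
    Recognizable (fun w => P w ∨ Q w) := by
  have := (hP.not.and hQ.not).not
  simpa only [← not_or, not_not] using this

theorem comap (f : β → α) (h : Recognizable P) : Recognizable (fun w => P (w.map f)) := by
  obtain ⟨σ, hσ, step, s, acc, h⟩ := h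
  refine ⟨σ, hσ, fun q b => step q (f b), s, acc, fun w => ?_⟩
  beta_reduce
  rw [h, List.foldl_map]

/-- The words having a prefix in `P` immediately followed by a letter in `K`. -/
theorem before (h : Recognizable P) (K : α → Prop) :
    Recognizable (fun w => ∃ n a, w[n]? = some a ∧ K a ∧ P (w.take n)) := by
  classical
  obtain ⟨σ, hσ, step, s, acc, h⟩ := h
  refine ⟨σ × Bool, inferInstance,
    fun q a => (step q.1 a, q.2 || decide (K a ∧ acc q.1)), (s, false), fun q => q.2 = true,
    fun w => ?_⟩
  have key : ∀ w : List α, w.foldl (fun (q : σ × Bool) a =>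
      (step q.1 a, q.2 || decide (K a ∧ acc q.1))) (s, false) =
      (w.foldl step s, decide (∃ n a, w[n]? = some a ∧ K a ∧ P (w.take n))) := by
    intro w
    induction w using List.reverseRecOn with
    | nil => simp
    | append_singleton w a ih =>
      rw [List.foldl_append, ih, List.foldl_append]
      simp only [List.foldl_cons, List.foldl_nil, Prod.mk.injEq, true_and]
      rw [Bool.eq_iff_iff]
      simp only [Bool.or_eq_true, decide_eq_true_eq, ← h]
      constructor
      · rintro (⟨n, b, hb, hK, hP⟩ | ⟨hK, hP⟩)
        · have hn : n < w.length := (List.getElem?_eq_some_iff.1 hb).1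
          refine ⟨n, b, ?_, hK, ?_⟩
          · rwa [List.getElem?_append_left hn]
          · rwa [List.take_append_of_le_length hn.le]
        · exact ⟨w.length, a, by simp, hK, by simpa using hP⟩
      · rintro ⟨n, b, hb, hK, hP⟩
        rcases lt_trichotomy n w.length with hn | rfl | hn
        · rw [List.getElem?_append_left hn] at hb
          rw [List.take_append_of_le_length hn.le] at hP
          exact Or.inl ⟨n, b, hb, hK, hP⟩
        · simp only [List.getElem?_concat_length, Option.some.injEq] at hb
          subst hb
          exact Or.inr ⟨hK, by simpa using hP⟩
        · rw [List.getElem?_eq_none (by simp; omega)] at hb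
          cases hb
  simp only [key, decide_eq_true_eq]

theorem hasLetter (K : α → Prop) : Recognizable (fun w => ∃ a ∈ w, K a) := by
  have := (const (α := α) True).before K
  simpa only [and_true, List.mem_iff_getElem?, exists_and_right, exists_comm] using this

theorem congr (h : Recognizable P) (hPQ : ∀ w, Q w ↔ P w) : Recognizable Q := by
  rwa [funext fun w => propext (hPQ w)]

/-- The words having a prefix (possibly the whole word) in `P`. -/
theorem exPrefix (h : Recognizable P) : Recognizable (fun w => ∃ n, P (w.take n)) := by
  refine (h.or (h.before fun _ => True)).congr fun w => ?_
  constructor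
  · rintro ⟨n, hn⟩
    rcases lt_or_ge n w.length with h | h
    · exact Or.inr ⟨n, _, List.getElem?_eq_getElem h, trivial, hn⟩
    · rw [List.take_of_length_le h] at hn
      exact Or.inl hn
  · rintro (h | ⟨n, a, _, _, h⟩)
    · exact ⟨w.length, by simpa using h⟩
    · exact ⟨n, h⟩

/-- A counter with increments in `K` and decrements in `K'` whose value has to remain in `{0, 1, 2}`
needs only finitely many states. -/
theorem counter (K K' : α → Bool) (F : ℤ → Prop) :
    Recognizable (fun w => (∀ n, 0 ≤ ((w.take n).countP K : ℤ) - (w.take n).countP K' ∧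
      ((w.take n).countP K : ℤ) - (w.take n).countP K' ≤ 2) ∧
      F ((w.countP K : ℤ) - w.countP K')) := by
  classical
  let I := {z : ℤ // 0 ≤ z ∧ z ≤ 2}
  have hI : Finite I := (Set.finite_Icc (0 : ℤ) 2)
  let tr : Option I → ℤ → Option I := fun q d =>
    q.bind fun z => if hz : 0 ≤ z.1 + d ∧ z.1 + d ≤ 2 then some ⟨z.1 + d, hz⟩ else none
  let d : α → ℤ := fun a => (if K a then 1 else 0) - (if K' a then 1 else 0)
  let B : List α → ℤ := fun w => (w.countP K : ℤ) - w.countP K'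
  have hB : ∀ w a, B (w ++ [a]) = B w + d a := by
    intro w a
    simp only [B, d, List.countP_append, List.countP_singleton]
    push_cast
    ring
  refine ⟨Option I, inferInstance, fun q a => tr q (d a), some ⟨0, by simp⟩,
    fun q => ∃ z, q = some z ∧ F z.1, fun w => ?_⟩
  have key : ∀ (w : List α) (z : I),
      w.foldl (fun q a => tr q (d a)) (some ⟨0, by simp⟩) = some z ↔
      (∀ n, 0 ≤ B (w.take n) ∧ B (w.take n) ≤ 2) ∧ B w = z.1 := by
    intro w
    induction w using List.reverseRecOn with
    | nil =>
      intro z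
      simp only [List.foldl_nil, Option.some.injEq]
      rw [Subtype.ext_iff (a1 := ⟨0, by simp⟩)]
      simp [B]
    | append_singleton w a ih =>
      intro z
      rw [List.foldl_append, List.foldl_cons, List.foldl_nil, Option.bind_eq_some_iff]
      constructor
      · rintro ⟨y, hy, hz⟩
        obtain ⟨h1, h2⟩ := (ih y).1 hy
        split_ifs at hz with hd
        have hz' : y.1 + d a = z.1 := by
          rw [Option.some.injEq] at hz
          rw [← hz]
        refine ⟨fun n => ?_, by rw [hB, h2, hz']⟩
        rcases le_or_gt n w.length with hn | hn
        · rw [List.take_append_of_le_length hn]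
          exact h1 n
        · rw [List.take_of_length_le (by simp; omega), hB, h2]
          exact hd
      · rintro ⟨h1, h2⟩
        have h3 : ∀ n, 0 ≤ B (w.take n) ∧ B (w.take n) ≤ 2 := by
          intro n
          have := h1 (min n w.length)
          rw [List.take_append_of_le_length (by simp)] at this
          rcases le_total n w.length with hn | hn
          · rwa [min_eq_left hn] at this
          · rw [min_eq_right hn, List.take_length] at this
            rwa [List.take_of_length_le hn]
        have h4 := h3 w.length
        rw [List.take_length] at h4
        refine ⟨⟨B w, h4⟩, (ih _).2 ⟨h3, rfl⟩, ?_⟩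
        rw [hB] at h2
        have : 0 ≤ B w + d a ∧ B w + d a ≤ 2 := by rw [h2]; exact z.2
        simp only [this, and_self, dite_true]
        exact congrArg some (Subtype.ext h2)
  constructor
  · rintro ⟨h1, h2⟩
    have h4 := h1 w.length
    rw [List.take_length] at h4
    exact ⟨⟨B w, h4⟩, (key w _).2 ⟨h1, rfl⟩, h2⟩
  · rintro ⟨z, hz, hF⟩
    obtain ⟨h1, h2⟩ := (key w z).1 hz
    exact ⟨h1, by rw [← h2] at hF; exact hF⟩

end Recognizable

/-! ### Executions as finite families of intervals -/

/-- An execution seen as a finite set of operations, each with a method, a data value, and the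
positions of its call (`inv`) and of its return (`res`). The values of the functions outside `ops`
are irrelevant. -/
structure History (M O : Type*) where
  ops : Finset O
  meth : O → M
  val : O → ℕ
  inv : O → ℕ
  res : O → ℕ

namespace History

variable {M : Type} {O : Type*} {e : List (Action M ℕ O)} {h : History M O}

/-- The method event of an operation. -/
def lab (h : History M O) (o : O) : Event M := (h.meth o, h.val o)

/-- `h` lists the operations of the execution `e`. -/
structure Of (h : History M O) (e : List (Action M ℕ O)) : Prop where
  call_iff : ∀ n o m x, e[n]? = some (Action.call o m x) ↔
    o ∈ h.ops ∧ h.inv o = n ∧ h.meth o = m ∧ h.val o = x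
  ret_iff : ∀ n o m x, e[n]? = some (Action.ret o m x) ↔
    o ∈ h.ops ∧ h.res o = n ∧ h.meth o = m ∧ h.val o = x
  inv_lt_res : ∀ o ∈ h.ops, h.inv o < h.res o

theorem Of.call (H : h.Of e) {o : O} (ho : o ∈ h.ops) :
    e[h.inv o]? = some (Action.call o (h.meth o) (h.val o)) :=
  (H.call_iff _ _ _ _).2 ⟨ho, rfl, rfl, rfl⟩

theorem Of.ret (H : h.Of e) {o : O} (ho : o ∈ h.ops) :
    e[h.res o]? = some (Action.ret o (h.meth o) (h.val o)) :=
  (H.ret_iff _ _ _ _).2 ⟨ho, rfl, rfl, rfl⟩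

theorem Of.inv_inj (H : h.Of e) {o o' : O} (ho : o ∈ h.ops) (ho' : o' ∈ h.ops)
    (heq : h.inv o = h.inv o') : o = o' := by
  have h1 := H.call ho
  rw [heq, H.call ho'] at h1
  simp only [Option.some.injEq, Action.call.injEq] at h1
  exact h1.1.symm

theorem Of.res_inj (H : h.Of e) {o o' : O} (ho : o ∈ h.ops) (ho' : o' ∈ h.ops)
    (heq : h.res o = h.res o') : o = o' := by
  have h1 := H.ret ho
  rw [heq, H.ret ho'] at h1
  simp only [Option.some.injEq, Action.ret.injEq] at h1
  exact h1.1.symm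

theorem Of.inv_ne_res (H : h.Of e) {o o' : O} (ho : o ∈ h.ops) (ho' : o' ∈ h.ops) :
    h.inv o ≠ h.res o' := by
  intro heq
  have h1 := H.call ho
  rw [heq, H.ret ho'] at h1
  cases h1

theorem Of.res_lt_length (H : h.Of e) {o : O} (ho : o ∈ h.ops) : h.res o < e.length :=
  (List.getElem?_eq_some_iff.1 (H.ret ho)).1

theorem Of.mem_iff (H : h.Of e) (o : O) (m : M) (x : ℕ) :
    Action.call o m x ∈ e ↔ o ∈ h.ops ∧ h.meth o = m ∧ h.val o = x := by
  rw [List.mem_iff_getElem?]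
  simp only [H.call_iff]
  constructor
  · rintro ⟨n, h1, _, h2⟩
    exact ⟨h1, h2⟩
  · rintro ⟨h1, h2⟩
    exact ⟨_, h1, rfl, h2⟩

theorem eq_of_nodup_filter {α β : Type*} {l : List α} {p : α → Bool} {f : α → β}
    (hl : ((l.filter p).map f).Nodup) {i j : ℕ} {a b : α} (ha : l[i]? = some a)
    (hb : l[j]? = some b) (pa : p a) (pb : p b) (hab : f a = f b) : i = j := by
  rw [List.Nodup, List.pairwise_map, List.pairwise_filter, List.pairwise_iff_getElem] at hl
  obtain ⟨hi, rfl⟩ := List.getElem?_eq_some_iff.1 ha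
  obtain ⟨hj, rfl⟩ := List.getElem?_eq_some_iff.1 hb
  rcases lt_trichotomy i j with hij | hij | hij
  · exact absurd hab (hl i j hi hj hij pa pb)
  · exact hij
  · exact absurd hab.symm (hl j i hj hi hij pb pa)

/-- Every well-formed execution is described by a history. -/
theorem exists_of [Inhabited M] (he : IsExecution e) : ∃ h : History M O, h.Of e := by
  classical
  obtain ⟨hc, hr, hrc, hcr⟩ := he
  have hcu : ∀ {i j : ℕ} {o : O} {m : M} {x : ℕ} {m' : M} {x' : ℕ}, e[i]? = some (Action.call o m x) →
      e[j]? = some (Action.call o m' x') → i = j := fun h1 h2 =>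
    eq_of_nodup_filter hc h1 h2 rfl rfl rfl
  have hru : ∀ {i j : ℕ} {o : O} {m : M} {x : ℕ} {m' : M} {x' : ℕ}, e[i]? = some (Action.ret o m x) →
      e[j]? = some (Action.ret o m' x') → i = j := fun h1 h2 =>
    eq_of_nodup_filter hr h1 h2 rfl rfl rfl
  have hrc' : ∀ {j : ℕ} {o : O} {m : M} {x : ℕ}, e[j]? = some (Action.ret o m x) →
      ∃ i < j, e[i]? = some (Action.call o m x) := by
    intro j o m x hj
    obtain ⟨hlt, hj⟩ := List.getElem?_eq_some_iff.1 hj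
    have := hrc (e.take j) (e.drop (j + 1)) o m x (by
      rw [← hj, List.cons_getElem_drop_succ, List.take_append_drop])
    obtain ⟨i, hi⟩ := List.mem_iff_getElem?.1 this
    rw [List.getElem?_take] at hi
    split_ifs at hi with hij
    exact ⟨i, hij, hi⟩
  have hex : ∀ o : O, ∃ (m : M) (x i j : ℕ), o ∈ CoReg.ops e →
      e[i]? = some (Action.call o m x) ∧ e[j]? = some (Action.ret o m x) ∧ i < j := by
    intro o
    by_cases ho : o ∈ CoReg.ops e
    · obtain ⟨m, x, hm⟩ := ho
      obtain ⟨j, hj⟩ := List.mem_iff_getElem?.1 (hcr o m x hm)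
      obtain ⟨i, hij, hi⟩ := hrc' hj
      exact ⟨m, x, i, j, fun _ => ⟨hi, hj, hij⟩⟩
    · exact ⟨default, 0, 0, 0, fun h => absurd h ho⟩
  choose mt vl iv rs hh using hex
  have hfin : (CoReg.ops e).Finite := by
    refine (e.map Action.op).toFinset.finite_toSet.subset ?_
    rintro o ⟨m, x, ho⟩
    simp only [List.coe_toFinset, Set.mem_ofPred_eq, List.mem_map]
    exact ⟨_, ho, rfl⟩
  refine ⟨⟨hfin.toFinset, mt, vl, iv, rs⟩, ?_, ?_, ?_⟩
  · intro n o m x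
    simp only [Set.Finite.mem_toFinset]
    constructor
    · intro hn
      have ho : o ∈ CoReg.ops e := ⟨m, x, List.mem_iff_getElem?.2 ⟨n, hn⟩⟩
      have h1 := (hh o ho).1
      obtain rfl := hcu h1 hn
      rw [h1] at hn
      simp only [Option.some.injEq, Action.call.injEq, true_and] at hn
      exact ⟨ho, rfl, hn⟩
    · rintro ⟨ho, rfl, rfl, rfl⟩
      exact (hh o ho).1
  · intro n o m x
    simp only [Set.Finite.mem_toFinset]
    constructor
    · intro hn
      obtain ⟨i, _, hi⟩ := hrc' hn
      have ho : o ∈ CoReg.ops e := ⟨m, x, List.mem_iff_getElem?.2 ⟨i, hi⟩⟩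
      have h1 := (hh o ho).2.1
      obtain rfl := hru h1 hn
      rw [h1] at hn
      simp only [Option.some.injEq, Action.ret.injEq, true_and] at hn
      exact ⟨ho, rfl, hn⟩
    · rintro ⟨ho, rfl, rfl, rfl⟩
      exact (hh o ho).2.1
  · intro o ho
    exact (hh o (hfin.mem_toFinset.1 ho)).2.2

/-! ### Projections and linearizations -/

theorem mem_proj {D : Set ℕ} {a : Action M ℕ O} : a ∈ proj D e ↔ a ∈ e ∧ a.val ∈ D := by
  simp [proj]

theorem happensBefore_iff_sublist {o₁ o₂ : O} : HappensBefore e o₁ o₂ ↔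
    ∃ m₁ x₁ m₂ x₂, [Action.ret o₁ m₁ x₁, Action.call o₂ m₂ x₂].Sublist e := by
  constructor
  · rintro ⟨e₁, e₂, e₃, m₁, x₁, m₂, x₂, rfl⟩
    refine ⟨m₁, x₁, m₂, x₂, ?_⟩
    rw [List.append_assoc, List.cons_append]
    exact ((((List.nil_sublist e₃).cons_cons _).trans (List.sublist_append_right e₂ _)).cons_cons _).trans
      (List.sublist_append_right e₁ _)
  · rintro ⟨m₁, x₁, m₂, x₂, hs⟩
    obtain ⟨r₁, r₂, rfl, h1, h2⟩ := List.cons_sublist_iff.1 hs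
    obtain ⟨s₁, s₂, rfl⟩ := List.append_of_mem h1
    obtain ⟨t₁, t₂, rfl⟩ := List.append_of_mem (List.singleton_sublist.1 h2)
    exact ⟨s₁, s₂ ++ t₁, t₂, m₁, x₁, m₂, x₂, by simp⟩

theorem Of.happensBefore_proj (H : h.Of e) (D : Set ℕ) (o₁ o₂ : O) :
    HappensBefore (proj D e) o₁ o₂ ↔ (o₁ ∈ h.ops ∧ h.val o₁ ∈ D) ∧ (o₂ ∈ h.ops ∧ h.val o₂ ∈ D) ∧
      h.res o₁ < h.inv o₂ := by
  classical
  have hpair : ∀ a b : Action M ℕ O, [a, b].Sublist (proj D e) ↔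
      a.val ∈ D ∧ b.val ∈ D ∧ [a, b].Sublist e := by
    intro a b
    constructor
    · intro hs
      have ha := hs.subset (a := a) (by simp)
      have hb := hs.subset (a := b) (by simp)
      rw [mem_proj] at ha hb
      exact ⟨ha.2, hb.2, hs.trans List.filter_sublist⟩
    · rintro ⟨ha, hb, hs⟩
      have := hs.filter (fun a => decide (a.val ∈ D))
      simpa [ha, hb, proj] using this
  have hidx : ∀ a b : Action M ℕ O, [a, b].Sublist e ↔
      ∃ i j : ℕ, i < j ∧ e[i]? = some a ∧ e[j]? = some b := by
    intro a b
    constructor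
    · intro hs
      obtain ⟨r₁, r₂, rfl, h1, h2⟩ := List.cons_sublist_iff.1 hs
      obtain ⟨i, hi⟩ := List.mem_iff_getElem?.1 h1
      obtain ⟨j, hj⟩ := List.mem_iff_getElem?.1 (List.singleton_sublist.1 h2)
      have hi' := (List.getElem?_eq_some_iff.1 hi).1
      refine ⟨i, r₁.length + j, by omega, ?_, ?_⟩
      · rwa [List.getElem?_append_left hi']
      · rwa [List.getElem?_append_right (by omega), Nat.add_sub_cancel_left]
    · rintro ⟨i, j, hij, hi, hj⟩
      rw [← List.take_append_drop (i + 1) e]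
      refine List.cons_sublist_iff.2 ⟨_, _, rfl, ?_, List.singleton_sublist.2 ?_⟩
      · exact List.mem_iff_getElem?.2 ⟨i, by rw [List.getElem?_take, if_pos (by omega), hi]⟩
      · refine List.mem_iff_getElem?.2 ⟨j - (i + 1), ?_⟩
        rw [List.getElem?_drop, Nat.add_sub_cancel' hij, hj]
  rw [happensBefore_iff_sublist]
  simp only [hpair, hidx, H.call_iff, H.ret_iff, Action.val]
  constructor
  · rintro ⟨_, _, _, _, h1, h2, i, j, hij, ⟨ho1, rfl, rfl, rfl⟩, ⟨ho2, rfl, rfl, rfl⟩⟩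
    exact ⟨⟨ho1, h1⟩, ⟨ho2, h2⟩, hij⟩
  · rintro ⟨⟨ho1, h1⟩, ⟨ho2, h2⟩, hij⟩
    exact ⟨_, _, _, _, h1, h2, _, _, hij, ⟨ho1, rfl, rfl, rfl⟩, ⟨ho2, rfl, rfl, rfl⟩⟩

theorem Of.mem_ops_proj (H : h.Of e) (D : Set ℕ) (o : O) :
    o ∈ CoReg.ops (proj D e) ↔ o ∈ h.ops ∧ h.val o ∈ D := by
  simp only [CoReg.ops, Set.mem_ofPred_eq, mem_proj, H.mem_iff, Action.val]
  constructor
  · rintro ⟨_, _, ⟨h1, rfl, rfl⟩, h2⟩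
    exact ⟨h1, h2⟩
  · rintro ⟨h1, h2⟩
    exact ⟨_, _, ⟨h1, rfl, rfl⟩, h2⟩

/-- `L` lists the operations of `h` with values in `D`, each one once. -/
def Lists (h : History M O) (D : Set ℕ) (L : List O) : Prop :=
  L.Nodup ∧ ∀ o, o ∈ L ↔ o ∈ h.ops ∧ h.val o ∈ D

/-- The order of `L` respects happens-before. -/
def Respects (h : History M O) (L : List O) : Prop :=
  L.Pairwise fun a b => ¬ h.res b < h.inv a

theorem Of.linearizable_proj_iff (H : h.Of e) (D : Set ℕ) (U : Set (List (Event M))) :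
    Linearizable (proj D e) U ↔ ∃ L, h.Lists D L ∧ h.Respects L ∧ L.map h.lab ∈ U := by
  classical
  constructor
  · rintro ⟨u, hu, f, hf1, hf2⟩
    have hlab : ∀ i, u.get i = h.lab (f.symm i : O) := by
      intro i
      obtain ⟨ho, hD⟩ := (H.mem_ops_proj D _).1 (f.symm i).2
      have := hf2 (f.symm i) (h.meth (f.symm i)) (h.val (f.symm i)) (by
        rw [mem_proj, H.mem_iff]
        exact ⟨⟨ho, rfl, rfl⟩, hD⟩)
      rwa [Equiv.apply_symm_apply] at this
    refine ⟨List.ofFn fun i => (f.symm i : O), ⟨?_, ?_⟩, ?_, ?_⟩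
    · rw [List.nodup_ofFn]
      exact Subtype.val_injective.comp f.symm.injective
    · intro o
      rw [List.mem_ofFn, ← H.mem_ops_proj]
      constructor
      · rintro ⟨i, rfl⟩
        exact (f.symm i).2
      · intro ho
        exact ⟨f ⟨o, ho⟩, by simp⟩
    · rw [Respects, List.pairwise_ofFn]
      intro i j hij hlt
      have := hf1 (f.symm j) (f.symm i) ((H.happensBefore_proj D _ _).2
        ⟨(H.mem_ops_proj D _).1 (f.symm j).2, (H.mem_ops_proj D _).1 (f.symm i).2, hlt⟩)
      simp only [Equiv.apply_symm_apply] at this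
      exact absurd this hij.asymm
    · rw [List.map_ofFn]
      have : h.lab ∘ (fun i => (f.symm i : O)) = u.get := funext fun i => (hlab i).symm
      rwa [this, List.ofFn_get]
  · rintro ⟨L, ⟨hnd, hmem⟩, hR, hU⟩
    let g : CoReg.ops (proj D e) ≃ {o // o ∈ L} := Equiv.subtypeEquivRight fun o => by
      rw [hmem, ← H.mem_ops_proj]
    let c : Fin L.length ≃ Fin (L.map h.lab).length := finCongr (by simp)
    refine ⟨_, hU, (g.trans (hnd.getEquiv L).symm).trans c, ?_, ?_⟩
    · intro o₁ o₂ hb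
      rw [H.happensBefore_proj] at hb
      have h1 : ∀ o : CoReg.ops (proj D e), L.get ((hnd.getEquiv L).symm (g o)) = o := by
        intro o
        have := congrArg Subtype.val ((hnd.getEquiv L).apply_symm_apply (g o))
        exact this
      rw [Respects, List.pairwise_iff_get] at hR
      have h2 : (hnd.getEquiv L).symm (g o₁) < (hnd.getEquiv L).symm (g o₂) := by
        by_contra hcon
        rcases (not_lt.1 hcon).lt_or_eq with hlt | heq
        · have := hR _ _ hlt
          rw [h1, h1] at this
          exact this hb.2.2
        · have h3 := h1 o₁
          rw [← heq, h1] at h3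
          have := H.inv_lt_res _ hb.1.1
          rw [h3] at hb
          omega
      exact h2
    · intro o m x ho
      rw [mem_proj, H.mem_iff] at ho
      obtain ⟨⟨_, rfl, rfl⟩, _⟩ := ho
      have h1 : L.get ((hnd.getEquiv L).symm (g o)) = o := by
        have := congrArg Subtype.val ((hnd.getEquiv L).apply_symm_apply (g o))
        exact this
      simp only [List.get_eq_getElem, List.getElem_map, c, Equiv.trans_apply, finCongr_apply,
        Fin.val_cast]
      rw [List.get_eq_getElem] at h1
      rw [h1]
      rfl

theorem events_eq_map (e : List (Action M ℕ O)) (h : History M O)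
    (hl : ∀ o m x, Action.call o m x ∈ e → h.lab o = (m, x)) :
    events e = ((e.filter fun a => a.isCall).map Action.op).map h.lab := by
  induction e with
  | nil => rfl
  | cons a e ih =>
    have ih := ih fun o m x ho => hl o m x (List.mem_cons_of_mem _ ho)
    cases a with
    | call o m x =>
      have := hl o m x (by simp)
      simp [events, Action.isCall, Action.op, this] at ih ⊢
      exact ih
    | ret o m x => simpa [events, Action.isCall, Action.op] using ih

theorem Of.exists_events_proj (H : h.Of e) (D : Set ℕ) :
    ∃ L, h.Lists D L ∧ events (proj D e) = L.map h.lab := by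
  classical
  refine ⟨_, ⟨?_, ?_⟩, events_eq_map (proj D e) h ?_⟩
  · rw [List.Nodup, List.pairwise_map, List.pairwise_filter, proj, List.pairwise_filter,
      List.pairwise_iff_getElem]
    intro i j hi hj hij _ _ hci hcj heq
    have h1 := List.getElem?_eq_getElem hi
    have h2 := List.getElem?_eq_getElem hj
    generalize e[i] = a at *
    generalize e[j] = b at *
    cases a with
    | ret => simp [Action.isCall] at hci
    | call o m x =>
      cases b with
      | ret => simp [Action.isCall] at hcj
      | call o' m' x' =>
        simp only [Action.op] at heq
        subst heq
        have h3 := ((H.call_iff _ _ _ _).1 h1).2.1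
        have h4 := ((H.call_iff _ _ _ _).1 h2).2.1
        omega
  · intro o
    rw [← H.mem_ops_proj, List.mem_map]
    simp only [CoReg.ops, Set.mem_ofPred_eq, List.mem_filter]
    constructor
    · rintro ⟨a, ⟨h1, h2⟩, rfl⟩
      cases a with
      | call o m x => exact ⟨m, x, h1⟩
      | ret o m x => simp [Action.isCall] at h2
    · rintro ⟨m, x, h1⟩
      exact ⟨_, ⟨h1, rfl⟩, rfl⟩
  · intro o m x ho
    rw [mem_proj, H.mem_iff] at ho
    obtain ⟨⟨_, rfl, rfl⟩, _⟩ := ho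
    rfl

theorem proj_univ (e : List (Action M ℕ O)) : proj Set.univ e = e := by
  simp [proj]

theorem contains_map {L : List O} {m : M} :
    Contains m (L.map h.lab) ↔ ∃ o ∈ L, h.meth o = m := by
  simp only [Contains, List.mem_map, lab, Prod.mk.injEq]
  constructor
  · rintro ⟨x, o, ho, hm, _⟩
    exact ⟨o, ho, hm⟩
  · rintro ⟨o, ho, hm⟩
    exact ⟨_, o, ho, hm, rfl⟩

/-- Positions of `L.map f` correspond to elements of the duplicate-free list `L`. -/
theorem exists_equiv_of_nodup {α β : Type*} {L : List α} (hL : L.Nodup) (f : α → β) :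
    ∃ g : Fin (L.map f).length ≃ {a // a ∈ L}, ∀ i, (L.map f).get i = f (g i) := by
  classical
  refine ⟨(finCongr (by simp)).trans (hL.getEquiv L), fun i => ?_⟩
  simp

theorem matched_map {L : List O} (hL : L.Nodup) {m : M} :
    Matched m (L.map h.lab) ↔
      ∀ o ∈ L, h.meth o = m → ∃ o' ∈ L, o' ≠ o ∧ h.val o' = h.val o := by
  obtain ⟨g, hg⟩ := exists_equiv_of_nodup hL h.lab
  simp only [Matched, hg]
  rw [g.forall_congr_left]
  simp only [Equiv.apply_symm_apply, Subtype.forall]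
  refine forall_congr' fun o => forall_congr' fun ho => imp_congr Iff.rfl ?_
  rw [g.exists_congr_left]
  simp only [Equiv.apply_symm_apply, Subtype.exists, ne_eq, EmbeddingLike.apply_eq_iff_eq,
    Subtype.mk.injEq, exists_and_left, exists_prop, lab]
  exact exists_congr fun o' => by tauto

theorem forall_get_eq_map {L : List O} (hL : L.Nodup) {β γ : Type*} (f : O → β) (k : β → γ)
    (P : β → Prop) :
    (∀ i j : Fin (L.map f).length, P ((L.map f).get i) →
      k ((L.map f).get i) = k ((L.map f).get j) → i = j) ↔
    ∀ o ∈ L, ∀ o' ∈ L, P (f o) → k (f o) = k (f o') → o = o' := by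
  obtain ⟨g, hg⟩ := exists_equiv_of_nodup hL f
  simp only [hg]
  rw [g.forall_congr_left]
  simp only [Equiv.apply_symm_apply, Subtype.forall]
  refine forall_congr' fun o => forall_congr' fun ho => ?_
  rw [g.forall_congr_left]
  simp only [Equiv.apply_symm_apply, Subtype.forall, EmbeddingLike.apply_eq_iff_eq,
    Subtype.mk.injEq]

theorem Of.differentiated_iff {ι : Type} (S : DataStructure M ι) (H : h.Of e) :
    S.Differentiated (events e) ↔
      (∀ o ∈ h.ops, ∀ o' ∈ h.ops, h.meth o ∈ S.input → h.lab o = h.lab o' → o = o') ∧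
      (∀ o ∈ h.ops, ∀ o' ∈ h.ops, h.meth o ∈ S.unused → h.val o = h.val o' → o = o') := by
  obtain ⟨L, ⟨hL, hmem⟩, he⟩ := H.exists_events_proj Set.univ
  rw [proj_univ] at he
  simp only [Set.mem_univ, and_true] at hmem
  rw [he]
  have h1 := forall_get_eq_map hL h.lab id (fun p => p.1 ∈ S.input)
  have h2 := forall_get_eq_map hL h.lab Prod.snd (fun p => p.1 ∈ S.unused)
  simp only [hmem] at h1 h2
  exact and_congr h1 h2

theorem Of.atMostOnce_iff (m : M) (H : h.Of e) :
    (∀ i j : Fin (events e).length,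
      ((events e).get i).1 = m → (events e).get i = (events e).get j → i = j) ↔
      ∀ o ∈ h.ops, ∀ o' ∈ h.ops, h.meth o = m → h.lab o = h.lab o' → o = o' := by
  obtain ⟨L, ⟨hL, hmem⟩, he⟩ := H.exists_events_proj Set.univ
  rw [proj_univ] at he
  simp only [Set.mem_univ, and_true] at hmem
  rw [he]
  have h1 := forall_get_eq_map hL h.lab id (fun p => p.1 = m)
  simp only [hmem] at h1
  exact h1

/-- The history of a renamed execution. -/
def rename (r : ℕ → ℕ) (h : History M O) : History M O := { h with val := fun o => r (h.val o) }

theorem Of.rename (H : h.Of e) (r : ℕ → ℕ) : (h.rename r).Of (CoReg.rename r e) := by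
  refine ⟨fun n o m x => ?_, fun n o m x => ?_, H.inv_lt_res⟩
  · simp only [CoReg.rename, List.getElem?_map, Option.map_eq_some_iff]
    constructor
    · rintro ⟨a, ha, heq⟩
      cases a with
      | ret => cases heq
      | call o' m' x' =>
        simp only [Action.map, id, Action.call.injEq] at heq
        obtain ⟨rfl, rfl, rfl⟩ := heq
        obtain ⟨h1, h2, h3, rfl⟩ := (H.call_iff _ _ _ _).1 ha
        exact ⟨h1, h2, h3, rfl⟩
    · rintro ⟨h1, h2, h3, rfl⟩
      exact ⟨_, (H.call_iff _ _ _ _).2 ⟨h1, h2, h3, rfl⟩, rfl⟩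
  · simp only [CoReg.rename, List.getElem?_map, Option.map_eq_some_iff]
    constructor
    · rintro ⟨a, ha, heq⟩
      cases a with
      | call => cases heq
      | ret o' m' x' =>
        simp only [Action.map, id, Action.ret.injEq] at heq
        obtain ⟨rfl, rfl, rfl⟩ := heq
        obtain ⟨h1, h2, h3, rfl⟩ := (H.ret_iff _ _ _ _).1 ha
        exact ⟨h1, h2, h3, rfl⟩
    · rintro ⟨h1, h2, h3, rfl⟩
      exact ⟨_, (H.ret_iff _ _ _ _).2 ⟨h1, h2, h3, rfl⟩, rfl⟩

end History

/-! ### Matching sets of the rules -/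

theorem seqProj_eq_self {M : Type} {x : ℕ} {u : List (Event M)} (hu : ∀ p ∈ u, p.2 ≠ x) :
    seqProj {x}ᶜ u = u := by
  simpa [seqProj] using hu

theorem ne_of_seqProj_eq {M : Type} {x : ℕ} {u w : List (Event M)} (h : u = seqProj {x}ᶜ w) :
    ∀ p ∈ u, p.2 ≠ x := by
  subst h
  intro p hp
  simp only [seqProj, List.mem_filter] at hp
  simpa using hp.2

theorem seqProj_append {M : Type} {D : Set ℕ} (u v : List (Event M)) :
    seqProj D (u ++ v) = seqProj D u ++ seqProj D v := by
  simp [seqProj]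

theorem seqProj_replicate {M : Type} {x : ℕ} (n : ℕ) (m : M) :
    seqProj {x}ᶜ (List.replicate n (m, x)) = [] := by
  simp [seqProj]

theorem seqProj_cons_self {M : Type} {x : ℕ} (m : M) (u : List (Event M)) :
    seqProj {x}ᶜ ((m, x) :: u) = seqProj {x}ᶜ u := by
  simp [seqProj]

theorem mem_den_var {M : Type} {us : ℕ → List (Event M)} {x i : ℕ} {w : List (Event M)} :
    w ∈ Term.den us x (.var i) ↔ w = us i :=
  Iff.rfl

theorem mem_den_meth {M : Type} {us : ℕ → List (Event M)} {x : ℕ} {m : M} {w : List (Event M)} :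
    w ∈ Term.den us x (.meth m) ↔ w = [(m, x)] :=
  Iff.rfl

theorem mem_den_star {M : Type} {us : ℕ → List (Event M)} {x : ℕ} {m : M} {w : List (Event M)} :
    w ∈ Term.den us x (.star m) ↔ ∃ n, w = List.replicate n (m, x) :=
  Iff.rfl

/-- A rule with expression `u · m · v`. -/
theorem mem_matchingSet_mid {M : Type} {g : List (Atom M)} {m : M} {w : List (Event M)} :
    w ∈ (Rule.mk 2 g [.var 0, .meth m, .var 1]).matchingSet ↔
      ∃ us x, (∀ a ∈ g, a.Holds us) ∧ w = us 0 ++ (m, x) :: us 1 ∧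
        (∀ p ∈ us 0, p.2 ≠ x) ∧ ∀ p ∈ us 1, p.2 ≠ x := by
  simp only [Rule.matchingSet, Rule.Matches, Set.mem_ofPred_eq]
  constructor
  · rintro ⟨x, us, hg, hp, hw⟩
    have := ne_of_seqProj_eq hp
    simp only [List.range_succ, List.range_zero, List.nil_append, List.cons_append,
      List.map_cons, List.map_nil, List.flatten_cons, List.flatten_nil, List.append_nil,
      List.mem_append, or_imp, forall_and] at this
    refine ⟨us, x, hg, ?_, this⟩
    simpa [mem_den_var, mem_den_meth, Language.mem_mul, eq_comm] using hw
  · rintro ⟨us, x, hg, rfl, h0, h1⟩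
    refine ⟨x, us, hg, ?_, ?_⟩
    · rw [seqProj_append, seqProj_cons_self, seqProj_eq_self h0, seqProj_eq_self h1]
      simp [List.range_succ]
    · simp [mem_den_var, mem_den_meth, Language.mem_mul]

/-- A rule with expression `m · u · m' · v`. -/
theorem mem_matchingSet_pair {M : Type} {g : List (Atom M)} {m m' : M} {w : List (Event M)} :
    w ∈ (Rule.mk 2 g [.meth m, .var 0, .meth m', .var 1]).matchingSet ↔
      ∃ us x, (∀ a ∈ g, a.Holds us) ∧ w = (m, x) :: (us 0 ++ (m', x) :: us 1) ∧
        (∀ p ∈ us 0, p.2 ≠ x) ∧ ∀ p ∈ us 1, p.2 ≠ x := by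
  simp only [Rule.matchingSet, Rule.Matches, Set.mem_ofPred_eq]
  constructor
  · rintro ⟨x, us, hg, hp, hw⟩
    have := ne_of_seqProj_eq hp
    simp only [List.range_succ, List.range_zero, List.nil_append, List.cons_append,
      List.map_cons, List.map_nil, List.flatten_cons, List.flatten_nil, List.append_nil,
      List.mem_append, or_imp, forall_and] at this
    refine ⟨us, x, hg, ?_, this⟩
    simpa [mem_den_var, mem_den_meth, Language.mem_mul, eq_comm] using hw
  · rintro ⟨us, x, hg, rfl, h0, h1⟩
    refine ⟨x, us, hg, ?_, ?_⟩
    · rw [seqProj_cons_self, seqProj_append, seqProj_cons_self, seqProj_eq_self h0,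
        seqProj_eq_self h1]
      simp [List.range_succ]
    · simp [mem_den_var, mem_den_meth, Language.mem_mul]

theorem mem_matchingSet_nil {M : Type} {w : List (Event M)} :
    w ∈ (Rule.mk 0 [] [] : Rule M).matchingSet ↔ w = [] := by
  simp only [Rule.matchingSet, Rule.Matches, Set.mem_ofPred_eq]
  constructor
  · rintro ⟨x, us, hg, hp, hw⟩
    simpa using hw
  · rintro rfl
    exact ⟨0, fun _ => [], by simp, by simp [seqProj], by simp⟩

theorem mem_matchingSet_single {M : Type} {m : M} {w : List (Event M)} :
    w ∈ (Rule.mk 0 [] [.meth m] : Rule M).matchingSet ↔ ∃ x, w = [(m, x)] := by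
  simp only [Rule.matchingSet, Rule.Matches, Set.mem_ofPred_eq]
  constructor
  · rintro ⟨x, us, hg, hp, hw⟩
    exact ⟨x, by simpa [mem_den_meth] using hw⟩
  · rintro ⟨x, rfl⟩
    exact ⟨x, fun _ => [], by simp, by simp [seqProj], by simp [mem_den_meth]⟩

/-- A rule with expression `m · m' · u`. -/
theorem mem_matchingSet_two {M : Type} {m m' : M} {w : List (Event M)} :
    w ∈ (Rule.mk 1 [] [.meth m, .meth m', .var 0] : Rule M).matchingSet ↔
      ∃ x u, w = (m, x) :: (m', x) :: u ∧ ∀ p ∈ u, p.2 ≠ x := by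
  simp only [Rule.matchingSet, Rule.Matches, Set.mem_ofPred_eq]
  constructor
  · rintro ⟨x, us, hg, hp, hw⟩
    have := ne_of_seqProj_eq hp
    exact ⟨x, us 0, by simpa [mem_den_var, mem_den_meth, Language.mem_mul, eq_comm] using hw,
      by simpa [List.range_succ] using this⟩
  · rintro ⟨x, u, rfl, h0⟩
    refine ⟨x, fun _ => u, by simp, ?_, ?_⟩
    · rw [seqProj_cons_self, seqProj_cons_self, seqProj_eq_self h0]
      simp [List.range_succ]
    · simp [mem_den_var, mem_den_meth, Language.mem_mul]

/-- A rule with expression `m · m'* · u`. -/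
theorem mem_matchingSet_star {M : Type} {m m' : M} {w : List (Event M)} :
    w ∈ (Rule.mk 1 [] [.meth m, .star m', .var 0] : Rule M).matchingSet ↔
      ∃ x n u, w = (m, x) :: (List.replicate n (m', x) ++ u) ∧ ∀ p ∈ u, p.2 ≠ x := by
  simp only [Rule.matchingSet, Rule.Matches, Set.mem_ofPred_eq]
  constructor
  · rintro ⟨x, us, hg, hp, hw⟩
    have := ne_of_seqProj_eq hp
    simp only [List.map_cons, List.map_nil, List.prod_cons, List.prod_nil, mul_one,
      Language.mem_mul, mem_den_var, mem_den_meth, mem_den_star] at hw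
    obtain ⟨a, rfl, b, ⟨c, ⟨n, rfl⟩, d, rfl, rfl⟩, rfl⟩ := hw
    exact ⟨x, n, us 0, by simp, by simpa [List.range_succ] using this⟩
  · rintro ⟨x, n, u, rfl, h0⟩
    refine ⟨x, fun _ => u, by simp, ?_, ?_⟩
    · rw [seqProj_cons_self, seqProj_append, seqProj_replicate, seqProj_eq_self h0]
      simp [List.range_succ]
    · simp only [List.map_cons, List.map_nil, List.prod_cons, List.prod_nil, mul_one,
        Language.mem_mul, mem_den_var, mem_den_meth, mem_den_star]
      exact ⟨[(m, x)], rfl, _, ⟨_, ⟨n, rfl⟩, u, rfl, rfl⟩, rfl⟩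

/-- A rule with expression `u · m`. -/
theorem mem_matchingSet_last {M : Type} {g : List (Atom M)} {m : M} {w : List (Event M)} :
    w ∈ (Rule.mk 1 g [.var 0, .meth m]).matchingSet ↔
      ∃ us x, (∀ a ∈ g, a.Holds us) ∧ w = us 0 ++ [(m, x)] ∧ ∀ p ∈ us 0, p.2 ≠ x := by
  simp only [Rule.matchingSet, Rule.Matches, Set.mem_ofPred_eq]
  constructor
  · rintro ⟨x, us, hg, hp, hw⟩
    have := ne_of_seqProj_eq hp
    exact ⟨us, x, hg, by simpa [mem_den_var, mem_den_meth, Language.mem_mul, eq_comm] using hw,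
      by simpa [List.range_succ] using this⟩
  · rintro ⟨us, x, hg, rfl, h0⟩
    refine ⟨x, us, hg, ?_, ?_⟩
    · rw [seqProj_append, seqProj_cons_self, seqProj_eq_self h0]
      simp [List.range_succ, seqProj]
    · simp [mem_den_var, mem_den_meth, Language.mem_mul]

/-! ### Colourings -/

section Paint

variable {M : Type} {O : Type*} {e : List (Action M ℕ O)} {h : History M O}

/-- The word obtained from an execution by replacing each data value by its colour and forgetting
the operation identifiers. -/
def paint (ρ : ℕ → Fin 4) (e : List (Action M ℕ O)) : List (Action M (Fin 4) Unit) :=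
  e.map (Action.map ρ fun _ => ())

theorem Action.map_map {V V' V'' O' O'' : Type*} (f : V → V') (g : O → O') (f' : V' → V'')
    (g' : O' → O'') (a : Action M V O) :
    (a.map f g).map f' g' = a.map (f' ∘ f) (g' ∘ g) := by
  cases a <;> rfl

/-- Co-regularity is witnessed by a recognizable set of coloured words that contains a colouring of
each differentiated execution with a violation, and whose coloured executions imply a violation
somewhere in the implementation. A data-independent implementation consists of the renamings of its
differentiated executions, and an automaton over the values `0, 1, 2, 3` sees these renamings as
colourings. -/
theorem coRegularOn_of_recognizable {ι : Type} {S : DataStructure M ι}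
    {C : Set (List (Action M ℕ O)) → Prop} {R : ι}
    {P : List (Action M (Fin 4) Unit) → Prop} (hP : Recognizable P)
    (complete : ∀ I, IsImplementation I → S.DataIndependent I → C I → ∀ e ∈ I,
      S.Differentiated (events e) → S.Violates R e → ∃ ρ, P (paint ρ e))
    (sound : ∀ I, IsImplementation I → S.DataIndependent I → C I → ∀ e ∈ I,
      S.Differentiated (events e) → ∀ ρ, P (paint ρ e) →
        ∃ e' ∈ I, S.Differentiated (events e') ∧ S.Violates R e') :
    S.CoRegularOn C R := by
  obtain ⟨σ, hσ, step, s, acc, hA⟩ := hP.comap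
    (Action.map (M := M) (fun x : Finset.range 4 => Fin.ofNat 4 (x : ℕ)) (id : Unit → Unit))
  let A : DFA (Action M (Finset.range 4) Unit) σ := ⟨step, s, {q | acc q}⟩
  have hacc : ∀ w, w ∈ A.toNFA.accepts ↔
      P (w.map (Action.map (fun x : Finset.range 4 => Fin.ofNat 4 (x : ℕ)) id)) := by
    intro w
    rw [DFA.toNFA_correct]
    exact (hA w).symm
  refine ⟨Finset.range 4, σ, hσ, A.toNFA, fun I hI hD hC => ⟨?_, ?_⟩⟩
  · rintro ⟨e, he, w, hw, hwe⟩
    obtain ⟨e', he', hd, r, rfl⟩ := hD.1 e he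
    refine sound I hI hD hC e' he' hd (fun n => Fin.ofNat 4 (r n)) ?_
    rw [hacc] at hw
    have := congrArg (List.map (Action.map (fun n : ℕ => Fin.ofNat 4 n) id)) hwe
    simp only [rename, List.map_map, Function.comp_def, Action.map_map] at this
    have h2 : w.map (Action.map (fun x : Finset.range 4 => Fin.ofNat 4 (x : ℕ)) id) =
        paint (fun n => Fin.ofNat 4 (r n)) e' := this
    rwa [← h2]
  · rintro ⟨e, he, hd, hv⟩
    obtain ⟨ρ, hρ⟩ := complete I hI hD hC e he hd hv
    refine ⟨_, hD.2 e he fun n => (ρ n : ℕ),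
      e.map (Action.map (fun n => ⟨(ρ n : ℕ), Finset.mem_range.2 (ρ n).2⟩) fun _ => ()), ?_, ?_⟩
    · rw [hacc]
      simpa only [List.map_map, Function.comp_def, Action.map_map, Fin.ofNat_eq_cast,
        Fin.cast_val_eq_self, id, paint] using hρ
    · simp only [rename, List.map_map, Function.comp_def, Action.map_map, id]

theorem coRegular_of_recognizable [Inhabited M] {ι : Type} {S : DataStructure M ι} {R : ι}
    {P : List (Action M (Fin 4) Unit) → Prop} (hP : Recognizable P)
    (H : ∀ (e : List (Action M ℕ O)) (h : History M O), h.Of e → S.Differentiated (events e) →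
      (S.Violates R e → ∃ ρ, P (paint ρ e)) ∧ ∀ ρ, P (paint ρ e) → S.Violates R e) :
    S.CoRegular O R := by
  refine coRegularOn_of_recognizable hP ?_ ?_
  · intro I hI _ _ e he hd hv
    obtain ⟨h, hh⟩ := History.exists_of (hI e he)
    exact (H e h hh hd).1 hv
  · intro I hI _ _ e he hd ρ hρ
    obtain ⟨h, hh⟩ := History.exists_of (hI e he)
    exact ⟨e, he, hd, (H e h hh hd).2 ρ hρ⟩

theorem coRegular_of_not_violates [Inhabited M] {ι : Type} {S : DataStructure M ι} {R : ι}
    (H : ∀ (e : List (Action M ℕ O)) (h : History M O), h.Of e → S.Differentiated (events e) →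
      ¬ S.Violates R e) : S.CoRegular O R :=
  coRegular_of_recognizable (Recognizable.const False) fun e h hh hd =>
    ⟨fun hv => absurd hv (H e h hh hd), fun _ hf => hf.elim⟩

/-- The call letters whose method and colour satisfy `p`. -/
def callOf (p : M → Fin 4 → Prop) : Action M (Fin 4) Unit → Prop
  | .call _ m k => p m k
  | .ret _ _ _ => False

/-- The return letters whose method and colour satisfy `p`. -/
def retOf (p : M → Fin 4 → Prop) : Action M (Fin 4) Unit → Prop
  | .call _ _ _ => False
  | .ret _ m k => p m k

theorem paint_callOf (H : h.Of e) (ρ : ℕ → Fin 4) (p : M → Fin 4 → Prop) (n : ℕ) :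
    (∃ a, (paint ρ e)[n]? = some a ∧ callOf p a) ↔
      ∃ o ∈ h.ops, p (h.meth o) (ρ (h.val o)) ∧ h.inv o = n := by
  simp only [paint, List.getElem?_map, Option.map_eq_some_iff]
  constructor
  · rintro ⟨_, ⟨a, ha, rfl⟩, hp⟩
    cases a with
    | ret => exact hp.elim
    | call o m x =>
      obtain ⟨h1, h2, rfl, rfl⟩ := (H.call_iff _ _ _ _).1 ha
      exact ⟨o, h1, hp, h2⟩
  · rintro ⟨o, ho, hp, rfl⟩
    exact ⟨_, ⟨_, H.call ho, rfl⟩, hp⟩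

theorem paint_retOf (H : h.Of e) (ρ : ℕ → Fin 4) (p : M → Fin 4 → Prop) (n : ℕ) :
    (∃ a, (paint ρ e)[n]? = some a ∧ retOf p a) ↔
      ∃ o ∈ h.ops, p (h.meth o) (ρ (h.val o)) ∧ h.res o = n := by
  simp only [paint, List.getElem?_map, Option.map_eq_some_iff]
  constructor
  · rintro ⟨_, ⟨a, ha, rfl⟩, hp⟩
    cases a with
    | call => exact hp.elim
    | ret o m x =>
      obtain ⟨h1, h2, rfl, rfl⟩ := (H.ret_iff _ _ _ _).1 ha
      exact ⟨o, h1, hp, h2⟩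
  · rintro ⟨o, ho, hp, rfl⟩
    exact ⟨_, ⟨_, H.ret ho, rfl⟩, hp⟩

theorem before_callOf (H : h.Of e) (ρ : ℕ → Fin 4) (p : M → Fin 4 → Prop)
    (P : List (Action M (Fin 4) Unit) → Prop) :
    (∃ n a, (paint ρ e)[n]? = some a ∧ callOf p a ∧ P ((paint ρ e).take n)) ↔
      ∃ o ∈ h.ops, p (h.meth o) (ρ (h.val o)) ∧ P ((paint ρ e).take (h.inv o)) := by
  simp only [← and_assoc, exists_and_right, paint_callOf H]
  constructor
  · rintro ⟨n, ⟨o, ⟨ho, hp⟩, rfl⟩, hP⟩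
    exact ⟨o, ⟨ho, hp⟩, hP⟩
  · rintro ⟨o, ⟨ho, hp⟩, hP⟩
    exact ⟨_, ⟨o, ⟨ho, hp⟩, rfl⟩, hP⟩

theorem before_retOf (H : h.Of e) (ρ : ℕ → Fin 4) (p : M → Fin 4 → Prop)
    (P : List (Action M (Fin 4) Unit) → Prop) :
    (∃ n a, (paint ρ e)[n]? = some a ∧ retOf p a ∧ P ((paint ρ e).take n)) ↔
      ∃ o ∈ h.ops, p (h.meth o) (ρ (h.val o)) ∧ P ((paint ρ e).take (h.res o)) := by
  simp only [← and_assoc, exists_and_right, paint_retOf H]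
  constructor
  · rintro ⟨n, ⟨o, ⟨ho, hp⟩, rfl⟩, hP⟩
    exact ⟨o, ⟨ho, hp⟩, hP⟩
  · rintro ⟨o, ⟨ho, hp⟩, hP⟩
    exact ⟨_, ⟨o, ⟨ho, hp⟩, rfl⟩, hP⟩

theorem exists_mem_take_iff {α : Type*} (w : List α) (n : ℕ) (K : α → Prop) :
    (∃ a ∈ w.take n, K a) ↔ ∃ i < n, ∃ a, w[i]? = some a ∧ K a := by
  simp only [List.mem_iff_getElem?, List.getElem?_take]
  constructor
  · rintro ⟨a, ⟨i, hi⟩, ha⟩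
    split_ifs at hi with hlt
    exact ⟨i, hlt, a, hi, ha⟩
  · rintro ⟨i, hlt, a, hi, ha⟩
    exact ⟨a, ⟨i, by rwa [if_pos hlt]⟩, ha⟩

theorem has_callOf_take (H : h.Of e) (ρ : ℕ → Fin 4) (p : M → Fin 4 → Prop) (n : ℕ) :
    (∃ a ∈ (paint ρ e).take n, callOf p a) ↔
      ∃ o ∈ h.ops, p (h.meth o) (ρ (h.val o)) ∧ h.inv o < n := by
  simp only [exists_mem_take_iff, paint_callOf H]
  constructor
  · rintro ⟨_, hlt, o, ho, hp, rfl⟩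
    exact ⟨o, ho, hp, hlt⟩
  · rintro ⟨o, ho, hp, hlt⟩
    exact ⟨_, hlt, o, ho, hp, rfl⟩

theorem has_retOf_take (H : h.Of e) (ρ : ℕ → Fin 4) (p : M → Fin 4 → Prop) (n : ℕ) :
    (∃ a ∈ (paint ρ e).take n, retOf p a) ↔
      ∃ o ∈ h.ops, p (h.meth o) (ρ (h.val o)) ∧ h.res o < n := by
  simp only [exists_mem_take_iff, paint_retOf H]
  constructor
  · rintro ⟨_, hlt, o, ho, hp, rfl⟩
    exact ⟨o, ho, hp, hlt⟩
  · rintro ⟨o, ho, hp, hlt⟩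
    exact ⟨_, hlt, o, ho, hp, rfl⟩

theorem has_callOf (H : h.Of e) (ρ : ℕ → Fin 4) (p : M → Fin 4 → Prop) :
    (∃ a ∈ paint ρ e, callOf p a) ↔ ∃ o ∈ h.ops, p (h.meth o) (ρ (h.val o)) := by
  have := has_callOf_take H ρ p e.length
  rw [List.take_of_length_le (by simp [paint])] at this
  rw [this]
  constructor
  · rintro ⟨o, ho, hp, _⟩
    exact ⟨o, ho, hp⟩
  · rintro ⟨o, ho, hp⟩
    exact ⟨o, ho, hp, (H.inv_lt_res o ho).trans (H.res_lt_length ho)⟩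

/-- Two call letters satisfying `p` are the calls of two different operations. -/
theorem hasTwo_callOf (H : h.Of e) (ρ : ℕ → Fin 4) (p : M → Fin 4 → Prop) :
    (∃ n a, (paint ρ e)[n]? = some a ∧ callOf p a ∧ ∃ b ∈ (paint ρ e).take n, callOf p b) ↔
      ∃ o ∈ h.ops, ∃ o' ∈ h.ops, o ≠ o' ∧ p (h.meth o) (ρ (h.val o)) ∧
        p (h.meth o') (ρ (h.val o')) := by
  rw [before_callOf H ρ p fun w => ∃ b ∈ w, callOf p b]
  simp only [has_callOf_take H]
  constructor
  · rintro ⟨o, ho, hp, o', ho', hp', hlt⟩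
    exact ⟨o, ho, o', ho', fun heq => by simp [heq] at hlt, hp, hp'⟩
  · rintro ⟨o, ho, o', ho', hne, hp, hp'⟩
    rcases lt_or_gt_of_ne fun heq => hne (H.inv_inj ho ho' heq) with hlt | hlt
    · exact ⟨o', ho', hp', o, ho, hp, hlt⟩
    · exact ⟨o, ho, hp, o', ho', hp', hlt⟩

theorem countP_take_eq_card {α β : Type*} (w : List α) (K : α → Bool) (s : Finset β)
    (pos : β → ℕ) (hinj : Set.InjOn pos s)
    (hs : ∀ n, (∃ a, w[n]? = some a ∧ K a) ↔ ∃ o ∈ s, pos o = n) (n : ℕ) :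
    (w.take n).countP K = (s.filter fun o => pos o < n).card := by
  classical
  induction n with
  | zero => simp
  | succ n ih =>
    have hsplit : (s.filter fun o => pos o < n + 1) =
        (s.filter fun o => pos o < n) ∪ s.filter fun o => pos o = n := by
      ext o
      simp only [Finset.mem_filter, Finset.mem_union, Order.lt_add_one_iff, le_iff_lt_or_eq]
      tauto
    have hdisj : Disjoint (s.filter fun o => pos o < n) (s.filter fun o => pos o = n) := by
      rw [Finset.disjoint_filter]
      intro o _ h1 h2
      omega
    rw [hsplit, Finset.card_union_of_disjoint hdisj, ← ih, List.take_add_one,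
      List.countP_append]
    congr 1
    by_cases hn : ∃ o ∈ s, pos o = n
    · obtain ⟨a, ha, hK⟩ := (hs n).2 hn
      obtain ⟨o, ho, hon⟩ := hn
      have : (s.filter fun o => pos o = n) = {o} := by
        ext o'
        simp only [Finset.mem_filter, Finset.mem_singleton]
        constructor
        · rintro ⟨h1, h2⟩
          exact hinj h1 ho (h2.trans hon.symm)
        · rintro rfl
          exact ⟨ho, hon⟩
      rw [this, ha]
      simp [hK]
    · have : (s.filter fun o => pos o = n) = ∅ := by
        rw [Finset.filter_eq_empty_iff]
        intro o ho h2
        exact hn ⟨o, ho, h2⟩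
      rw [this, Finset.card_empty, List.countP_eq_zero]
      intro a ha hK
      exact hn ((hs n).1 ⟨a, by simpa using ha, hK⟩)

open Classical in
theorem countP_callOf_take (H : h.Of e) (ρ : ℕ → Fin 4) (p : M → Fin 4 → Prop) (n : ℕ) :
    ((paint ρ e).take n).countP (fun a => decide (callOf p a)) =
      ((h.ops.filter fun o => p (h.meth o) (ρ (h.val o))).filter fun o => h.inv o < n).card := by
  refine countP_take_eq_card _ _ _ _ ?_ ?_ n
  · intro o ho o' ho' heq
    simp only [Finset.coe_filter, Set.mem_ofPred_eq] at ho ho'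
    exact H.inv_inj ho.1 ho'.1 heq
  · intro n
    simp only [decide_eq_true_eq, Finset.mem_filter, and_assoc]
    exact paint_callOf H ρ p n

open Classical in
theorem countP_retOf_take (H : h.Of e) (ρ : ℕ → Fin 4) (p : M → Fin 4 → Prop) (n : ℕ) :
    ((paint ρ e).take n).countP (fun a => decide (retOf p a)) =
      ((h.ops.filter fun o => p (h.meth o) (ρ (h.val o))).filter fun o => h.res o < n).card := by
  refine countP_take_eq_card _ _ _ _ ?_ ?_ n
  · intro o ho o' ho' heq
    simp only [Finset.coe_filter, Set.mem_ofPred_eq] at ho ho'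
    exact H.res_inj ho.1 ho'.1 heq
  · intro n
    simp only [decide_eq_true_eq, Finset.mem_filter, and_assoc]
    exact paint_retOf H ρ p n

end Paint

/-! ### Elementary properties of coloured words -/

section Properties

variable {M : Type} {O : Type*} {e : List (Action M ℕ O)} {h : History M O}

/-- Some operation satisfies `p`. -/
def Has (p : M → Fin 4 → Prop) (w : List (Action M (Fin 4) Unit)) : Prop :=
  ∃ a ∈ w, callOf p a

/-- At least two operations satisfy `p`. -/
def Two (p : M → Fin 4 → Prop) (w : List (Action M (Fin 4) Unit)) : Prop :=
  ∃ n a, w[n]? = some a ∧ callOf p a ∧ ∃ b ∈ w.take n, callOf p b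

/-- The return of an operation satisfying `p` precedes the call of one satisfying `q`. -/
def Bef (p q : M → Fin 4 → Prop) (w : List (Action M (Fin 4) Unit)) : Prop :=
  ∃ n a, w[n]? = some a ∧ callOf q a ∧ ∃ b ∈ w.take n, retOf p b

theorem recognizable_has (p : M → Fin 4 → Prop) : Recognizable (Has p) :=
  Recognizable.hasLetter _

theorem recognizable_two (p : M → Fin 4 → Prop) : Recognizable (Two p) :=
  (Recognizable.hasLetter _).before _

theorem recognizable_bef (p q : M → Fin 4 → Prop) : Recognizable (Bef p q) :=
  (Recognizable.hasLetter _).before _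

theorem has_paint (H : h.Of e) (ρ : ℕ → Fin 4) (p : M → Fin 4 → Prop) :
    Has p (paint ρ e) ↔ ∃ o ∈ h.ops, p (h.meth o) (ρ (h.val o)) :=
  has_callOf H ρ p

theorem two_paint (H : h.Of e) (ρ : ℕ → Fin 4) (p : M → Fin 4 → Prop) :
    Two p (paint ρ e) ↔ ∃ o ∈ h.ops, ∃ o' ∈ h.ops, o ≠ o' ∧ p (h.meth o) (ρ (h.val o)) ∧
      p (h.meth o') (ρ (h.val o')) :=
  hasTwo_callOf H ρ p

theorem bef_paint (H : h.Of e) (ρ : ℕ → Fin 4) (p q : M → Fin 4 → Prop) :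
    Bef p q (paint ρ e) ↔ ∃ o ∈ h.ops, ∃ o' ∈ h.ops, p (h.meth o) (ρ (h.val o)) ∧
      q (h.meth o') (ρ (h.val o')) ∧ h.res o < h.inv o' := by
  rw [Bef, before_callOf H ρ q fun w => ∃ b ∈ w, retOf p b]
  simp only [has_retOf_take H]
  constructor
  · rintro ⟨o', ho', hq, o, ho, hp, hlt⟩
    exact ⟨o, ho, o', ho', hp, hq, hlt⟩
  · rintro ⟨o, ho, o', ho', hp, hq, hlt⟩
    exact ⟨o', ho', hq, o, ho, hp, hlt⟩

end Properties

/-! ### Lists of operations -/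

namespace History

variable {M : Type} {O : Type*} {e : List (Action M ℕ O)} {h : History M O}

theorem Of.contains_iff (H : h.Of e) (D : Set ℕ) (m : M) :
    Contains m (events (proj D e)) ↔ ∃ o ∈ h.ops, h.val o ∈ D ∧ h.meth o = m := by
  obtain ⟨L, ⟨_, hmem⟩, he⟩ := H.exists_events_proj D
  simp only [he, contains_map, hmem, and_assoc]

theorem Of.matched_iff (H : h.Of e) (D : Set ℕ) (m : M) :
    Matched m (events (proj D e)) ↔ ∀ o ∈ h.ops, h.val o ∈ D → h.meth o = m →
      ∃ o' ∈ h.ops, o' ≠ o ∧ h.val o' = h.val o := by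
  obtain ⟨L, ⟨hL, hmem⟩, he⟩ := H.exists_events_proj D
  rw [he, matched_map hL]
  simp only [hmem, and_imp]
  refine forall_congr' fun o => forall_congr' fun _ => forall_congr' fun hD =>
    forall_congr' fun _ => exists_congr fun o' => ?_
  constructor
  · rintro ⟨⟨h1, _⟩, h2⟩
    exact ⟨h1, h2⟩
  · rintro ⟨h1, h2, h3⟩
    exact ⟨⟨h1, by rwa [h3]⟩, h2, h3⟩

theorem Of.events_eq_nil_iff (H : h.Of e) (D : Set ℕ) :
    events (proj D e) = [] ↔ ∀ o ∈ h.ops, h.val o ∉ D := by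
  obtain ⟨L, ⟨_, hmem⟩, he⟩ := H.exists_events_proj D
  rw [he, List.map_eq_nil_iff, List.eq_nil_iff_forall_not_mem]
  simp only [hmem, not_and]

/-- Any set of operations has a linearization: order them by their calls. -/
theorem Of.exists_respects (H : h.Of e) (s : Finset O) (hs : s ⊆ h.ops) :
    ∃ L : List O, L.Nodup ∧ (∀ o, o ∈ L ↔ o ∈ s) ∧ h.Respects L := by
  classical
  induction s using Finset.induction_on_max_value h.inv with
  | empty => exact ⟨[], by simp, by simp, List.Pairwise.nil⟩
  | insert a s ha hmax ih =>
    obtain ⟨L, h1, h2, h3⟩ := ih fun o ho => hs (Finset.mem_insert_of_mem ho)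
    refine ⟨L ++ [a], ?_, ?_, ?_⟩
    · rw [List.nodup_append]
      refine ⟨h1, by simp, ?_⟩
      intro o ho b hb
      rw [List.mem_singleton] at hb
      rintro rfl
      exact ha (hb ▸ (h2 _).1 ho)
    · intro o
      simp [h2, or_comm]
    · rw [Respects, List.pairwise_append]
      refine ⟨h3, by simp, ?_⟩
      intro o ho b hb
      rw [List.mem_singleton] at hb
      subst hb
      have := hmax o ((h2 o).1 ho)
      have := H.inv_lt_res b (hs (Finset.mem_insert_self _ _))
      omega

theorem Respects.of_append {A B : List O} (hR : h.Respects (A ++ B)) {a b : O} (ha : a ∈ A)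
    (hb : b ∈ B) : ¬ h.res b < h.inv a :=
  (List.pairwise_append.1 hR).2.2 a ha b hb

theorem respects_append {A B : List O} : h.Respects (A ++ B) ↔
    h.Respects A ∧ h.Respects B ∧ ∀ a ∈ A, ∀ b ∈ B, ¬ h.res b < h.inv a :=
  List.pairwise_append

theorem respects_cons {a : O} {B : List O} : h.Respects (a :: B) ↔
    (∀ b ∈ B, ¬ h.res b < h.inv a) ∧ h.Respects B :=
  List.pairwise_cons

theorem lab_eq_iff {o : O} {m : M} {x : ℕ} :
    h.lab o = (m, x) ↔ h.meth o = m ∧ h.val o = x := by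
  simp [lab]

theorem forall_mem_map_lab {L : List O} {P : Event M → Prop} :
    (∀ p ∈ L.map h.lab, P p) ↔ ∀ o ∈ L, P (h.meth o, h.val o) := by
  simp [lab]

/-! ### Defects of a single data value -/

/-- The value `x` is defective: its removals (operations `mr`) cannot be explained by its insertion
(operation `mi`), because there is none, or because it comes too late, or, if a value may be
removed only `once`, because there are two removals. -/
def Defect (h : History M O) (once : Prop) (mi mr : M) (x : ℕ) : Prop :=
  ∃ q ∈ h.ops, h.meth q = mr ∧ h.val q = x ∧
    ((∀ p ∈ h.ops, h.meth p = mi → h.val p ≠ x) ∨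
      (once ∧ ∃ q' ∈ h.ops, q' ≠ q ∧ h.meth q' = mr ∧ h.val q' = x) ∨
      ∃ p ∈ h.ops, h.meth p = mi ∧ h.val p = x ∧ h.res q < h.inv p)

/-- An input method is used at most once with each value. -/
def InputUnique (h : History M O) (mi : M) : Prop :=
  ∀ p ∈ h.ops, ∀ p' ∈ h.ops, h.meth p = mi → h.meth p' = mi → h.val p = h.val p' → p = p'

end History

section Defect

variable {M : Type} {O : Type*} {e : List (Action M ℕ O)} {h : History M O}

/-- The coloured words in which colour `1` is seen to be defective. -/
def DefectWord (once : Prop) (mi mr : M) (w : List (Action M (Fin 4) Unit)) : Prop :=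
  (¬ Has (fun m k => m = mi ∧ k = 1) w ∧ Has (fun m k => m = mr ∧ k = 1) w) ∨
  (once ∧ ¬ Two (fun m k => m = mi ∧ k = 1) w ∧ Two (fun m k => m = mr ∧ k = 1) w) ∨
  (¬ Two (fun m k => m = mi ∧ k = 1) w ∧
    Bef (fun m k => m = mr ∧ k = 1) (fun m k => m = mi ∧ k = 1) w)

theorem recognizable_defectWord (once : Prop) (mi mr : M) :
    Recognizable (DefectWord once mi mr) :=
  ((recognizable_has _).not.and (recognizable_has _)).or
    (((Recognizable.const once).and ((recognizable_two _).not.and (recognizable_two _))).or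
      ((recognizable_two _).not.and (recognizable_bef _ _)))

/-- Colour the value `x` with `1`, the value `y` with `2`, and everything else with `0`. -/
def twoColours (x y : ℕ) : ℕ → Fin 4 := fun n => if n = x then 1 else if n = y then 2 else 0

theorem twoColours_eq_one {x y n : ℕ} : twoColours x y n = 1 ↔ n = x := by
  unfold twoColours
  split_ifs with h1 h2
  · simp [h1]
  · simp [h1]
  · simp [h1]

theorem twoColours_eq_two {x y n : ℕ} (hxy : x ≠ y) : twoColours x y n = 2 ↔ n = y := by
  unfold twoColours
  split_ifs with h1 h2
  · subst h1
    simpa using hxy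
  · simp [h2]
  · simp [h2]

theorem not_two_input (H : h.Of e) {mi : M} (hu : h.InputUnique mi) {ρ : ℕ → Fin 4} {k : Fin 4}
    {x : ℕ} (hρ : ∀ n, ρ n = k → n = x) : ¬ Two (fun m k' => m = mi ∧ k' = k) (paint ρ e) := by
  rw [two_paint H]
  rintro ⟨o, ho, o', ho', hne, ⟨h1, h2⟩, h3, h4⟩
  exact hne (hu o ho o' ho' h1 h3 ((hρ _ h2).trans (hρ _ h4).symm))

theorem exists_defectWord (H : h.Of e) {once : Prop} {mi mr : M} (hu : h.InputUnique mi) {x : ℕ}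
    (hx : h.Defect once mi mr x) : ∃ ρ, DefectWord once mi mr (paint ρ e) := by
  refine ⟨twoColours x x, ?_⟩
  have htwo := not_two_input H hu (ρ := twoColours x x) (k := 1) fun n => twoColours_eq_one.1
  unfold DefectWord
  simp only [has_paint H, two_paint H (p := fun m k => m = mr ∧ k = 1), bef_paint H,
    twoColours_eq_one]
  obtain ⟨q, hq, hqm, hqx, h1 | ⟨ho, q', hq', hne, hm', hx'⟩ | ⟨p, hp, hpm, hpx, hlt⟩⟩ := hx
  · refine Or.inl ⟨?_, q, hq, hqm, hqx⟩
    rintro ⟨p, hp, hpm, hpx⟩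
    exact h1 p hp hpm hpx
  · exact Or.inr (Or.inl ⟨ho, htwo, q, hq, q', hq', hne.symm, ⟨hqm, hqx⟩, hm', hx'⟩)
  · exact Or.inr (Or.inr ⟨htwo, q, hq, p, hp, ⟨hqm, hqx⟩, ⟨hpm, hpx⟩, hlt⟩)

theorem exists_defect_of_word (H : h.Of e) {once : Prop} {mi mr : M} {ρ : ℕ → Fin 4}
    (hw : DefectWord once mi mr (paint ρ e)) : ∃ x, h.Defect once mi mr x := by
  unfold DefectWord at hw
  rw [has_paint H, has_paint H, two_paint H, two_paint H, bef_paint H] at hw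
  by_contra hcon
  -- without a defect, each removal comes with an insertion of the same value
  have hins : ∀ q ∈ h.ops, h.meth q = mr → ∃ p ∈ h.ops, h.meth p = mi ∧ h.val p = h.val q := by
    intro q hq hm
    by_contra hno
    exact hcon ⟨h.val q, q, hq, hm, rfl, Or.inl fun p hp h1 h2 => hno ⟨p, hp, h1, h2⟩⟩
  rcases hw with ⟨h1, q, hq, hm, hk⟩ | ⟨ho, h1, q, hq, q', hq', hne, ⟨hm, hk⟩, hm', hk'⟩ |
    ⟨h1, q, hq, p', hp', ⟨hm, hk⟩, ⟨hm', hk'⟩, hlt⟩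
  · obtain ⟨p, hp, hpm, hpv⟩ := hins q hq hm
    exact h1 ⟨p, hp, hpm, by rw [hpv, hk]⟩
  · obtain ⟨p, hp, hpm, hpv⟩ := hins q hq hm
    obtain ⟨p', hp', hpm', hpv'⟩ := hins q' hq' hm'
    have : p = p' := by
      by_contra hpp
      exact h1 ⟨p, hp, p', hp', hpp, ⟨hpm, by rw [hpv, hk]⟩, hpm', by rw [hpv', hk']⟩
    subst this
    exact hcon ⟨h.val q, q, hq, hm, rfl, Or.inr (Or.inl
      ⟨ho, q', hq', hne.symm, hm', hpv'.symm.trans hpv⟩)⟩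
  · obtain ⟨p, hp, hpm, hpv⟩ := hins q hq hm
    have : p = p' := by
      by_contra hpp
      exact h1 ⟨p, hp, p', hp', hpp, ⟨hpm, by rw [hpv, hk]⟩, hm', hk'⟩
    subst this
    exact hcon ⟨h.val q, q, hq, hm, rfl, Or.inr (Or.inr ⟨p, hp, hpm, hpv, hlt⟩)⟩

/-- A defective value is not explained by an insertion followed by a removal. -/
theorem History.Defect.not_pair {mi mr : M} (hne : mi ≠ mr) {x : ℕ} {once : Prop}
    (hx : h.Defect once mi mr x) {a b : O} (ha : h.meth a = mi) (hb : h.meth b = mr)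
    (hL : h.Lists {x} [a, b]) (hR : h.Respects [a, b]) : False := by
  have hmem : ∀ o ∈ h.ops, h.val o = x → o = a ∨ o = b := by
    intro o ho hv
    simpa using (hL.2 o).2 ⟨ho, hv⟩
  have ha' := (hL.2 a).1 (by simp)
  have hR' : ¬ h.res b < h.inv a := (respects_cons.1 hR).1 b (by simp)
  obtain ⟨q, hq, hqm, hqx, h1 | ⟨-, q', hq', hne', hm', hx'⟩ | ⟨p, hp, hpm, hpx, hlt⟩⟩ := hx
  · exact h1 a ha'.1 ha ha'.2
  · rcases hmem q hq hqx with rfl | rfl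
    · exact hne (ha.symm.trans hqm)
    · rcases hmem q' hq' hx' with rfl | rfl
      · exact hne (ha.symm.trans hm')
      · exact hne' rfl
  · rcases hmem q hq hqx with rfl | rfl
    · exact hne (ha.symm.trans hqm)
    · rcases hmem p hp hpx with rfl | rfl
      · exact hR' hlt
      · exact hne (hpm.symm.trans hb)

end Defect

/-! ### Rules that are never violated, and the rule `Lock` -/

section Simple

variable {O : Type*}

theorem linearizable_nil {M : Type} {e : List (Action M ℕ O)} {h : History M O} (H : h.Of e)
    {D : Set ℕ} (hD : ∀ o ∈ h.ops, h.val o ∉ D) :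
    Linearizable (proj D e) (Rule.mk 0 [] [] : Rule M).matchingSet := by
  rw [H.linearizable_proj_iff]
  refine ⟨[], ⟨by simp, fun o => ?_⟩, List.Pairwise.nil, mem_matchingSet_nil.2 rfl⟩
  simp only [List.not_mem_nil, false_iff, not_and]
  exact hD o

instance : Inhabited QueueMethod := ⟨.enq⟩
instance : Inhabited StackMethod := ⟨.push⟩
instance : Inhabited RegisterMethod := ⟨.write⟩
instance : Inhabited MutexMethod := ⟨.lock⟩

theorem queue_r0 : queue.CoRegular O .r0 := by
  refine coRegular_of_not_violates fun e h H hd => ?_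
  rintro ⟨D, hlast, hlin⟩
  refine hlin (linearizable_nil H ?_)
  simp only [queue] at hlast
  split_ifs at hlast with h1 h2 h3
  rw [H.contains_iff] at h1 h2 h3
  intro o ho hD
  cases hm : h.meth o
  · exact h3 ⟨o, ho, hD, hm⟩
  · exact h2 ⟨o, ho, hD, hm⟩
  · exact h1 ⟨o, ho, hD, hm⟩

theorem register_r0 : register.CoRegular O .r0 := by
  refine coRegular_of_not_violates fun e h H hd => ?_
  rintro ⟨D, hlast, hlin⟩
  refine hlin (linearizable_nil H ?_)
  simp only [register] at hlast
  split_ifs at hlast with h1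
  rwa [not_not, H.events_eq_nil_iff] at h1

theorem mutex_r0 : mutex.CoRegular O .r0 := by
  refine coRegular_of_not_violates fun e h H hd => ?_
  rintro ⟨D, hlast, hlin⟩
  refine hlin (linearizable_nil H ?_)
  simp only [mutex] at hlast
  split_ifs at hlast with h1 h2
  rwa [not_not, H.events_eq_nil_iff] at h2

theorem inputUnique_of_differentiated {M ι : Type} {S : DataStructure M ι}
    {e : List (Action M ℕ O)} {h : History M O} (H : h.Of e) (hd : S.Differentiated (events e))
    {m : M} (hm : m ∈ S.input) : h.InputUnique m := by
  rw [H.differentiated_iff] at hd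
  intro p hp p' hp' h1 h2 h3
  exact hd.1 p hp p' hp' (by rwa [h1]) (by simp [History.lab, h1, h2, h3])

theorem stack_r0 : stack.CoRegular O .r0 := by
  refine coRegular_of_not_violates fun e h H hd => ?_
  rintro ⟨D, hlast, hlin⟩
  refine hlin (linearizable_nil H ?_)
  simp only [stack] at hlast
  split_ifs at hlast with h1 h2 h3
  rw [H.contains_iff] at h1 h3
  rw [H.matched_iff] at h2
  have hpush : ∀ o ∈ h.ops, h.val o ∈ D → h.meth o = .push := by
    intro o ho hD
    cases hm : h.meth o
    · rfl
    · exact absurd ⟨o, ho, hD, hm⟩ h3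
    · exact absurd ⟨o, ho, hD, hm⟩ h1
  intro o ho hD
  obtain ⟨o', ho', hne, hv⟩ := h2 o ho hD (hpush o ho hD)
  exact hne (inputUnique_of_differentiated H hd (m := .push) rfl o' ho' o ho
    (hpush o' ho' (by rwa [hv])) (hpush o ho hD) hv)

/-- A projection with enqueues only is linearized by any order of its operations: the last enqueue
of the order is the one to be removed, since its value occurs only once. -/
theorem queue_rEnq : queue.CoRegular O .rEnq := by
  classical
  refine coRegular_of_not_violates fun e h H hd => ?_
  rintro ⟨D, hlast, hlin⟩
  apply hlin
  simp only [queue] at hlast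
  split_ifs at hlast with h1 h2 h3
  rw [H.contains_iff] at h1 h2 h3
  have henq : ∀ o ∈ h.ops, h.val o ∈ D → h.meth o = .enq := by
    intro o ho hD
    cases hm : h.meth o
    · rfl
    · exact absurd ⟨o, ho, hD, hm⟩ h2
    · exact absurd ⟨o, ho, hD, hm⟩ h1
  have hu := inputUnique_of_differentiated H hd (m := .enq) rfl
  rw [H.linearizable_proj_iff]
  obtain ⟨L, hL1, hL2, hL3⟩ := H.exists_respects (h.ops.filter fun o => h.val o ∈ D)
    (Finset.filter_subset _ _)
  simp only [Finset.mem_filter] at hL2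
  refine ⟨L, ⟨hL1, hL2⟩, hL3, ?_⟩
  obtain ⟨o, ho, hD, -⟩ := h3
  rcases L.eq_nil_or_concat' with rfl | ⟨A, a, rfl⟩
  · exact absurd ((hL2 o).2 ⟨ho, hD⟩) (by simp)
  have ha := (hL2 a).1 (by simp)
  have hA : ∀ o ∈ A, o ∈ h.ops ∧ h.val o ∈ D := fun o ho => (hL2 o).1 (by simp [ho])
  refine mem_matchingSet_last.2 ⟨fun _ => A.map h.lab, h.val a, ?_, ?_, ?_⟩
  · intro at' hat
    rw [List.mem_singleton] at hat
    subst hat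
    exact History.forall_mem_map_lab.2 fun o ho => henq o (hA o ho).1 (hA o ho).2
  · simp [History.lab, henq a ha.1 ha.2]
  · refine History.forall_mem_map_lab.2 fun o ho heq => ?_
    have := hu o (hA o ho).1 a ha.1 (henq o (hA o ho).1 (hA o ho).2) (henq a ha.1 ha.2) heq
    subst this
    exact (List.nodup_append.1 hL1).2.2 o ho o (by simp) rfl

theorem mutex_last_rLock (u : List (Event MutexMethod)) :
    mutex.last u = .rLock ↔ ¬ Contains .unlock u ∧ u ≠ [] := by
  simp only [mutex]
  split_ifs with h1 h2 <;> simp [*]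

theorem mutex_rLock : mutex.CoRegular O .rLock := by
  refine coRegular_of_recognizable (P := fun w =>
    (Has (fun m k => m = .lock ∧ k = 1) w ∧ Has (fun m k => m = .lock ∧ k = 2) w) ∧
    ¬ Has (fun m k => m = .unlock ∧ (k = 1 ∨ k = 2)) w)
    (((recognizable_has _).and (recognizable_has _)).and (recognizable_has _).not)
    fun e h H hd => ⟨?_, ?_⟩
  · rintro ⟨D, hlast, hlin⟩
    rw [mutex_last_rLock, H.contains_iff, ne_eq, H.events_eq_nil_iff] at hlast
    obtain ⟨h1, h2⟩ := hlast
    have hlock : ∀ o ∈ h.ops, h.val o ∈ D → h.meth o = .lock := by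
      intro o ho hD
      cases hm : h.meth o
      · rfl
      · exact absurd ⟨o, ho, hD, hm⟩ h1
    push Not at h2
    obtain ⟨o, ho, hD⟩ := h2
    by_cases hone : ∀ o' ∈ h.ops, h.val o' ∈ D → o' = o
    · refine absurd ?_ hlin
      rw [H.linearizable_proj_iff]
      refine ⟨[o], ⟨by simp, fun o' => ?_⟩, by simp [History.Respects],
        mem_matchingSet_single.2 ⟨h.val o, by simp [History.lab, hlock o ho hD]⟩⟩
      rw [List.mem_singleton]
      constructor
      · rintro rfl
        exact ⟨ho, hD⟩
      · rintro ⟨ho', hD'⟩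
        exact hone o' ho' hD'
    · push Not at hone
      obtain ⟨o', ho', hD', hne⟩ := hone
      have hv : h.val o ≠ h.val o' := fun heq => hne (inputUnique_of_differentiated H hd
        (m := .lock) rfl o' ho' o ho (hlock o' ho' hD') (hlock o ho hD) heq.symm)
      refine ⟨twoColours (h.val o) (h.val o'), ?_⟩
      simp only [has_paint H, twoColours_eq_one, twoColours_eq_two hv]
      refine ⟨⟨⟨o, ho, hlock o ho hD, rfl⟩, o', ho', hlock o' ho' hD', rfl⟩, ?_⟩
      rintro ⟨q, hq, hm, hx | hx⟩
      · exact h1 ⟨q, hq, by rwa [hx], hm⟩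
      · exact h1 ⟨q, hq, by rwa [hx], hm⟩
  · rintro ρ ⟨⟨h1, h2⟩, h3⟩
    rw [has_paint H] at h1 h2 h3
    obtain ⟨o, ho, hm, hk⟩ := h1
    obtain ⟨o', ho', hm', hk'⟩ := h2
    refine ⟨{h.val o, h.val o'}, ?_, ?_⟩
    · rw [mutex_last_rLock, H.contains_iff, ne_eq, H.events_eq_nil_iff]
      refine ⟨?_, fun hcon => hcon o ho (by simp)⟩
      rintro ⟨q, hq, hx | hx, hm⟩
      · exact h3 ⟨q, hq, hm, Or.inl (by rw [hx, hk])⟩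
      · exact h3 ⟨q, hq, hm, Or.inr (by rw [hx, hk'])⟩
    · rw [H.linearizable_proj_iff]
      rintro ⟨L, ⟨-, hmem⟩, -, hL⟩
      obtain ⟨x, hL⟩ := mem_matchingSet_single.1 hL
      rw [List.map_eq_singleton_iff] at hL
      obtain ⟨a, rfl, -⟩ := hL
      have e1 := (hmem o).2 ⟨ho, by simp⟩
      have e2 := (hmem o').2 ⟨ho', by simp⟩
      rw [List.mem_singleton] at e1 e2
      rw [e1] at hk
      rw [e2, hk] at hk'
      exact absurd hk' (by decide)

end Simple

/-! ### Violations by one or two data values -/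

section Pair

variable {M : Type} {O : Type*} {e : List (Action M ℕ O)} {h : History M O}

theorem exists_input_of_no_defect {once : Prop} {mi mr : M}
    (hno : ∀ x, ¬ h.Defect once mi mr x) {q : O} (hq : q ∈ h.ops)
    (hm : h.meth q = mi ∨ h.meth q = mr) :
    ∃ p ∈ h.ops, h.meth p = mi ∧ h.val p = h.val q := by
  rcases hm with hm | hm
  · exact ⟨q, hq, hm, rfl⟩
  · by_contra hcon
    exact hno (h.val q) ⟨q, hq, hm, rfl, Or.inl fun p hp h1 h2 => hcon ⟨p, hp, h1, h2⟩⟩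

/-- Without defects, a colour with a single insertion is the colour of a single value. -/
theorem val_eq_of_not_two (H : h.Of e) {once : Prop} {mi mr : M}
    (hno : ∀ x, ¬ h.Defect once mi mr x) {ρ : ℕ → Fin 4} {k : Fin 4}
    (htwo : ¬ Two (fun m k' => m = mi ∧ k' = k) (paint ρ e)) {q q' : O} (hq : q ∈ h.ops)
    (hq' : q' ∈ h.ops) (hm : h.meth q = mi ∨ h.meth q = mr)
    (hm' : h.meth q' = mi ∨ h.meth q' = mr) (hk : ρ (h.val q) = k) (hk' : ρ (h.val q') = k) :
    h.val q = h.val q' := by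
  obtain ⟨p, hp, hpm, hpv⟩ := exists_input_of_no_defect hno hq hm
  obtain ⟨p', hp', hpm', hpv'⟩ := exists_input_of_no_defect hno hq' hm'
  by_contra hne
  rw [two_paint H] at htwo
  refine htwo ⟨p, hp, p', hp', ?_, ⟨hpm, by rw [hpv, hk]⟩, hpm', by rw [hpv', hk']⟩
  rintro rfl
  exact hne (hpv.symm.trans hpv')

/-- In a linearization that starts with the operations of value `z`, no other operation happens
before one of these. -/
theorem History.Respects.not_before_first_block {D : Set ℕ} {A B : List O} {z : ℕ}
    (hL : h.Lists D (A ++ B)) (hR : h.Respects (A ++ B)) (hA : ∀ o ∈ A, h.val o = z)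
    (hB : ∀ o ∈ B, h.val o ≠ z) {o o' : O} (ho : o ∈ h.ops) (ho' : o' ∈ h.ops)
    (hoD : h.val o ∈ D) (hoD' : h.val o' ∈ D) (hne : h.val o ≠ z) (heq : h.val o' = z) :
    ¬ h.res o < h.inv o' := by
  have h1 := (hL.2 o).2 ⟨ho, hoD⟩
  have h2 := (hL.2 o').2 ⟨ho', hoD'⟩
  rw [List.mem_append] at h1 h2
  exact hR.of_append (h2.resolve_right fun h' => hB _ h' heq)
    (h1.resolve_left fun h' => hne (hA _ h'))

/-- Conversely, if nothing happens before the operations of value `x`, then these can be linearized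
first. -/
theorem exists_linearization_first_block (H : h.Of e) {D : Set ℕ} {x : ℕ} (hx : x ∈ D) {A : List O}
    (hA : A.Nodup) (hmem : ∀ o, o ∈ A ↔ o ∈ h.ops ∧ h.val o = x) (hR : h.Respects A)
    (hfirst : ∀ o ∈ h.ops, ∀ o' ∈ h.ops, h.val o ∈ D → h.val o ≠ x → h.val o' = x →
      ¬ h.res o < h.inv o') :
    ∃ B, h.Lists D (A ++ B) ∧ h.Respects (A ++ B) ∧ ∀ o ∈ B, h.val o ≠ x := by
  classical
  obtain ⟨B, h1, h2, h3⟩ := H.exists_respects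
    (h.ops.filter fun o => h.val o ∈ D ∧ h.val o ≠ x) (Finset.filter_subset _ _)
  simp only [Finset.mem_filter] at h2
  refine ⟨B, ⟨?_, ?_⟩, ?_, fun o ho => ((h2 o).1 ho).2.2⟩
  · rw [List.nodup_append]
    refine ⟨hA, h1, ?_⟩
    rintro a ha b hb rfl
    exact ((h2 a).1 hb).2.2 ((hmem a).1 ha).2
  · intro o
    rw [List.mem_append, hmem, h2]
    by_cases hv : h.val o = x
    · simp [hv, hx]
    · simp [hv]
  · rw [History.respects_append]
    refine ⟨hR, h3, fun a ha b hb => ?_⟩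
    have hb' := (h2 b).1 hb
    have ha' := (hmem a).1 ha
    exact hfirst b hb'.1 a ha'.1 hb'.2.1 hb'.2.2 ha'.2

/-- If every value satisfying `c` is preceded by another value (in the sense that some operation of
the latter happens before one of the former), then two values suffice: precedence between values
is determined by the first return and the last call, so that the value with the first return
precedes every value that is preceded at all. -/
theorem exists_preceding_pair {D : Set ℕ} {c : ℕ → Prop}
    (hc : ∃ o ∈ h.ops, h.val o ∈ D ∧ c (h.val o))
    (hbad : ∀ o₁ ∈ h.ops, h.val o₁ ∈ D → c (h.val o₁) → ∃ o ∈ h.ops, ∃ o' ∈ h.ops,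
      h.val o ∈ D ∧ h.val o ≠ h.val o₁ ∧ h.val o' = h.val o₁ ∧ h.res o < h.inv o') :
    ∃ x ∈ D, ∃ y ∈ D, x ≠ y ∧ c x ∧
      (∃ o ∈ h.ops, ∃ o' ∈ h.ops, h.val o = y ∧ h.val o' = x ∧ h.res o < h.inv o') ∧
      (¬ c y ∨
        ∃ o ∈ h.ops, ∃ o' ∈ h.ops, h.val o = x ∧ h.val o' = y ∧ h.res o < h.inv o') := by
  classical
  obtain ⟨o₁, ho₁, hD₁, hc₁⟩ := hc
  obtain ⟨o₀, ho₀, hmin⟩ := Finset.exists_min_image (h.ops.filter fun o => h.val o ∈ D) h.res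
    ⟨o₁, by simp [ho₁, hD₁]⟩
  simp only [Finset.mem_filter, and_imp] at ho₀ hmin
  obtain ⟨ho₀, hD₀⟩ := ho₀
  by_cases hc₀ : c (h.val o₀)
  · obtain ⟨o, ho, o', ho', hD, hne, heq, hlt⟩ := hbad o₀ ho₀ hD₀ hc₀
    refine ⟨h.val o₀, hD₀, h.val o, hD, hne.symm, hc₀, ⟨o, ho, o', ho', rfl, heq, hlt⟩, ?_⟩
    by_cases hcy : c (h.val o)
    · obtain ⟨p, hp, p', hp', hpD, -, hpeq, hplt⟩ := hbad o ho hD hcy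
      exact Or.inr ⟨o₀, ho₀, p', hp', rfl, hpeq, (hmin p hp hpD).trans_lt hplt⟩
    · exact Or.inl hcy
  · obtain ⟨p, hp, p', hp', hpD, -, hpeq, hplt⟩ := hbad o₁ ho₁ hD₁ hc₁
    refine ⟨h.val o₁, hD₁, h.val o₀, hD₀, ?_, hc₁,
      ⟨o₀, ho₀, p', hp', rfl, hpeq, (hmin p hp hpD).trans_lt hplt⟩, Or.inl hc₀⟩
    intro heq
    exact hc₀ (heq ▸ hc₁)

end Pair

/-! ### The rule `WR` -/

section Register

variable {O : Type*}

theorem register_last_rWR (u : List (Event RegisterMethod)) :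
    register.last u = .rWR ↔ u ≠ [] := by
  simp only [register]
  split_ifs with h1 <;> simp [h1]

/-- The coloured words in which the colours `1` and `2` stand for two values each of which has an
operation that happens before an operation of the other. -/
def WRPairWord (w : List (Action RegisterMethod (Fin 4) Unit)) : Prop :=
  (¬ Two (fun m k => m = .write ∧ k = 1) w ∧ ¬ Two (fun m k => m = .write ∧ k = 2) w) ∧
  Bef (fun _ k => k = 2) (fun _ k => k = 1) w ∧ Bef (fun _ k => k = 1) (fun _ k => k = 2) w

theorem recognizable_wrPairWord : Recognizable WRPairWord :=
  ((recognizable_two _).not.and (recognizable_two _).not).and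
    ((recognizable_bef _ _).and (recognizable_bef _ _))

theorem register_rWR : register.CoRegular O .rWR := by
  classical
  refine coRegular_of_recognizable
    ((recognizable_defectWord False .write .read).or recognizable_wrPairWord) fun e h H hd => ?_
  have hu := inputUnique_of_differentiated H hd (m := .write) rfl
  have hmeth : ∀ o, h.meth o = .write ∨ h.meth o = .read := fun o => by
    cases h.meth o <;> simp
  -- the shape of the linearizations that match the rule
  have hshape : ∀ D, ¬ Linearizable (proj D e) (register.rule .rWR).matchingSet ↔
      ∀ L, h.Lists D L → h.Respects L → ¬ ∃ a A B, L = a :: A ++ B ∧ h.meth a = .write ∧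
        (∀ o ∈ A, h.meth o = .read) ∧ (∀ o ∈ a :: A, h.val o = h.val a) ∧
        ∀ o ∈ B, h.val o ≠ h.val a := by
    intro D
    rw [H.linearizable_proj_iff, not_exists]
    refine forall_congr' fun L => ?_
    rw [not_and, not_and]
    refine forall_congr' fun _ => forall_congr' fun _ => not_congr ?_
    change _ ∈ (Rule.mk 1 [] [.meth .write, .star .read, .var 0] : Rule RegisterMethod).matchingSet ↔ _
    rw [mem_matchingSet_star]
    constructor
    · rintro ⟨x, n, u, hL, hne⟩
      rw [List.map_eq_cons_iff] at hL
      obtain ⟨a, L', rfl, ha, hL'⟩ := hL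
      rw [List.map_eq_append_iff] at hL'
      obtain ⟨A, B, rfl, hA, rfl⟩ := hL'
      obtain ⟨ham, rfl⟩ := History.lab_eq_iff.1 ha
      have hA' : ∀ o ∈ A, h.lab o = (.read, h.val a) := by
        intro o ho
        exact List.eq_of_mem_replicate (hA ▸ List.mem_map_of_mem ho)
      refine ⟨a, A, B, rfl, ham, fun o ho => (History.lab_eq_iff.1 (hA' o ho)).1, ?_,
        History.forall_mem_map_lab.1 hne⟩
      rintro o (_ | ⟨_, ho⟩)
      · rfl
      · exact (History.lab_eq_iff.1 (hA' o ho)).2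
    · rintro ⟨a, A, B, rfl, ham, hAm, hA, hB⟩
      refine ⟨h.val a, A.length, B.map h.lab, ?_, History.forall_mem_map_lab.2 hB⟩
      rw [List.map_append, List.map_cons, List.cons_append, History.lab_eq_iff.2 ⟨ham, rfl⟩]
      congr 2
      rw [List.eq_replicate_iff]
      refine ⟨by simp, fun p hp => ?_⟩
      obtain ⟨o, ho, rfl⟩ := List.mem_map.1 hp
      exact History.lab_eq_iff.2 ⟨hAm o ho, hA o (by simp [ho])⟩
  have hviol : register.Violates .rWR e ↔ ∃ D, (∃ o ∈ h.ops, h.val o ∈ D) ∧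
      ∀ L, h.Lists D L → h.Respects L → ¬ ∃ a A B, L = a :: A ++ B ∧ h.meth a = .write ∧
        (∀ o ∈ A, h.meth o = .read) ∧ (∀ o ∈ a :: A, h.val o = h.val a) ∧
        ∀ o ∈ B, h.val o ≠ h.val a := by
    refine exists_congr fun D => and_congr ?_ (hshape D)
    rw [register_last_rWR, ne_eq, H.events_eq_nil_iff]
    push Not
    rfl
  rw [hviol]
  clear hshape hviol
  have hdefect : ∀ x, h.Defect False .write .read x → ∃ D, (∃ o ∈ h.ops, h.val o ∈ D) ∧
      ∀ L, h.Lists D L → h.Respects L → ¬ ∃ a A B, L = a :: A ++ B ∧ h.meth a = .write ∧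
        (∀ o ∈ A, h.meth o = .read) ∧ (∀ o ∈ a :: A, h.val o = h.val a) ∧
        ∀ o ∈ B, h.val o ≠ h.val a := by
    rintro x ⟨q, hq, hqm, hqx, hx⟩
    refine ⟨{x}, ⟨q, hq, hqx⟩, ?_⟩
    rintro L ⟨hL1, hL2⟩ hR ⟨a, A, B, rfl, ham, hAm, hA, hB⟩
    obtain ⟨ha, hax⟩ := (hL2 a).1 (by simp)
    rw [Set.mem_singleton_iff] at hax
    rcases hx with h1 | ⟨hf, -⟩ | ⟨p, hp, hpm, hpx, hlt⟩
    · exact h1 a ha ham hax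
    · exact hf
    · obtain rfl := hu p hp a ha hpm ham (hpx.trans hax.symm)
      have hqL := (hL2 q).2 ⟨hq, hqx⟩
      rw [List.cons_append, List.mem_cons] at hqL
      rcases hqL with rfl | hqL
      · rw [hqm] at ham
        cases ham
      · exact (History.respects_cons.1 hR).1 q hqL hlt
  constructor
  · rintro ⟨D, ⟨o₁, ho₁, hD₁⟩, hlin⟩
    by_cases hdef : ∃ x, h.Defect False .write .read x
    · obtain ⟨x, hx⟩ := hdef
      obtain ⟨ρ, hρ⟩ := exists_defectWord H hu hx
      exact ⟨ρ, Or.inl hρ⟩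
    push Not at hdef
    obtain ⟨x, -, y, -, hxy, -, h1, h2⟩ := exists_preceding_pair (h := h) (c := fun _ => True)
      ⟨o₁, ho₁, hD₁, trivial⟩ (by
        intro o₂ ho₂ hD₂ _
        by_contra hcon
        obtain ⟨p, hp, hpm, hpv⟩ := exists_input_of_no_defect hdef ho₂ (hmeth o₂)
        obtain ⟨A, hA1, hA2, hA3⟩ := H.exists_respects
          (h.ops.filter fun o => h.meth o = .read ∧ h.val o = h.val o₂) (Finset.filter_subset _ _)
        simp only [Finset.mem_filter] at hA2
        have hpA : p ∉ A := fun hpA => by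
          have := ((hA2 p).1 hpA).2.1
          rw [hpm] at this
          cases this
        have hfirst : ∀ b ∈ A, ¬ h.res b < h.inv p := fun b hb hlt =>
          hdef (h.val o₂) ⟨b, ((hA2 b).1 hb).1, ((hA2 b).1 hb).2.1, ((hA2 b).1 hb).2.2,
            Or.inr (Or.inr ⟨p, hp, hpm, hpv, hlt⟩)⟩
        obtain ⟨B, hB1, hB2, hB3⟩ := exists_linearization_first_block H hD₂ (A := p :: A)
          (List.nodup_cons.2 ⟨hpA, hA1⟩) (by
            intro o
            rw [List.mem_cons, hA2]
            constructor
            · rintro (rfl | h1)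
              · exact ⟨hp, hpv⟩
              · exact ⟨h1.1, h1.2.2⟩
            · rintro ⟨ho, hv⟩
              rcases hmeth o with hm | hm
              · exact Or.inl (hu o ho p hp hm hpm (hv.trans hpv.symm))
              · exact Or.inr ⟨ho, hm, hv⟩)
          (History.respects_cons.2 ⟨hfirst, hA3⟩) (by
            intro o ho o' ho' hD hne heq hlt
            exact hcon ⟨o, ho, o', ho', hD, hne, heq, hlt⟩)
        refine hlin _ hB1 hB2 ⟨p, A, B, rfl, hpm, fun o ho => ((hA2 o).1 ho).2.1, ?_, ?_⟩
        · rintro o (_ | ⟨_, ho⟩)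
          · rfl
          · rw [hpv]
            exact ((hA2 o).1 ho).2.2
        · rwa [hpv])
    obtain ⟨o, ho, o', ho', hoy, hox, hlt⟩ := h1
    obtain ⟨p, hp, p', hp', hpx, hpy, hplt⟩ := h2.resolve_left (by simp)
    refine ⟨twoColours x y, Or.inr ⟨⟨?_, ?_⟩, ?_, ?_⟩⟩
    · exact not_two_input H hu fun n => twoColours_eq_one.1
    · exact not_two_input H hu fun n => (twoColours_eq_two hxy).1
    · rw [bef_paint H]
      exact ⟨o, ho, o', ho', (twoColours_eq_two hxy).2 hoy, twoColours_eq_one.2 hox, hlt⟩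
    · rw [bef_paint H]
      exact ⟨p, hp, p', hp', twoColours_eq_one.2 hpx, (twoColours_eq_two hxy).2 hpy, hplt⟩
  · rintro ρ hρ
    by_cases hdef : ∃ x, h.Defect False .write .read x
    · obtain ⟨x, hx⟩ := hdef
      exact hdefect x hx
    rcases hρ with hρ | ⟨⟨ht1, ht2⟩, hb1, hb2⟩
    · exact absurd (exists_defect_of_word H hρ) hdef
    push Not at hdef
    rw [bef_paint H] at hb1 hb2
    obtain ⟨o, ho, o', ho', hk, hk', hlt⟩ := hb1
    obtain ⟨p, hp, p', hp', hj, hj', hplt⟩ := hb2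
    have hx := val_eq_of_not_two H hdef ht1 ho' hp (hmeth _) (hmeth _) hk' hj
    have hy := val_eq_of_not_two H hdef ht2 ho hp' (hmeth _) (hmeth _) hk hj'
    have hxy : h.val o ≠ h.val o' := fun heq => by
      rw [heq, hk'] at hk
      exact absurd hk (by decide)
    refine ⟨{h.val o, h.val o'}, ⟨o, ho, by simp⟩, ?_⟩
    rintro L hL hR ⟨a, A, B, rfl, ham, hAm, hA, hB⟩
    obtain ⟨ha, haD⟩ := (hL.2 a).1 (by simp)
    rcases haD with haD | haD
    · exact hR.not_before_first_block hL hA hB hp hp' (by simp [← hx]) (by simp [← hy])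
        (by rw [haD, ← hx]; exact hxy.symm) (by rw [haD, hy]) hplt
    · rw [Set.mem_singleton_iff] at haD
      exact hR.not_before_first_block hL hA hB ho ho' (by simp) (by simp)
        (by rw [haD]; exact hxy) haD.symm hlt

end Register

/-! ### The rule `LU` -/

section Mutex

variable {O : Type*}

theorem mutex_last_rLU (u : List (Event MutexMethod)) :
    mutex.last u = .rLU ↔ Contains .unlock u := by
  simp only [mutex]
  split_ifs with h1 h2 <;> simp [h1]

/-- The coloured words in which the colours `1` and `2` stand for two values such that `1` has an
`Unlock`, an operation of `2` happens before one of `1`, and conversely if `2` has an `Unlock`. -/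
def LUPairWord (w : List (Action MutexMethod (Fin 4) Unit)) : Prop :=
  (¬ Two (fun m k => m = .lock ∧ k = 1) w ∧ ¬ Two (fun m k => m = .lock ∧ k = 2) w) ∧
  Has (fun m k => m = .unlock ∧ k = 1) w ∧
  Bef (fun _ k => k = 2) (fun _ k => k = 1) w ∧
  (¬ Has (fun m k => m = .unlock ∧ k = 2) w ∨ Bef (fun _ k => k = 1) (fun _ k => k = 2) w)

theorem recognizable_luPairWord : Recognizable LUPairWord :=
  ((recognizable_two _).not.and (recognizable_two _).not).and
    ((recognizable_has _).and
      ((recognizable_bef _ _).and ((recognizable_has _).not.or (recognizable_bef _ _))))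

theorem mutex_rLU : mutex.CoRegular O .rLU := by
  classical
  refine coRegular_of_recognizable
    ((recognizable_defectWord True .lock .unlock).or recognizable_luPairWord) fun e h H hd => ?_
  have hu := inputUnique_of_differentiated H hd (m := .lock) rfl
  have hmeth : ∀ o, h.meth o = .lock ∨ h.meth o = .unlock := fun o => by
    cases h.meth o <;> simp
  have hviol : mutex.Violates .rLU e ↔ ∃ D, (∃ o ∈ h.ops, h.val o ∈ D ∧ h.meth o = .unlock) ∧
      ∀ L, h.Lists D L → h.Respects L → ¬ ∃ a b B, L = [a, b] ++ B ∧ h.meth a = .lock ∧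
        h.meth b = .unlock ∧ h.val b = h.val a ∧ ∀ o ∈ B, h.val o ≠ h.val a := by
    refine exists_congr fun D => and_congr ?_ ?_
    · rw [mutex_last_rLU, H.contains_iff]
    rw [H.linearizable_proj_iff, not_exists]
    refine forall_congr' fun L => ?_
    rw [not_and, not_and]
    refine forall_congr' fun _ => forall_congr' fun _ => not_congr ?_
    change _ ∈ (Rule.mk 1 [] [.meth .lock, .meth .unlock, .var 0] : Rule MutexMethod).matchingSet ↔ _
    rw [mem_matchingSet_two]
    constructor
    · rintro ⟨x, u, hL, hne⟩
      rw [List.map_eq_cons_iff] at hL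
      obtain ⟨a, L', rfl, ha, hL'⟩ := hL
      rw [List.map_eq_cons_iff] at hL'
      obtain ⟨b, B, rfl, hb, rfl⟩ := hL'
      obtain ⟨ham, rfl⟩ := History.lab_eq_iff.1 ha
      obtain ⟨hbm, hbv⟩ := History.lab_eq_iff.1 hb
      exact ⟨a, b, B, rfl, ham, hbm, hbv, History.forall_mem_map_lab.1 hne⟩
    · rintro ⟨a, b, B, rfl, ham, hbm, hbv, hB⟩
      refine ⟨h.val a, B.map h.lab, ?_, History.forall_mem_map_lab.2 hB⟩
      simp [History.lab, ham, hbm, hbv]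
  rw [hviol]
  clear hviol
  constructor
  · rintro ⟨D, ⟨q, hq, hqD, hqm⟩, hlin⟩
    by_cases hdef : ∃ x, h.Defect True .lock .unlock x
    · obtain ⟨x, hx⟩ := hdef
      obtain ⟨ρ, hρ⟩ := exists_defectWord H hu hx
      exact ⟨ρ, Or.inl hρ⟩
    push Not at hdef
    obtain ⟨x, hxD, y, -, hxy, ⟨r, hr, hrm, hrx⟩, h1, h2⟩ := exists_preceding_pair (h := h)
      (c := fun x => ∃ r ∈ h.ops, h.meth r = .unlock ∧ h.val r = x)
      ⟨q, hq, hqD, q, hq, hqm, rfl⟩ (by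
        rintro o₂ ho₂ hD₂ ⟨r, hr, hrm, hrv⟩
        by_contra hcon
        obtain ⟨p, hp, hpm, hpv⟩ := exists_input_of_no_defect hdef ho₂ (hmeth o₂)
        have hpr : p ≠ r := by
          rintro rfl
          rw [hpm] at hrm
          cases hrm
        obtain ⟨B, hB1, hB2, hB3⟩ := exists_linearization_first_block H hD₂ (A := [p, r])
          (by simpa using hpr) (by
            intro o
            simp only [List.mem_cons, List.not_mem_nil, or_false]
            constructor
            · rintro (rfl | rfl)
              · exact ⟨hp, hpv⟩
              · exact ⟨hr, hrv⟩
            · rintro ⟨ho, hv⟩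
              rcases hmeth o with hm | hm
              · exact Or.inl (hu o ho p hp hm hpm (hv.trans hpv.symm))
              · by_contra hne
                push Not at hne
                exact hdef (h.val o₂) ⟨r, hr, hrm, hrv,
                  Or.inr (Or.inl ⟨trivial, o, ho, hne.2, hm, hv⟩)⟩)
          (by
            simp only [History.Respects, List.pairwise_cons, List.mem_singleton, forall_eq,
              List.not_mem_nil, false_imp_iff, implies_true, List.Pairwise.nil, and_true]
            exact fun hlt => hdef (h.val o₂) ⟨r, hr, hrm, hrv,
              Or.inr (Or.inr ⟨p, hp, hpm, hpv, hlt⟩)⟩)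
          (by
            intro o ho o' ho' hD hne heq hlt
            exact hcon ⟨o, ho, o', ho', hD, hne, heq, hlt⟩)
        refine hlin _ hB1 hB2 ⟨p, r, B, rfl, hpm, hrm, hrv.trans hpv.symm, ?_⟩
        rwa [hpv])
    obtain ⟨o, ho, o', ho', hoy, hox, hlt⟩ := h1
    refine ⟨twoColours x y, Or.inr ⟨⟨?_, ?_⟩, ?_, ?_, ?_⟩⟩
    · exact not_two_input H hu fun n => twoColours_eq_one.1
    · exact not_two_input H hu fun n => (twoColours_eq_two hxy).1
    · rw [has_paint H]
      exact ⟨r, hr, hrm, twoColours_eq_one.2 hrx⟩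
    · rw [bef_paint H]
      exact ⟨o, ho, o', ho', (twoColours_eq_two hxy).2 hoy, twoColours_eq_one.2 hox, hlt⟩
    · rcases h2 with h2 | ⟨p, hp, p', hp', hpx, hpy, hplt⟩
      · left
        rw [has_paint H]
        rintro ⟨s, hs, hsm, hsv⟩
        exact h2 ⟨s, hs, hsm, (twoColours_eq_two hxy).1 hsv⟩
      · right
        rw [bef_paint H]
        exact ⟨p, hp, p', hp', twoColours_eq_one.2 hpx, (twoColours_eq_two hxy).2 hpy, hplt⟩
  · rintro ρ hρ
    by_cases hdef : ∃ x, h.Defect True .lock .unlock x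
    · obtain ⟨x, hx⟩ := hdef
      obtain ⟨q, hq, hqm, hqx, -⟩ := id hx
      refine ⟨{x}, ⟨q, hq, hqx, hqm⟩, ?_⟩
      rintro L hL hR ⟨a, b, B, rfl, ham, hbm, hbv, hB⟩
      have hBnil : B = [] := by
        rw [List.eq_nil_iff_forall_not_mem]
        intro o ho
        have ha := ((hL.2 a).1 (by simp)).2
        have ho' := ((hL.2 o).1 (by simp [ho])).2
        exact hB o ho (ho'.trans ha.symm)
      subst hBnil
      exact hx.not_pair (by simp) ham hbm hL hR
    rcases hρ with hρ | ⟨⟨ht1, ht2⟩, hh, hb1, hb2⟩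
    · exact absurd (exists_defect_of_word H hρ) hdef
    push Not at hdef
    rw [has_paint H] at hh
    obtain ⟨q, hq, hqm, hqk⟩ := hh
    rw [bef_paint H] at hb1
    obtain ⟨o, ho, o', ho', hk, hk', hlt⟩ := hb1
    have hqx := val_eq_of_not_two H hdef ht1 hq ho' (hmeth _) (hmeth _) hqk hk'
    have hxy : h.val o ≠ h.val o' := fun heq => by
      rw [heq, hk'] at hk
      exact absurd hk (by decide)
    refine ⟨{h.val o, h.val o'}, ⟨q, hq, by simp [hqx], hqm⟩, ?_⟩
    rintro L hL hR ⟨a, b, B, rfl, ham, hbm, hbv, hB⟩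
    have hA : ∀ c ∈ [a, b], h.val c = h.val a := by
      simp [hbv]
    obtain ⟨ha, haD⟩ := (hL.2 a).1 (by simp)
    rcases haD with haD | haD
    · rcases hb2 with hb2 | hb2
      · rw [has_paint H] at hb2
        exact hb2 ⟨b, ((hL.2 b).1 (by simp)).1, hbm, by rw [hbv, haD, hk]⟩
      · rw [bef_paint H] at hb2
        obtain ⟨p, hp, p', hp', hj, hj', hplt⟩ := hb2
        have hx := val_eq_of_not_two H hdef ht1 ho' hp (hmeth _) (hmeth _) hk' hj
        have hy := val_eq_of_not_two H hdef ht2 ho hp' (hmeth _) (hmeth _) hk hj'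
        exact hR.not_before_first_block hL hA hB hp hp' (by simp [← hx]) (by simp [← hy])
          (by rw [haD, ← hx]; exact hxy.symm) (by rw [haD, hy]) hplt
    · rw [Set.mem_singleton_iff] at haD
      exact hR.not_before_first_block hL hA hB ho ho' (by simp) (by simp)
        (by rw [haD]; exact hxy) haD.symm hlt

end Mutex

/-! ### The rule `EnqDeq` -/

section EnqDeq

variable {O : Type*}

theorem queue_last_rEnqDeq (u : List (Event QueueMethod)) :
    queue.last u = .rEnqDeq ↔ ¬ Contains .deqEmpty u ∧ Contains .deq u := by
  simp only [queue]
  split_ifs with h1 h2 h3 <;> simp [*]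

/-- The coloured words in which the colours `1` and `2` stand for two values such that `1` is
dequeued, an operation of `2` happens before the `Enq` of `1`, and `2` is not dequeued or the `Deq`
of `1` happens before the one of `2`. -/
def EnqDeqPairWord (w : List (Action QueueMethod (Fin 4) Unit)) : Prop :=
  (¬ Two (fun m k => m = .enq ∧ k = 1) w ∧ ¬ Two (fun m k => m = .enq ∧ k = 2) w) ∧
  Has (fun m k => m = .deq ∧ k = 1) w ∧
  Bef (fun m k => (m = .enq ∨ m = .deq) ∧ k = 2) (fun m k => m = .enq ∧ k = 1) w ∧
  (¬ Has (fun m k => m = .deq ∧ k = 2) w ∨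
    Bef (fun m k => m = .deq ∧ k = 1) (fun m k => m = .deq ∧ k = 2) w)

theorem recognizable_enqDeqPairWord : Recognizable EnqDeqPairWord :=
  ((recognizable_two _).not.and (recognizable_two _).not).and
    ((recognizable_has _).and
      ((recognizable_bef _ _).and ((recognizable_has _).not.or (recognizable_bef _ _))))

/-- If every dequeued value of `D` is obstructed, then two values obstruct each other: the one with
the first return, and the one with the first return of a `Deq`. -/
theorem exists_enqDeq_pair {e : List (Action QueueMethod ℕ O)} {h : History QueueMethod O}
    (H : h.Of e) (hu : h.InputUnique .enq) (hdef : ∀ x, ¬ h.Defect True .enq .deq x) {D : Set ℕ}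
    (hc : ∃ q ∈ h.ops, h.val q ∈ D ∧ h.meth q = .deq)
    (hne : ¬ ∃ q ∈ h.ops, h.val q ∈ D ∧ h.meth q = .deqEmpty)
    (hbad : ∀ p ∈ h.ops, ∀ q ∈ h.ops, h.val p ∈ D → h.meth p = .enq → h.meth q = .deq →
      h.val p = h.val q → ∃ o ∈ h.ops, h.val o ∈ D ∧
        (h.res o < h.inv p ∨ (h.meth o = .deq ∧ h.res o < h.inv q))) :
    ∃ o ∈ h.ops, ∃ p ∈ h.ops, ∃ q ∈ h.ops, h.val o ≠ h.val p ∧ (h.meth o = .enq ∨ h.meth o = .deq) ∧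
      h.meth p = .enq ∧ h.meth q = .deq ∧ h.val p = h.val q ∧ h.res o < h.inv p ∧
      ∀ q' ∈ h.ops, h.meth q' = .deq → h.val q' = h.val o →
        ∃ q'' ∈ h.ops, h.meth q'' = .deq ∧ h.val q'' = h.val q ∧ h.res q'' < h.inv q' := by
  classical
  obtain ⟨o₁, ho₁, hD₁, hm₁⟩ := hc
  obtain ⟨o₀, ho₀, hmin⟩ := Finset.exists_min_image (h.ops.filter fun o => h.val o ∈ D) h.res
    ⟨o₁, by simp [ho₁, hD₁]⟩
  obtain ⟨z, hz, hzmin⟩ := Finset.exists_min_image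
    (h.ops.filter fun o => h.val o ∈ D ∧ h.meth o = .deq) h.res ⟨o₁, by simp [ho₁, hD₁, hm₁]⟩
  simp only [Finset.mem_filter, and_imp] at ho₀ hmin hz hzmin
  obtain ⟨ho₀, hD₀⟩ := ho₀
  obtain ⟨hz, hzD, hzm⟩ := hz
  obtain ⟨p, hp, hpm, hpv⟩ := exists_input_of_no_defect hdef hz (Or.inr hzm)
  have hm₀ : h.meth o₀ = .enq ∨ h.meth o₀ = .deq := by
    cases hm : h.meth o₀
    · exact Or.inl rfl
    · exact Or.inr rfl
    · exact absurd ⟨o₀, ho₀, hD₀, hm⟩ hne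
  -- an operation that returns before everything else is not preceded by its own insertion
  have hself : ∀ p ∈ h.ops, h.meth p = .enq → h.val p = h.val o₀ → ¬ h.res o₀ < h.inv p := by
    intro p hp hpm hpv hlt
    rcases hm₀ with hm | hm
    · obtain rfl := hu p hp o₀ ho₀ hpm hm hpv
      have h1 := H.inv_lt_res p hp
      omega
    · exact hdef (h.val o₀) ⟨o₀, ho₀, hm, rfl, Or.inr (Or.inr ⟨p, hp, hpm, hpv, hlt⟩)⟩
  have hlt : h.res o₀ < h.inv p := by
    obtain ⟨o, ho, hoD, hlt | ⟨hom, hlt⟩⟩ := hbad p hp z hz (by rwa [hpv]) hpm hzm hpv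
    · exact (hmin o ho hoD).trans_lt hlt
    · have h1 := hzmin o ho hoD hom
      have h2 := H.inv_lt_res z hz
      omega
  refine ⟨o₀, ho₀, p, hp, z, hz, ?_, hm₀, hpm, hzm, hpv, hlt, ?_⟩
  · intro heq
    exact hself p hp hpm heq.symm hlt
  · intro q' hq' hqm' hqv'
    obtain ⟨p', hp', hpm', hpv'⟩ := exists_input_of_no_defect hdef ho₀ hm₀
    obtain ⟨o, ho, hoD, hlt' | ⟨hom, hlt'⟩⟩ := hbad p' hp' q' hq' (by rwa [hpv']) hpm' hqm'
      (hpv'.trans hqv'.symm)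
    · exact absurd ((hmin o ho hoD).trans_lt hlt') (hself p' hp' hpm' hpv')
    · exact ⟨z, hz, hzm, rfl, (hzmin o ho hoD hom).trans_lt hlt'⟩

theorem queue_rEnqDeq : queue.CoRegular O .rEnqDeq := by
  classical
  refine coRegular_of_recognizable
    ((recognizable_defectWord True .enq .deq).or recognizable_enqDeqPairWord) fun e h H hd => ?_
  have hu := inputUnique_of_differentiated H hd (m := .enq) rfl
  have hviol : queue.Violates .rEnqDeq e ↔
      ∃ D, ((¬ ∃ o ∈ h.ops, h.val o ∈ D ∧ h.meth o = .deqEmpty) ∧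
        ∃ o ∈ h.ops, h.val o ∈ D ∧ h.meth o = .deq) ∧
      ∀ L, h.Lists D L → h.Respects L → ¬ ∃ a A b B, L = a :: (A ++ b :: B) ∧ h.meth a = .enq ∧
        h.meth b = .deq ∧ h.val b = h.val a ∧ (∀ o ∈ A, h.meth o = .enq) ∧
        (∀ o ∈ B, h.meth o = .enq ∨ h.meth o = .deq) ∧
        (∀ o ∈ A, h.val o ≠ h.val a) ∧ ∀ o ∈ B, h.val o ≠ h.val a := by
    refine exists_congr fun D => and_congr ?_ ?_
    · rw [queue_last_rEnqDeq, H.contains_iff, H.contains_iff]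
    rw [H.linearizable_proj_iff, not_exists]
    refine forall_congr' fun L => ?_
    rw [not_and, not_and]
    refine forall_congr' fun _ => forall_congr' fun _ => not_congr ?_
    change _ ∈ (Rule.mk 2 [.methods 0 {.enq}, .methods 1 {.enq, .deq}]
      [.meth .enq, .var 0, .meth .deq, .var 1] : Rule QueueMethod).matchingSet ↔ _
    rw [mem_matchingSet_pair]
    simp only [List.mem_cons, List.not_mem_nil, or_false, forall_eq_or_imp, forall_eq,
      Atom.Holds, Set.mem_singleton_iff, Set.mem_insert_iff]
    constructor
    · rintro ⟨us, x, ⟨hg0, hg1⟩, hL, h0, h1⟩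
      rw [List.map_eq_cons_iff] at hL
      obtain ⟨a, L', rfl, ha, hL'⟩ := hL
      rw [List.map_eq_append_iff] at hL'
      obtain ⟨A, L'', rfl, hA, hL''⟩ := hL'
      rw [List.map_eq_cons_iff] at hL''
      obtain ⟨b, B, rfl, hb, hB⟩ := hL''
      obtain ⟨ham, rfl⟩ := History.lab_eq_iff.1 ha
      obtain ⟨hbm, hbv⟩ := History.lab_eq_iff.1 hb
      rw [← hA] at hg0 h0
      rw [← hB] at hg1 h1
      exact ⟨a, A, b, B, rfl, ham, hbm, hbv, History.forall_mem_map_lab.1 hg0,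
        History.forall_mem_map_lab.1 hg1, History.forall_mem_map_lab.1 h0,
        History.forall_mem_map_lab.1 h1⟩
    · rintro ⟨a, A, b, B, rfl, ham, hbm, hbv, hA, hB, h0, h1⟩
      refine ⟨fun i => if i = 0 then A.map h.lab else B.map h.lab, h.val a,
        ⟨History.forall_mem_map_lab.2 hA, History.forall_mem_map_lab.2 hB⟩, ?_,
        History.forall_mem_map_lab.2 h0, History.forall_mem_map_lab.2 h1⟩
      simp [History.lab, ham, hbm, hbv]
  rw [hviol]
  clear hviol
  constructor
  · rintro ⟨D, ⟨hne, hc⟩, hlin⟩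
    by_cases hdef : ∃ x, h.Defect True .enq .deq x
    · obtain ⟨x, hx⟩ := hdef
      obtain ⟨ρ, hρ⟩ := exists_defectWord H hu hx
      exact ⟨ρ, Or.inl hρ⟩
    push Not at hdef
    have hmeth : ∀ o ∈ h.ops, h.val o ∈ D → h.meth o = .enq ∨ h.meth o = .deq := by
      intro o ho hD
      cases hm : h.meth o
      · exact Or.inl rfl
      · exact Or.inr rfl
      · exact absurd ⟨o, ho, hD, hm⟩ hne
    obtain ⟨o, ho, p, hp, q, hq, hov, hom, hpm, hqm, hpv, hlt, hnext⟩ :=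
      exists_enqDeq_pair H hu hdef hc hne (by
        intro p hp q hq hpD hpm hqm hpv
        by_contra hcon
        -- the enqueues that have to precede `q` are put before it, the rest after it
        obtain ⟨A, hA1, hA2, hA3⟩ := H.exists_respects
          (h.ops.filter fun o => h.val o ∈ D ∧ h.val o ≠ h.val p ∧ h.res o < h.inv q)
          (Finset.filter_subset _ _)
        obtain ⟨B, hB1, hB2, hB3⟩ := H.exists_respects
          (h.ops.filter fun o => h.val o ∈ D ∧ h.val o ≠ h.val p ∧ ¬ h.res o < h.inv q)
          (Finset.filter_subset _ _)
        simp only [Finset.mem_filter] at hA2 hB2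
        have hxops : ∀ o ∈ h.ops, h.val o = h.val p → o = p ∨ o = q := by
          intro o ho hv
          rcases hmeth o ho (by rwa [hv]) with hm | hm
          · exact Or.inl (hu o ho p hp hm hpm hv)
          · by_contra hcon'
            push Not at hcon'
            exact hdef (h.val p) ⟨q, hq, hqm, hpv.symm,
              Or.inr (Or.inl ⟨trivial, o, ho, hcon'.2, hm, hv⟩)⟩
        have hpq : p ≠ q := by
          rintro rfl
          rw [hpm] at hqm
          cases hqm
        have hAenq : ∀ o ∈ A, h.meth o = .enq := by
          intro o ho
          have ho' := (hA2 o).1 ho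
          refine (hmeth o ho'.1 ho'.2.1).resolve_right fun hm => hcon ?_
          exact ⟨o, ho'.1, ho'.2.1, Or.inr ⟨hm, ho'.2.2.2⟩⟩
        have hfirst : ∀ o ∈ h.ops, h.val o ∈ D → ¬ h.res o < h.inv p :=
          fun o ho hD hlt => hcon ⟨o, ho, hD, Or.inl hlt⟩
        refine hlin (p :: (A ++ q :: B)) ⟨?_, ?_⟩ ?_ ⟨p, A, q, B, rfl, hpm, hqm, hpv.symm, hAenq,
          fun o ho => hmeth o ((hB2 o).1 ho).1 ((hB2 o).1 ho).2.1,
          fun o ho => ((hA2 o).1 ho).2.2.1, fun o ho => ((hB2 o).1 ho).2.2.1⟩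
        · rw [List.nodup_cons, List.nodup_append, List.nodup_cons]
          refine ⟨?_, hA1, ⟨?_, hB1⟩, ?_⟩
          · rw [List.mem_append, List.mem_cons, hA2, hB2]
            rintro (h1 | h1 | h1)
            · exact h1.2.2.1 rfl
            · exact hpq h1
            · exact h1.2.2.1 rfl
          · rw [hB2]
            exact fun h1 => h1.2.2.1 hpv.symm
          · rintro a ha b hb rfl
            rw [List.mem_cons, hB2] at hb
            rw [hA2] at ha
            rcases hb with rfl | hb
            · exact ha.2.2.1 hpv.symm
            · exact hb.2.2.2 ha.2.2.2
        · intro o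
          rw [List.mem_cons, List.mem_append, List.mem_cons, hA2, hB2]
          constructor
          · rintro (rfl | h1 | rfl | h1)
            · exact ⟨hp, hpD⟩
            · exact ⟨h1.1, h1.2.1⟩
            · exact ⟨hq, by rwa [← hpv]⟩
            · exact ⟨h1.1, h1.2.1⟩
          · rintro ⟨ho, hoD⟩
            by_cases hv : h.val o = h.val p
            · rcases hxops o ho hv with rfl | rfl <;> simp
            · by_cases hlt : h.res o < h.inv q
              · exact Or.inr (Or.inl ⟨ho, hoD, hv, hlt⟩)
              · exact Or.inr (Or.inr (Or.inr ⟨ho, hoD, hv, hlt⟩))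
        · rw [History.respects_cons, History.respects_append, History.respects_cons]
          refine ⟨?_, hA3, ⟨?_, hB3⟩, ?_⟩
          · intro o ho
            rw [List.mem_append, List.mem_cons, hA2, hB2] at ho
            rcases ho with h1 | rfl | h1
            · exact hfirst o h1.1 h1.2.1
            · exact hfirst o hq (by rwa [← hpv])
            · exact hfirst o h1.1 h1.2.1
          · intro o ho
            exact ((hB2 o).1 ho).2.2.2
          · intro a ha b hb
            have ha' := (hA2 a).1 ha
            have h1 := H.inv_lt_res a ha'.1
            rw [List.mem_cons] at hb
            rcases hb with rfl | hb
            · have h2 := H.inv_lt_res b hq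
              omega
            · have h2 := ((hB2 b).1 hb).2.2.2
              omega)
    have hxy : h.val p ≠ h.val o := hov.symm
    refine ⟨twoColours (h.val p) (h.val o), Or.inr ⟨⟨?_, ?_⟩, ?_, ?_, ?_⟩⟩
    · exact not_two_input H hu fun n => twoColours_eq_one.1
    · exact not_two_input H hu fun n => (twoColours_eq_two hxy).1
    · rw [has_paint H]
      exact ⟨q, hq, hqm, twoColours_eq_one.2 hpv.symm⟩
    · rw [bef_paint H]
      exact ⟨o, ho, p, hp, ⟨hom, (twoColours_eq_two hxy).2 rfl⟩,
        ⟨hpm, twoColours_eq_one.2 rfl⟩, hlt⟩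
    · rw [has_paint H, bef_paint H]
      by_cases hdeq : ∃ q' ∈ h.ops, h.meth q' = .deq ∧ h.val q' = h.val o
      · obtain ⟨q', hq', hqm', hqv'⟩ := hdeq
        obtain ⟨q'', hq'', hqm'', hqv'', hlt''⟩ := hnext q' hq' hqm' hqv'
        exact Or.inr ⟨q'', hq'', q', hq', ⟨hqm'', twoColours_eq_one.2 (hqv''.trans hpv.symm)⟩,
          ⟨hqm', (twoColours_eq_two hxy).2 hqv'⟩, hlt''⟩
      · left
        rintro ⟨s, hs, hsm, hsv⟩
        exact hdeq ⟨s, hs, hsm, (twoColours_eq_two hxy).1 hsv⟩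
  · rintro ρ hρ
    have hunused : ∀ q ∈ h.ops, ∀ o ∈ h.ops, h.meth q = .deqEmpty → h.val q = h.val o → q = o :=
      fun q hq o ho hm hv => ((H.differentiated_iff queue).1 hd).2 q hq o ho hm hv
    by_cases hdef : ∃ x, h.Defect True .enq .deq x
    · obtain ⟨x, hx⟩ := hdef
      obtain ⟨q, hq, hqm, hqx, -⟩ := id hx
      refine ⟨{x}, ⟨?_, q, hq, hqx, hqm⟩, ?_⟩
      · rintro ⟨o, ho, hox, hom⟩
        obtain rfl := hunused o ho q hq hom (hox.trans hqx.symm)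
        rw [hom] at hqm
        cases hqm
      rintro L hL hR ⟨a, A, b, B, rfl, ham, hbm, hbv, -, -, hA, hB⟩
      have ha := ((hL.2 a).1 (by simp)).2
      have hAnil : A = [] := by
        rw [List.eq_nil_iff_forall_not_mem]
        intro o ho
        exact hA o ho (((hL.2 o).1 (by simp [ho])).2.trans ha.symm)
      have hBnil : B = [] := by
        rw [List.eq_nil_iff_forall_not_mem]
        intro o ho
        exact hB o ho (((hL.2 o).1 (by simp [ho])).2.trans ha.symm)
      subst hAnil hBnil
      exact hx.not_pair (by simp) ham hbm hL hR
    rcases hρ with hρ | ⟨⟨ht1, ht2⟩, hh, hb1, hb2⟩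
    · exact absurd (exists_defect_of_word H hρ) hdef
    push Not at hdef
    rw [has_paint H] at hh
    obtain ⟨q, hq, hqm, hqk⟩ := hh
    rw [bef_paint H] at hb1
    obtain ⟨o, ho, p, hp, ⟨hom, hk⟩, ⟨hpm, hk'⟩, hlt⟩ := hb1
    have hqp := val_eq_of_not_two H hdef ht1 hq hp (Or.inr hqm) (Or.inl hpm) hqk hk'
    have hxy : h.val o ≠ h.val p := fun heq => by
      rw [heq, hk'] at hk
      exact absurd hk (by decide)
    refine ⟨{h.val o, h.val p}, ⟨?_, q, hq, by simp [hqp], hqm⟩, ?_⟩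
    · rintro ⟨s, hs, hsv, hsm⟩
      rcases hsv with hsv | hsv
      · obtain rfl := hunused s hs o ho hsm hsv
        rw [hsm] at hom
        rcases hom with hom | hom <;> cases hom
      · obtain rfl := hunused s hs p hp hsm hsv
        rw [hsm] at hpm
        cases hpm
    rintro L hL hR ⟨a, A, b, B, rfl, ham, hbm, hbv, hA, -, -, -⟩
    obtain ⟨ha, haD⟩ := (hL.2 a).1 (by simp)
    rcases haD with haD | haD
    · -- colour `2` comes first: its `Deq` is preceded by the `Deq` of colour `1`
      have hb := ((hL.2 b).1 (by simp)).1
      rcases hb2 with hb2 | hb2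
      · rw [has_paint H] at hb2
        exact hb2 ⟨b, hb, hbm, by rw [hbv, haD, hk]⟩
      · rw [bef_paint H] at hb2
        obtain ⟨r, hr, r', hr', ⟨hrm, hrk⟩, ⟨hrm', hrk'⟩, hrlt⟩ := hb2
        have hrp := val_eq_of_not_two H hdef ht1 hr hp (Or.inr hrm) (Or.inl hpm) hrk hk'
        have hro := val_eq_of_not_two H hdef ht2 hr' ho (Or.inr hrm') hom hrk' hk
        have hrb : r' = b := by
          by_contra hne
          exact hdef (h.val o) ⟨b, hb, hbm, hbv.trans haD,
            Or.inr (Or.inl ⟨trivial, r', hr', hne, hrm', hro⟩)⟩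
        subst hrb
        have hrL := (hL.2 r).2 ⟨hr, by simp [hrp]⟩
        rw [History.respects_cons, History.respects_append, History.respects_cons] at hR
        rw [List.mem_cons, List.mem_append, List.mem_cons] at hrL
        rcases hrL with rfl | hrL | rfl | hrL
        · rw [ham] at hrm
          cases hrm
        · have := hA r hrL
          rw [this] at hrm
          cases hrm
        · exact hxy (hro.symm.trans hrp)
        · exact hR.2.2.1.1 r hrL hrlt
    · rw [Set.mem_singleton_iff] at haD
      obtain rfl := hu a ha p hp ham hpm haD
      have hoL := (hL.2 o).2 ⟨ho, by simp⟩
      rw [List.mem_cons] at hoL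
      rcases hoL with rfl | hoL
      · exact hxy rfl
      · exact (History.respects_cons.1 hR).1 o hoL hlt

end EnqDeq

/-! ### Covers of an interval -/

/-- In a cover of the points of `(lo, hi]` by intervals `(s z, t z]` that has the least number of
members, each member contains a point of `(lo, hi]` of its own, and no point lies in three members:
of three intervals with a common point, the one with the middle private point is contained in the
union of the others. -/
theorem exists_minimal_cover {β : Type*} (Y : Finset β) (s t : β → ℕ) (lo hi : ℕ)
    (hY : ∀ n, lo < n → n ≤ hi → ∃ y ∈ Y, s y < n ∧ n ≤ t y) :
    ∃ Z ⊆ Y, (∀ n, lo < n → n ≤ hi → ∃ y ∈ Z, s y < n ∧ n ≤ t y) ∧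
      (∀ z ∈ Z, ∃ n, lo < n ∧ n ≤ hi ∧ s z < n ∧ n ≤ t z) ∧
      ∀ n, (Z.filter fun z => s z < n ∧ n ≤ t z).card ≤ 2 := by
  classical
  obtain ⟨Z, hZ, hmin⟩ := Finset.exists_min_image
    (Y.powerset.filter fun Z => ∀ n, lo < n → n ≤ hi → ∃ y ∈ Z, s y < n ∧ n ≤ t y)
    Finset.card ⟨Y, by simpa using hY⟩
  simp only [Finset.mem_filter, Finset.mem_powerset, and_imp] at hZ hmin
  have hpriv : ∀ z ∈ Z, ∃ n, lo < n ∧ n ≤ hi ∧ (s z < n ∧ n ≤ t z) ∧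
      ∀ y ∈ Z, s y < n → n ≤ t y → y = z := by
    intro z hz
    by_contra hcon
    push Not at hcon
    refine absurd (hmin (Z.erase z) ((Finset.erase_subset _ _).trans hZ.1) ?_)
      (not_le.2 (Finset.card_erase_lt_of_mem hz))
    intro n h1 h2
    obtain ⟨y, hy, hy1, hy2⟩ := hZ.2 n h1 h2
    by_cases hyz : y = z
    · subst hyz
      obtain ⟨y', hy', h3, h4, h5⟩ := hcon n h1 h2 ⟨hy1, hy2⟩
      exact ⟨y', Finset.mem_erase.2 ⟨h5, hy'⟩, h3, h4⟩
    · exact ⟨y, Finset.mem_erase.2 ⟨hyz, hy⟩, hy1, hy2⟩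
  choose! p hp using hpriv
  refine ⟨Z, hZ.1, hZ.2, fun z hz => ⟨p z, (hp z hz).1, (hp z hz).2.1, (hp z hz).2.2.1⟩, ?_⟩
  intro n
  by_contra hcard
  rw [not_le, Finset.two_lt_card] at hcard
  obtain ⟨a, ha, b, hb, c, hc, hab, hac, hbc⟩ := hcard
  rw [Finset.mem_filter] at ha hb hc
  have hinj : ∀ x ∈ Z, ∀ y ∈ Z, x ≠ y → p x ≠ p y := by
    intro x hx y hy hxy heq
    have h1 := (hp x hx).2.2.1
    exact hxy ((hp y hy).2.2.2 x hx (by omega) (by omega))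
  have hmid : ∀ x y z, (x ∈ Z ∧ s x < n ∧ n ≤ t x) → (y ∈ Z ∧ s y < n ∧ n ≤ t y) →
      (z ∈ Z ∧ s z < n ∧ n ≤ t z) → p x < p y → p y < p z → False := by
    intro x y z hx hy hz hxy hyz
    have hpx := (hp x hx.1).2.2.1
    have hpz := (hp z hz.1).2.2.1
    rcases le_total n (p y) with hn | hn
    · have := (hp y hy.1).2.2.2 z hz.1 (by omega) (by omega)
      subst this
      omega
    · have := (hp y hy.1).2.2.2 x hx.1 (by omega) (by omega)
      subst this
      omega
  have h1 := hinj a ha.1 b hb.1 hab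
  have h2 := hinj a ha.1 c hc.1 hac
  have h3 := hinj b hb.1 c hc.1 hbc
  rcases h1.lt_or_gt with h1 | h1 <;> rcases h2.lt_or_gt with h2 | h2 <;>
    rcases h3.lt_or_gt with h3 | h3
  · exact hmid a b c ha hb hc h1 h3
  · exact hmid a c b ha hc hb h2 h3
  · omega
  · exact hmid c a b hc ha hb h2 h1
  · exact hmid b a c hb ha hc h1 h2
  · omega
  · exact hmid b c a hb hc ha h3 h2
  · exact hmid c b a hc hb ha h3 h1

namespace History

variable {M : Type} {O : Type*} {e : List (Action M ℕ O)} {h : History M O}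

/-- A linearization puts an operation `o` at some point in time `n` between its call and its return:
what is placed before `o` is called before `n`, and what is placed after `o` returns after `n`. -/
theorem Of.exists_cut (H : h.Of e) {A B : List O} {o : O} (hA : ∀ q ∈ A, q ∈ h.ops)
    (ho : o ∈ h.ops) (hB : ∀ q ∈ B, q ∈ h.ops) (hR : h.Respects (A ++ o :: B)) :
    ∃ n, h.inv o < n ∧ n ≤ h.res o ∧ (∀ q ∈ A, h.inv q < n) ∧ ∀ q ∈ B, n ≤ h.res q := by
  classical
  obtain ⟨p, hp, hmax⟩ := Finset.exists_max_image (insert o A.toFinset) h.inv ⟨o, by simp⟩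
  simp only [Finset.mem_insert, List.mem_toFinset, forall_eq_or_imp] at hp hmax
  rw [respects_append, respects_cons] at hR
  have hpops : p ∈ h.ops := by
    rcases hp with rfl | hp
    · exact ho
    · exact hA p hp
  refine ⟨h.inv p + 1, by omega, ?_, fun q hq => by have := hmax.2 q hq; omega, ?_⟩
  · have h1 := H.inv_ne_res hpops ho
    rcases hp with rfl | hp
    · have := H.inv_lt_res p ho
      omega
    · have := hR.2.2 p hp o (by simp)
      omega
  · intro q hq
    have h1 := H.inv_ne_res hpops (hB q hq)
    rcases hp with rfl | hp
    · have := hR.2.1.1 q hq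
      omega
    · have := hR.2.2 p hp q (by simp [hq])
      omega

theorem respects_of_cut {A B : List O} {o : O} {n : ℕ} (hRA : h.Respects A) (hRB : h.Respects B)
    (h1 : h.inv o < n) (h2 : n ≤ h.res o) (hA : ∀ q ∈ A, h.inv q < n)
    (hB : ∀ q ∈ B, n ≤ h.res q) : h.Respects (A ++ o :: B) := by
  rw [respects_append, respects_cons]
  refine ⟨hRA, ⟨fun b hb => ?_, hRB⟩, fun a ha b hb => ?_⟩
  · have := hB b hb
    omega
  · have h3 := hA a ha
    rw [List.mem_cons] at hb
    rcases hb with rfl | hb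
    · omega
    · have := hB b hb
      omega

/-- At time `n`, some value of `D` has certainly been inserted and has not started to be removed. -/
def Covered (h : History M O) (mi mr : M) (D : Set ℕ) (n : ℕ) : Prop :=
  ∃ p ∈ h.ops, h.val p ∈ D ∧ h.meth p = mi ∧ h.res p < n ∧
    ∀ q ∈ h.ops, h.meth q = mr → h.val q = h.val p → n ≤ h.inv q

/-- A value is removed at most once. -/
def RemovalUnique (h : History M O) (mr : M) : Prop :=
  ∀ q ∈ h.ops, ∀ q' ∈ h.ops, h.meth q = mr → h.meth q' = mr → h.val q = h.val q' → q = q'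

/-- `t p` is the time when the removal of the value of `p` is called, and `N` if it is not
removed. -/
def IsRemovalTime (h : History M O) (mr : M) (N : ℕ) (t : O → ℕ) : Prop :=
  ∀ p, (∀ q ∈ h.ops, h.meth q = mr → h.val q = h.val p → t p = h.inv q) ∧
    ((¬ ∃ q ∈ h.ops, h.meth q = mr ∧ h.val q = h.val p) → t p = N)

theorem RemovalUnique.exists_isRemovalTime {mr : M} (hr : h.RemovalUnique mr) (N : ℕ) :
    ∃ t, h.IsRemovalTime mr N t := by
  have : ∀ p, ∃ k, (∀ q ∈ h.ops, h.meth q = mr → h.val q = h.val p → k = h.inv q) ∧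
      ((¬ ∃ q ∈ h.ops, h.meth q = mr ∧ h.val q = h.val p) → k = N) := by
    intro p
    by_cases hq : ∃ q ∈ h.ops, h.meth q = mr ∧ h.val q = h.val p
    · obtain ⟨q, hq, hm, hv⟩ := hq
      refine ⟨h.inv q, fun q' hq' hm' hv' => ?_, fun hcon => absurd ⟨q, hq, hm, hv⟩ hcon⟩
      rw [hr q hq q' hq' hm hm' (hv.trans hv'.symm)]
    · exact ⟨N, fun q hq' hm hv => absurd ⟨q, hq', hm, hv⟩ hq, fun _ => rfl⟩
  choose t ht using this
  exact ⟨t, ht⟩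

theorem IsRemovalTime.covered_iff {mi mr : M} {N : ℕ} {t : O → ℕ} (ht : h.IsRemovalTime mr N t)
    {D : Set ℕ} {n : ℕ} (hn : n ≤ N) : h.Covered mi mr D n ↔
      ∃ p ∈ h.ops, (h.val p ∈ D ∧ h.meth p = mi) ∧ h.res p < n ∧ n ≤ t p := by
  refine exists_congr fun p => and_congr Iff.rfl ?_
  rw [and_assoc]
  refine and_congr Iff.rfl (and_congr Iff.rfl (and_congr Iff.rfl ?_))
  constructor
  · intro hq
    by_cases hex : ∃ q ∈ h.ops, h.meth q = mr ∧ h.val q = h.val p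
    · obtain ⟨q, hq', hm, hv⟩ := hex
      rw [(ht p).1 q hq' hm hv]
      exact hq q hq' hm hv
    · rwa [(ht p).2 hex]
  · intro hnt q hq hm hv
    rwa [← (ht p).1 q hq hm hv]

end History

/-! ### Counting insertions and removals in coloured words -/

section Balance

variable {M : Type} {O : Type*} {e : List (Action M ℕ O)} {h : History M O}

open Classical in
/-- The number of returned insertions minus the number of called removals, for the values whose
colour is in `C`. -/
noncomputable def bal (mi mr : M) (C : Fin 4 → Prop) (w : List (Action M (Fin 4) Unit)) : ℤ :=
  (w.countP fun a => decide (retOf (fun m k => m = mi ∧ C k) a)) -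
    (w.countP fun a => decide (callOf (fun m k => m = mr ∧ C k) a))

/-- The balance stays in `{0, 1, 2}`. -/
def Bounded (mi mr : M) (C : Fin 4 → Prop) (w : List (Action M (Fin 4) Unit)) : Prop :=
  ∀ n, 0 ≤ bal mi mr C (w.take n) ∧ bal mi mr C (w.take n) ≤ 2

/-- The balance is positive between each call of an operation satisfying `q` and each later return
of an operation satisfying `r`. -/
def CoverWord (mi mr : M) (C : Fin 4 → Prop) (q r : M → Fin 4 → Prop)
    (w : List (Action M (Fin 4) Unit)) : Prop :=
  ¬ ∃ n a, w[n]? = some a ∧ retOf r a ∧ ∃ k, Has q ((w.take n).take k) ∧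
    Bounded mi mr C ((w.take n).take k) ∧ bal mi mr C ((w.take n).take k) = 0

theorem recognizable_bounded_and (mi mr : M) (C : Fin 4 → Prop) (F : ℤ → Prop) :
    Recognizable (fun w => Bounded mi mr C w ∧ F (bal mi mr C w)) :=
  Recognizable.counter _ _ F

theorem recognizable_bounded (mi mr : M) (C : Fin 4 → Prop) : Recognizable (Bounded mi mr C) :=
  (recognizable_bounded_and mi mr C fun _ => True).congr fun w => by simp

theorem recognizable_coverWord (mi mr : M) (C : Fin 4 → Prop) (q r : M → Fin 4 → Prop) :
    Recognizable (CoverWord mi mr C q r) :=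
  (((recognizable_has q).and (recognizable_bounded_and mi mr C fun z => z = 0)).exPrefix.before
    (retOf r)).not

theorem coverWord_paint (H : h.Of e) {ρ : ℕ → Fin 4} {mi mr : M} {C : Fin 4 → Prop}
    {q r : M → Fin 4 → Prop} (hb : Bounded mi mr C (paint ρ e)) :
    CoverWord mi mr C q r (paint ρ e) ↔ ∀ o ∈ h.ops, r (h.meth o) (ρ (h.val o)) →
      ∀ o' ∈ h.ops, q (h.meth o') (ρ (h.val o')) → ∀ n, h.inv o' < n → n ≤ h.res o →
        1 ≤ bal mi mr C ((paint ρ e).take n) := by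
  rw [CoverWord, before_retOf H ρ r fun w => ∃ k, Has q (w.take k) ∧
    Bounded mi mr C (w.take k) ∧ bal mi mr C (w.take k) = 0]
  simp only [List.take_take, Has, has_callOf_take H]
  constructor
  · intro hcov o ho hr o' ho' hq n hn hn'
    by_contra hlt
    have h0 := (hb n).1
    refine hcov ⟨o, ho, hr, n, ?_⟩
    rw [min_eq_left hn']
    refine ⟨⟨o', ho', hq, hn⟩, fun k => ?_, by omega⟩
    rw [List.take_take]
    exact hb _
  · rintro hcov ⟨o, ho, hr, k, ⟨o', ho', hq, hlt⟩, -, h0⟩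
    have := hcov o ho hr o' ho' hq _ hlt (min_le_right _ _)
    omega

open Classical in
theorem bal_paint_take (H : h.Of e) (ρ : ℕ → Fin 4) (mi mr : M) (C : Fin 4 → Prop) (n : ℕ) :
    bal mi mr C ((paint ρ e).take n) =
      (((h.ops.filter fun o => h.meth o = mi ∧ C (ρ (h.val o))).filter
        fun o => h.res o < n).card : ℤ) -
      ((h.ops.filter fun o => h.meth o = mr ∧ C (ρ (h.val o))).filter
        fun o => h.inv o < n).card := by
  rw [bal, countP_retOf_take H, countP_callOf_take H]
  congr!

/-- If the balance is positive, then some inserted value has not started to be removed: otherwise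
there would be as many removals as insertions. -/
theorem covered_of_bal_pos (H : h.Of e) {ρ : ℕ → Fin 4} {mi mr : M} (hu : h.InputUnique mi)
    {C : Fin 4 → Prop} {n : ℕ} (hn : 1 ≤ bal mi mr C ((paint ρ e).take n)) :
    h.Covered mi mr {x | C (ρ x) ∧ ∃ p ∈ h.ops, h.meth p = mi ∧ h.val p = x} n := by
  classical
  by_contra hcon
  rw [bal_paint_take H] at hn
  have hex : ∀ p ∈ (h.ops.filter fun o => h.meth o = mi ∧ C (ρ (h.val o))).filter
      (fun o => h.res o < n), ∃ q ∈ (h.ops.filter fun o => h.meth o = mr ∧ C (ρ (h.val o))).filter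
      (fun o => h.inv o < n), h.val q = h.val p := by
    intro p hp
    simp only [Finset.mem_filter] at hp ⊢
    by_contra hno
    refine hcon ⟨p, hp.1.1, ⟨hp.1.2.2, p, hp.1.1, hp.1.2.1, rfl⟩, hp.1.2.1, hp.2, ?_⟩
    intro q hq hm hv
    by_contra hlt
    exact hno ⟨q, ⟨⟨hq, hm, by rw [hv]; exact hp.1.2.2⟩, not_le.1 hlt⟩, hv⟩
  choose! g hg using hex
  have hle := Finset.card_le_card_of_injOn g (fun p hp => (hg p hp).1) (by
    intro p hp p' hp' heq
    have h1 := (hg p hp).2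
    have h2 := (hg p' hp').2
    simp only [Finset.coe_filter, Finset.mem_filter, Set.mem_ofPred_eq] at hp hp'
    refine hu p hp.1.1 p' hp'.1.1 hp.1.2.1 hp'.1.2.1 ?_
    rw [← h1, ← h2, heq])
  omega

/-- If the insertions and removals of the values with colour in `C` balance out and each such value
is removed at most once and only if it is inserted, then each such inserted value is removed. -/
theorem exists_removal_of_bal_eq_zero (H : h.Of e) {ρ : ℕ → Fin 4} {mi mr : M}
    (hu : h.InputUnique mi) (hr : h.RemovalUnique mr) {C : Fin 4 → Prop}
    (hin : ∀ q ∈ h.ops, h.meth q = mr → C (ρ (h.val q)) →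
      ∃ p ∈ h.ops, h.meth p = mi ∧ h.val p = h.val q)
    (hz : bal mi mr C (paint ρ e) = 0) {p : O} (hp : p ∈ h.ops) (hpm : h.meth p = mi)
    (hpC : C (ρ (h.val p))) : ∃ q ∈ h.ops, h.meth q = mr ∧ h.val q = h.val p := by
  classical
  have h1 := bal_paint_take H ρ mi mr C e.length
  rw [List.take_of_length_le (by simp [paint]), hz] at h1
  set A := h.ops.filter fun o => h.meth o = mi ∧ C (ρ (h.val o)) with hA
  set B := h.ops.filter fun o => h.meth o = mr ∧ C (ρ (h.val o)) with hB
  have hA' : (A.filter fun o => h.res o < e.length) = A :=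
    Finset.filter_true_of_mem fun o ho => H.res_lt_length (Finset.mem_filter.1 ho).1
  have hB' : (B.filter fun o => h.inv o < e.length) = B :=
    Finset.filter_true_of_mem fun o ho =>
      (H.inv_lt_res o (Finset.mem_filter.1 ho).1).trans (H.res_lt_length (Finset.mem_filter.1 ho).1)
  rw [hA', hB'] at h1
  have hAi : Set.InjOn h.val A := by
    intro o ho o' ho' heq
    simp only [hA, Finset.coe_filter, Set.mem_ofPred_eq] at ho ho'
    exact hu o ho.1 o' ho'.1 ho.2.1 ho'.2.1 heq
  have hBi : Set.InjOn h.val B := by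
    intro o ho o' ho' heq
    simp only [hB, Finset.coe_filter, Set.mem_ofPred_eq] at ho ho'
    exact hr o ho.1 o' ho'.1 ho.2.1 ho'.2.1 heq
  have hsub : B.image h.val ⊆ A.image h.val := by
    intro x hx
    obtain ⟨q, hq, rfl⟩ := Finset.mem_image.1 hx
    simp only [hB, Finset.mem_filter] at hq
    obtain ⟨p', hp', hm', hv'⟩ := hin q hq.1 hq.2.1 hq.2.2
    exact Finset.mem_image.2 ⟨p', by simp [hA, hp', hm', hv', hq.2.2], hv'⟩
  have heq := Finset.eq_of_subset_of_card_le hsub (by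
    rw [Finset.card_image_of_injOn hAi, Finset.card_image_of_injOn hBi]
    omega)
  have hpA : h.val p ∈ A.image h.val :=
    Finset.mem_image_of_mem _ (by simp [hA, hp, hpm, hpC])
  rw [← heq] at hpA
  obtain ⟨q, hq, hqv⟩ := Finset.mem_image.1 hpA
  simp only [hB, Finset.mem_filter] at hq
  exact ⟨q, hq.1, hq.2.1, hqv⟩

/-- If exactly the values inserted by `Z` have a colour in `C`, then the balance counts the members
of `Z` that cover a point in time. -/
theorem bal_eq_card (H : h.Of e) {ρ : ℕ → Fin 4} {mi mr : M} (hu : h.InputUnique mi)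
    (hr : h.RemovalUnique mr) {t : O → ℕ} (ht : h.IsRemovalTime mr e.length t) {Z : Finset O}
    (hZ : ∀ z ∈ Z, z ∈ h.ops ∧ h.meth z = mi ∧ h.res z < t z) {C : Fin 4 → Prop}
    (hC : ∀ x, C (ρ x) ↔ ∃ z ∈ Z, h.val z = x) {n : ℕ} (hn : n ≤ e.length) :
    bal mi mr C ((paint ρ e).take n) = (Z.filter fun z => h.res z < n ∧ n ≤ t z).card := by
  classical
  rw [bal_paint_take H]
  have h1 : (h.ops.filter fun o => h.meth o = mi ∧ C (ρ (h.val o))) = Z := by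
    ext o
    rw [Finset.mem_filter, hC]
    constructor
    · rintro ⟨ho, hm, z, hz, hv⟩
      rwa [hu o ho z (hZ z hz).1 hm (hZ z hz).2.1 hv.symm]
    · intro ho
      exact ⟨(hZ o ho).1, (hZ o ho).2.1, o, ho, rfl⟩
  have h2 : ((h.ops.filter fun o => h.meth o = mr ∧ C (ρ (h.val o))).filter
      fun o => h.inv o < n).card = (Z.filter fun z => t z < n).card := by
    rw [← Finset.card_image_of_injOn (f := h.val)
      (s := (h.ops.filter fun o => h.meth o = mr ∧ C (ρ (h.val o))).filter fun o => h.inv o < n),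
      ← Finset.card_image_of_injOn (f := h.val) (s := Z.filter fun z => t z < n)]
    · congr 1
      ext x
      simp only [Finset.mem_image, Finset.mem_filter, hC]
      constructor
      · rintro ⟨q, ⟨⟨hq, hm, z, hz, hv⟩, hlt⟩, rfl⟩
        exact ⟨z, ⟨hz, by rwa [(ht z).1 q hq hm hv.symm]⟩, hv⟩
      · rintro ⟨z, ⟨hz, hlt⟩, rfl⟩
        by_cases hq : ∃ q ∈ h.ops, h.meth q = mr ∧ h.val q = h.val z
        · obtain ⟨q, hq, hm, hv⟩ := hq
          exact ⟨q, ⟨⟨hq, hm, z, hz, hv.symm⟩, by rwa [← (ht z).1 q hq hm hv]⟩, hv⟩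
        · rw [(ht z).2 hq] at hlt
          omega
    · intro z hz z' hz' heq
      simp only [Finset.coe_filter, Set.mem_ofPred_eq] at hz hz'
      exact hu z (hZ z hz.1).1 z' (hZ z' hz'.1).1 (hZ z hz.1).2.1 (hZ z' hz'.1).2.1 heq
    · intro q hq q' hq' heq
      simp only [Finset.coe_filter, Finset.mem_filter, Set.mem_ofPred_eq] at hq hq'
      exact hr q hq.1.1 q' hq'.1.1 hq.1.2.1 hq'.1.2.1 heq
  rw [h1, h2]
  have h3 : (Z.filter fun z => h.res z < n) =
      (Z.filter fun z => h.res z < n ∧ n ≤ t z) ∪ Z.filter fun z => t z < n := by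
    ext z
    simp only [Finset.mem_filter, Finset.mem_union]
    constructor
    · rintro ⟨hz, hlt⟩
      rcases le_or_gt n (t z) with hle | hle
      · exact Or.inl ⟨hz, hlt, hle⟩
      · exact Or.inr ⟨hz, hle⟩
    · rintro (⟨hz, hlt, -⟩ | ⟨hz, hlt⟩)
      · exact ⟨hz, hlt⟩
      · exact ⟨hz, (hZ z hz).2.2.trans hlt⟩
  have h4 : Disjoint (Z.filter fun z => h.res z < n ∧ n ≤ t z) (Z.filter fun z => t z < n) := by
    rw [Finset.disjoint_filter]
    intro z _ h5 h6
    omega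
  rw [h3, Finset.card_union_of_disjoint h4]
  push_cast
  ring

theorem bounded_of_card_le (H : h.Of e) {ρ : ℕ → Fin 4} {mi mr : M} (hu : h.InputUnique mi)
    (hr : h.RemovalUnique mr) {t : O → ℕ} (ht : h.IsRemovalTime mr e.length t) {Z : Finset O}
    (hZ : ∀ z ∈ Z, z ∈ h.ops ∧ h.meth z = mi ∧ h.res z < t z) {C : Fin 4 → Prop}
    (hC : ∀ x, C (ρ x) ↔ ∃ z ∈ Z, h.val z = x)
    (hcard : ∀ n, (Z.filter fun z => h.res z < n ∧ n ≤ t z).card ≤ 2) :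
    Bounded mi mr C (paint ρ e) := by
  intro n
  have : (paint ρ e).take n = (paint ρ e).take (min n e.length) := by
    rw [← List.take_take, List.take_of_length_le (l := paint ρ e) (i := e.length) (by simp [paint])]
  rw [this, bal_eq_card H hu hr ht hZ hC (min_le_right _ _)]
  have := hcard (min n e.length)
  omega

end Balance

/-! ### Rules that hinge on a cover of one operation -/

section Mid

variable {M : Type} {O : Type*} {e : List (Action M ℕ O)} {h : History M O}

theorem History.Covered.mono {mi mr : M} {D D' : Set ℕ} (hD : D ⊆ D') {n : ℕ}
    (hc : h.Covered mi mr D n) : h.Covered mi mr D' n := by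
  obtain ⟨p, hp, hpD, hrest⟩ := hc
  exact ⟨p, hp, hD hpD, hrest⟩

/-- A rule `u · m · v` with `u` matched: its operation `m` is placed at a point in time that is not
covered, `u` consisting of what has to be placed before and of the removals of the values inserted
there. -/
theorem linearizable_mid_iff (H : h.Of e) {D : Set ℕ} {g : List (Atom M)} {mi mr m₁ : M}
    (hne : mi ≠ mr) (allowed : Set M) (hallowed : ∀ o ∈ h.ops, h.val o ∈ D → h.meth o ∈ allowed)
    (hg : ∀ us, (∀ a ∈ g, a.Holds us) → Matched mi (us 0))
    (hg' : ∀ us, Matched mi (us 0) → (∀ p ∈ us 0, p.1 ∈ allowed) → (∀ p ∈ us 1, p.1 ∈ allowed) →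
      ∀ a ∈ g, a.Holds us)
    (hother : ∀ p ∈ h.ops, ∀ p' ∈ h.ops, h.meth p = mi → p' ≠ p → h.val p' = h.val p →
      h.meth p' = mr) :
    Linearizable (proj D e) (Rule.mk 2 g [.var 0, .meth m₁, .var 1]).matchingSet ↔
      ∃ o ∈ h.ops, h.val o ∈ D ∧ h.meth o = m₁ ∧ (∀ o' ∈ h.ops, h.val o' = h.val o → o' = o) ∧
        ∃ n, h.inv o < n ∧ n ≤ h.res o ∧ ¬ h.Covered mi mr D n := by
  classical
  rw [H.linearizable_proj_iff]
  constructor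
  · rintro ⟨L, hL, hR, hmatch⟩
    obtain ⟨us, x, hgu, hw, h0, h1⟩ := mem_matchingSet_mid.1 hmatch
    rw [List.map_eq_append_iff] at hw
    obtain ⟨A, L', rfl, hA, hw⟩ := hw
    rw [List.map_eq_cons_iff] at hw
    obtain ⟨o, B, rfl, hlab, hB⟩ := hw
    obtain ⟨hm, rfl⟩ := History.lab_eq_iff.1 hlab
    have hmat := hg us hgu
    rw [← hA] at h0 hmat
    rw [← hB] at h1
    rw [History.forall_mem_map_lab] at h0 h1
    rw [History.matched_map (List.nodup_append.1 hL.1).1] at hmat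
    have hmemA : ∀ q ∈ A, q ∈ h.ops ∧ h.val q ∈ D := fun q hq => (hL.2 q).1 (by simp [hq])
    have hmemB : ∀ q ∈ B, q ∈ h.ops ∧ h.val q ∈ D := fun q hq => (hL.2 q).1 (by simp [hq])
    have ho := (hL.2 o).1 (by simp)
    obtain ⟨n, hn1, hn2, hnA, hnB⟩ := H.exists_cut (fun q hq => (hmemA q hq).1) ho.1
      (fun q hq => (hmemB q hq).1) hR
    refine ⟨o, ho.1, ho.2, hm, ?_, n, hn1, hn2, ?_⟩
    · intro o' ho' hv
      have := (hL.2 o').2 ⟨ho', by rw [hv]; exact ho.2⟩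
      rw [List.mem_append, List.mem_cons] at this
      rcases this with h' | h' | h'
      · exact absurd hv (h0 o' h')
      · exact h'
      · exact absurd hv (h1 o' h')
    · rintro ⟨p, hp, hpD, hpm, hpn, hq⟩
      have := (hL.2 p).2 ⟨hp, hpD⟩
      rw [List.mem_append, List.mem_cons] at this
      rcases this with hpA | rfl | hpB
      · obtain ⟨p', hp', hne', hv⟩ := hmat p hpA hpm
        have h3 := hq p' (hmemA p' hp').1
          (hother p hp p' (hmemA p' hp').1 hpm hne' hv) hv
        have h4 := hnA p' hp'
        omega
      · omega
      · have := hnB p hpB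
        omega
  · rintro ⟨o, ho, hoD, hom, hsole, n, hn1, hn2, hcov⟩
    obtain ⟨A, hA1, hA2, hA3⟩ := H.exists_respects
      (h.ops.filter fun q => h.val q ∈ D ∧ q ≠ o ∧
        (h.res q < n ∨ (h.meth q ≠ mi ∧ h.inv q < n))) (Finset.filter_subset _ _)
    obtain ⟨B, hB1, hB2, hB3⟩ := H.exists_respects
      (h.ops.filter fun q => h.val q ∈ D ∧ q ≠ o ∧
        ¬ (h.res q < n ∨ (h.meth q ≠ mi ∧ h.inv q < n))) (Finset.filter_subset _ _)
    simp only [Finset.mem_filter] at hA2 hB2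
    refine ⟨A ++ o :: B, ⟨?_, ?_⟩, ?_, ?_⟩
    · rw [List.nodup_append, List.nodup_cons]
      refine ⟨hA1, ⟨?_, hB1⟩, ?_⟩
      · rw [hB2]
        exact fun hcon => hcon.2.2.1 rfl
      · rintro a ha b hb rfl
        rw [hA2] at ha
        rw [List.mem_cons, hB2] at hb
        rcases hb with rfl | hb
        · exact ha.2.2.1 rfl
        · exact hb.2.2.2 ha.2.2.2
    · intro q
      rw [List.mem_append, List.mem_cons, hA2, hB2]
      constructor
      · rintro (h' | rfl | h')
        · exact ⟨h'.1, h'.2.1⟩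
        · exact ⟨ho, hoD⟩
        · exact ⟨h'.1, h'.2.1⟩
      · rintro ⟨hq, hqD⟩
        by_cases hqo : q = o
        · exact Or.inr (Or.inl hqo)
        · by_cases hlt : h.res q < n ∨ (h.meth q ≠ mi ∧ h.inv q < n)
          · exact Or.inl ⟨hq, hqD, hqo, hlt⟩
          · exact Or.inr (Or.inr ⟨hq, hqD, hqo, hlt⟩)
    · refine History.respects_of_cut hA3 hB3 hn1 hn2 ?_ ?_
      · intro q hq
        have hq' := (hA2 q).1 hq
        have := H.inv_lt_res q hq'.1
        rcases hq'.2.2.2 with h' | h'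
        · omega
        · exact h'.2
      · intro q hq
        have hq' := (hB2 q).1 hq
        by_contra hlt
        exact hq'.2.2.2 (Or.inl (not_le.1 hlt))
    · refine mem_matchingSet_mid.2 ⟨fun i => if i = 0 then A.map h.lab else B.map h.lab,
        h.val o, ?_, ?_, ?_, ?_⟩
      · refine hg' _ ?_ ?_ ?_
        · simp only [if_true]
          rw [History.matched_map hA1]
          intro p hpA hpm
          have hp := (hA2 p).1 hpA
          have hpn : h.res p < n := hp.2.2.2.resolve_right fun h' => h'.1 hpm
          by_contra hcon
          refine hcov ⟨p, hp.1, hp.2.1, hpm, hpn, fun q hq hqm hqv => ?_⟩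
          by_contra hlt
          have hqp : q ≠ p := by
            rintro rfl
            exact hne (hpm.symm.trans hqm)
          refine hcon ⟨q, (hA2 q).2 ⟨hq, by rw [hqv]; exact hp.2.1, ?_,
            Or.inr ⟨by rw [hqm]; exact hne.symm, not_le.1 hlt⟩⟩, hqp, hqv⟩
          rintro rfl
          exact hp.2.2.1 (hsole p hp.1 hqv.symm)
        · exact History.forall_mem_map_lab.2 fun q hq =>
            hallowed q ((hA2 q).1 hq).1 ((hA2 q).1 hq).2.1
        · exact History.forall_mem_map_lab.2 fun q hq =>
            hallowed q ((hB2 q).1 hq).1 ((hB2 q).1 hq).2.1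
      · simp [History.lab, hom]
      · exact History.forall_mem_map_lab.2 fun q hq heq =>
          ((hA2 q).1 hq).2.2.1 (hsole q ((hA2 q).1 hq).1 heq)
      · exact History.forall_mem_map_lab.2 fun q hq heq =>
          ((hB2 q).1 hq).2.2.1 (hsole q ((hB2 q).1 hq).1 heq)

/-- If the points of `(lo, hi]` are covered, then a set `Z` of insertions covers them of which at
most two are active at any time. -/
theorem exists_cover {mi mr : M} {D : Set ℕ} {t : O → ℕ}
    (ht : h.IsRemovalTime mr e.length t) {lo hi : ℕ} (hhi : hi ≤ e.length)
    (hcov : ∀ n, lo < n → n ≤ hi → h.Covered mi mr D n) :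
    ∃ Z : Finset O, (∀ z ∈ Z, z ∈ h.ops ∧ h.meth z = mi ∧ h.res z < t z) ∧
      (∀ z ∈ Z, h.val z ∈ D ∧ ∃ n, lo < n ∧ n ≤ hi ∧ h.res z < n ∧ n ≤ t z) ∧
      (∀ n, lo < n → n ≤ hi → ∃ z ∈ Z, h.res z < n ∧ n ≤ t z) ∧
      ∀ n, (Z.filter fun z => h.res z < n ∧ n ≤ t z).card ≤ 2 := by
  classical
  obtain ⟨Z, hZY, hZcov, hZmeet, hcard⟩ := exists_minimal_cover
    (h.ops.filter fun p => h.val p ∈ D ∧ h.meth p = mi) h.res t lo hi (by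
      intro n hn hn'
      obtain ⟨p, hp, hpD, hpn⟩ := (ht.covered_iff (hn'.trans hhi)).1 (hcov n hn hn')
      exact ⟨p, by simpa using ⟨hp, hpD⟩, hpn⟩)
  refine ⟨Z, fun z hz => ?_, fun z hz => ⟨?_, hZmeet z hz⟩, hZcov, hcard⟩
  · have := hZY hz
    simp only [Finset.mem_filter] at this
    obtain ⟨n, _, _, h1, h2⟩ := hZmeet z hz
    exact ⟨this.1, this.2.2, by omega⟩
  · have := hZY hz
    simp only [Finset.mem_filter] at this
    exact this.2.1

/-- The coloured words in which values of colour `2` cover an operation `m₁` of colour `1`. -/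
def MidWord (mi mr m₁ : M) (w : List (Action M (Fin 4) Unit)) : Prop :=
  Bounded mi mr (fun k => k = 2) w ∧ Has (fun m k => m = m₁ ∧ k = 1) w ∧
    CoverWord mi mr (fun k => k = 2) (fun m k => m = m₁ ∧ k = 1) (fun m k => m = m₁ ∧ k = 1) w

theorem recognizable_midWord (mi mr m₁ : M) : Recognizable (MidWord mi mr m₁) :=
  (recognizable_bounded _ _ _).and ((recognizable_has _).and (recognizable_coverWord _ _ _ _ _))

theorem exists_midWord (H : h.Of e) {mi mr m₁ : M} (hu : h.InputUnique mi)
    (hr : h.RemovalUnique mr) {o : O} (ho : o ∈ h.ops) (hom : h.meth o = m₁)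
    (hsole : ∀ o' ∈ h.ops, h.val o' = h.val o → o' = o) {D : Set ℕ}
    (hcov : ∀ n, h.inv o < n → n ≤ h.res o → h.Covered mi mr D n) :
    ∃ ρ, MidWord mi mr m₁ (paint ρ e) ∧ (∀ x, ρ x = 1 ↔ x = h.val o) ∧
      ((∀ p ∈ h.ops, h.val p ∈ D → p ≠ o → h.meth p = mi →
        ∃ q ∈ h.ops, h.meth q = mr ∧ h.val q = h.val p) →
        bal mi mr (fun k => k = 2) (paint ρ e) = 0) := by
  classical
  obtain ⟨t, ht⟩ := hr.exists_isRemovalTime e.length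
  obtain ⟨Z, hZ, hZD, hZcov, hcard⟩ := exists_cover ht (H.res_lt_length ho).le hcov
  have hZo : ∀ z ∈ Z, z ≠ o := by
    rintro z hz rfl
    obtain ⟨-, n, h1, h2, h3, h4⟩ := hZD z hz
    omega
  let ρ : ℕ → Fin 4 := fun x => if x = h.val o then 1 else if ∃ z ∈ Z, h.val z = x then 2 else 0
  have hρ1 : ∀ x, ρ x = 1 ↔ x = h.val o := by
    intro x
    simp only [ρ]
    split_ifs with h1 h2 <;> simp [h1]
  have hρ2 : ∀ x, ρ x = 2 ↔ ∃ z ∈ Z, h.val z = x := by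
    intro x
    simp only [ρ]
    split_ifs with h1 h2
    · simp only [Fin.reduceEq, false_iff]
      rintro ⟨z, hz, hv⟩
      exact hZo z hz (hsole z (hZ z hz).1 (hv.trans h1))
    · simp [h2]
    · simp [h2]
  have hb : Bounded mi mr (fun k => k = 2) (paint ρ e) :=
    bounded_of_card_le H hu hr ht hZ hρ2 hcard
  refine ⟨ρ, ⟨hb, ?_, ?_⟩, hρ1, ?_⟩
  · rw [has_paint H]
    exact ⟨o, ho, hom, (hρ1 _).2 rfl⟩
  · rw [coverWord_paint H hb]
    rintro o₁ ho₁ ⟨-, hk₁⟩ o₂ ho₂ ⟨-, hk₂⟩ n hn hn'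
    obtain rfl := hsole o₁ ho₁ ((hρ1 _).1 hk₁)
    obtain rfl := hsole o₂ ho₂ ((hρ1 _).1 hk₂)
    rw [bal_eq_card H hu hr ht hZ (C := fun k => k = 2) hρ2 (hn'.trans (H.res_lt_length ho).le)]
    obtain ⟨z, hz, hz1, hz2⟩ := hZcov n hn hn'
    have : 0 < (Z.filter fun z => h.res z < n ∧ n ≤ t z).card :=
      Finset.card_pos.2 ⟨z, by simp [hz, hz1, hz2]⟩
    omega
  · intro hrem
    have h1 := bal_eq_card H hu hr ht hZ (C := fun k => k = 2) hρ2 (n := e.length) le_rfl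
    rw [List.take_of_length_le (by simp [paint])] at h1
    rw [h1, Nat.cast_eq_zero, Finset.card_eq_zero, Finset.filter_eq_empty_iff]
    rintro z hz ⟨-, hle⟩
    obtain ⟨q, hq, hqm, hqv⟩ := hrem z (hZ z hz).1 (hZD z hz).1 (hZo z hz) (hZ z hz).2.1
    rw [(ht z).1 q hq hqm hqv] at hle
    have h2 := H.inv_lt_res q hq
    have h3 := H.res_lt_length hq
    omega

theorem exists_covered_of_midWord (H : h.Of e) {mi mr m₁ : M} (hu : h.InputUnique mi)
    {ρ : ℕ → Fin 4} (hw : MidWord mi mr m₁ (paint ρ e)) :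
    ∃ o ∈ h.ops, h.meth o = m₁ ∧ ρ (h.val o) = 1 ∧ ∀ n, h.inv o < n → n ≤ h.res o →
      h.Covered mi mr {x | ρ x = 2 ∧ ∃ p ∈ h.ops, h.meth p = mi ∧ h.val p = x} n := by
  obtain ⟨hb, hh, hc⟩ := hw
  rw [has_paint H] at hh
  obtain ⟨o, ho, hm, hk⟩ := hh
  rw [coverWord_paint H hb] at hc
  exact ⟨o, ho, hm, hk, fun n hn hn' =>
    covered_of_bal_pos H hu (C := fun k => k = 2) (hc o ho ⟨hm, hk⟩ o ho ⟨hm, hk⟩ n hn hn')⟩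

theorem removalUnique_of_atMostOnce {ι : Type} {S : DataStructure M ι} {m : M}
    {I : Set (List (Action M ℕ O))} (hI : S.AtMostOnce m I) (he : e ∈ I) (H : h.Of e)
    (hd : S.Differentiated (events e)) : h.RemovalUnique m := by
  have := (H.atMostOnce_iff m).1 (hI e he hd)
  intro q hq q' hq' hm hm' hv
  exact this q hq q' hq' hm (by simp [History.lab, hm, hm', hv])

/-- The rules `DeqEmpty` and `PopEmpty`: an observation `m₁` of emptiness is wrong if and only if it
is covered by inserted values. -/
theorem coRegularOn_empty [Inhabited M] {ι : Type} {S : DataStructure M ι} {R : ι} {mi mr m₁ : M}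
    (hrule : S.rule R = ⟨2, [.matched mi 0], [.var 0, .meth m₁, .var 1]⟩)
    (hlast : ∀ u, S.last u = R ↔ Contains m₁ u) (hin : mi ∈ S.input) (hun : m₁ ∈ S.unused)
    (hm : ∀ m, m = mi ∨ m = mr ∨ m = m₁) (hir : mi ≠ mr) (h1i : m₁ ≠ mi) :
    S.CoRegularOn (S.AtMostOnce mr : Set (List (Action M ℕ O)) → Prop) R := by
  have hsetup : ∀ (e : List (Action M ℕ O)) (h : History M O), h.Of e →
      S.Differentiated (events e) →
      (∀ o ∈ h.ops, h.meth o = m₁ → ∀ o' ∈ h.ops, h.val o' = h.val o → o' = o) ∧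
      (S.Violates R e ↔ ∃ D, (∃ o ∈ h.ops, h.val o ∈ D ∧ h.meth o = m₁) ∧
        ∀ o ∈ h.ops, h.val o ∈ D → h.meth o = m₁ → ∀ n, h.inv o < n → n ≤ h.res o →
          h.Covered mi mr D n) := by
    intro e h H hd
    have hd' := (H.differentiated_iff S).1 hd
    have hu := inputUnique_of_differentiated H hd hin
    have hsole : ∀ o ∈ h.ops, h.meth o = m₁ → ∀ o' ∈ h.ops, h.val o' = h.val o → o' = o :=
      fun o ho hom o' ho' hv => (hd'.2 o ho o' ho' (by rwa [hom]) hv.symm).symm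
    refine ⟨hsole, exists_congr fun D => and_congr ?_ ?_⟩
    · rw [hlast, H.contains_iff]
    · rw [hrule, linearizable_mid_iff H hir Set.univ (fun _ _ _ => trivial) (mi := mi) (mr := mr)]
      · push Not
        constructor
        · intro hh o ho hoD hom
          exact hh o ho hoD hom (hsole o ho hom)
        · intro hh o ho hoD hom _
          exact hh o ho hoD hom
      · intro us hus
        exact hus _ (List.mem_singleton_self _)
      · intro us hus _ _ a ha
        rw [List.mem_singleton] at ha
        subst ha
        exact hus
      · intro p hp p' hp' hpm hne hv
        rcases hm (h.meth p') with h' | h' | h'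
        · exact absurd (hu p' hp' p hp h' hpm hv) hne
        · exact h'
        · exact absurd (hsole p' hp' h' p hp hv.symm).symm hne
  refine coRegularOn_of_recognizable (recognizable_midWord mi mr m₁) ?_ ?_
  · intro I hI _ hA e he hd hv
    obtain ⟨h, H⟩ := History.exists_of (hI e he)
    obtain ⟨hsole, hviol⟩ := hsetup e h H hd
    obtain ⟨D, ⟨o, ho, hoD, hom⟩, hcov⟩ := hviol.1 hv
    obtain ⟨ρ, hρ, -⟩ := exists_midWord H (inputUnique_of_differentiated H hd hin)
      (removalUnique_of_atMostOnce hA he H hd) ho hom (hsole o ho hom) (hcov o ho hoD hom)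
    exact ⟨ρ, hρ⟩
  · intro I hI _ _ e he hd ρ hρ
    obtain ⟨h, H⟩ := History.exists_of (hI e he)
    obtain ⟨hsole, hviol⟩ := hsetup e h H hd
    refine ⟨e, he, hd, hviol.2 ?_⟩
    obtain ⟨o, ho, hom, hk, hcov⟩ :=
      exists_covered_of_midWord H (inputUnique_of_differentiated H hd hin) hρ
    refine ⟨insert (h.val o) {x | ρ x = 2 ∧ ∃ p ∈ h.ops, h.meth p = mi ∧ h.val p = x},
      ⟨o, ho, by simp, hom⟩, ?_⟩
    rintro o' ho' hD hom' n hn hn'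
    have hoo : o' = o := by
      rcases hD with hv | ⟨-, p, hp, hpm, hpv⟩
      · exact hsole o ho hom o' ho' hv
      · have := hsole o' ho' hom' p hp hpv
        subst this
        exact absurd (hom'.symm.trans hpm) h1i
    subst hoo
    exact (hcov n hn hn').mono (Set.subset_insert _ _)

theorem queue_last_rDeqEmpty (u : List (Event QueueMethod)) :
    queue.last u = .rDeqEmpty ↔ Contains .deqEmpty u := by
  simp only [queue]
  split_ifs with h1 h2 h3 <;> simp [h1]

theorem stack_last_rPopEmpty (u : List (Event StackMethod)) :
    stack.last u = .rPopEmpty ↔ Contains .popEmpty u := by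
  simp only [stack]
  split_ifs with h1 h2 h3 <;> simp [h1]

theorem queue_rDeqEmpty : queue.CoRegularOn (O := O) (queue.AtMostOnce .deq) .rDeqEmpty :=
  coRegularOn_empty (mi := .enq) (m₁ := .deqEmpty) rfl queue_last_rDeqEmpty rfl rfl
    (fun m => by cases m <;> simp) (by simp) (by simp)

theorem stack_rPopEmpty : stack.CoRegularOn (O := O) (stack.AtMostOnce .pop) .rPopEmpty :=
  coRegularOn_empty (mi := .push) (m₁ := .popEmpty) rfl stack_last_rPopEmpty rfl rfl
    (fun m => by cases m <;> simp) (by simp) (by simp)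

end Mid

/-! ### The rule `Push` -/

section Push

variable {O : Type*} {e : List (Action StackMethod ℕ O)} {h : History StackMethod O}

theorem stack_last_rPush (u : List (Event StackMethod)) :
    stack.last u = .rPush ↔ ¬ Contains .popEmpty u ∧ ¬ Matched .push u := by
  simp only [stack]
  split_ifs with h1 h2 h3 <;> simp [*]

/-- The operations with the value of a `Push` are this `Push` and `Pop`s. -/
theorem stack_meth_of_val_eq (H : h.Of e) (hd : stack.Differentiated (events e)) {p p' : O}
    (hp : p ∈ h.ops) (hp' : p' ∈ h.ops) (hm : h.meth p = .push) (hne : p' ≠ p)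
    (hv : h.val p' = h.val p) : h.meth p' = .pop := by
  cases hm' : h.meth p'
  · exact absurd (inputUnique_of_differentiated H hd (m := .push) rfl p' hp' p hp hm' hm hv) hne
  · rfl
  · exact absurd (((H.differentiated_iff stack).1 hd).2 p' hp' p hp (by rw [hm']; rfl) hv) hne

theorem stack_violates_rPush_iff (H : h.Of e) (hd : stack.Differentiated (events e)) :
    stack.Violates .rPush e ↔ ∃ D, (¬ ∃ o ∈ h.ops, h.val o ∈ D ∧ h.meth o = .popEmpty) ∧
      (∃ o ∈ h.ops, h.val o ∈ D ∧ h.meth o = .push ∧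
        ∀ o' ∈ h.ops, h.val o' = h.val o → o' = o) ∧
      ∀ o ∈ h.ops, h.val o ∈ D → h.meth o = .push → (∀ o' ∈ h.ops, h.val o' = h.val o → o' = o) →
        ∀ n, h.inv o < n → n ≤ h.res o → h.Covered .push .pop D n := by
  refine exists_congr fun D => ?_
  rw [stack_last_rPush, H.contains_iff, H.matched_iff, and_assoc]
  refine and_congr_right fun hne => and_congr ?_ ?_
  · push Not
    refine exists_congr fun o => and_congr Iff.rfl (and_congr Iff.rfl (and_congr Iff.rfl
      (forall_congr' fun o' => forall_congr' fun _ => ?_)))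
    tauto
  · change ¬ Linearizable _ (Rule.mk 2 [.matched .push 0, .methods 0 {.push, .pop},
      .methods 1 {.push, .pop}] [.var 0, .meth .push, .var 1] : Rule StackMethod).matchingSet ↔ _
    rw [linearizable_mid_iff H (mi := .push) (mr := .pop) (by simp) {.push, .pop}]
    · push Not
      rfl
    · intro o ho hD
      cases hm : h.meth o
      · simp
      · simp
      · exact absurd ⟨o, ho, hD, hm⟩ hne
    · intro us hus
      exact hus (.matched .push 0) (by simp)
    · intro us h1 h2 h3 a ha
      simp only [List.mem_cons, List.not_mem_nil, or_false] at ha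
      rcases ha with rfl | rfl | rfl
      · exact h1
      · exact h2
      · exact h3
    · intro p hp p' hp' hm hne hv
      exact stack_meth_of_val_eq H hd hp hp' hm hne hv

/-- Moving the value of `Pop`s without `Push` to another value that no `PopEmpty` carries keeps an
execution differentiated. -/
theorem differentiated_rename (H : h.Of e) (hd : stack.Differentiated (events e)) {q : O}
    (hq : q ∈ h.ops) (hqm : h.meth q = .pop)
    (hno : ∀ p ∈ h.ops, h.meth p = .push → h.val p ≠ h.val q) {y : ℕ}
    (hy : ∀ p ∈ h.ops, h.meth p = .popEmpty → h.val p ≠ y) :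
    stack.Differentiated (events (rename (fun x => if x = h.val q then y else x) e)) := by
  have hd' := (H.differentiated_iff stack).1 hd
  rw [(H.rename _).differentiated_iff]
  constructor
  · intro o ho o' ho' hm hlab
    have hm' : h.meth o = .push := hm
    have hmm : h.meth o = h.meth o' := (Prod.mk.injEq _ _ _ _ ▸ hlab).1
    have hvv : (if h.val o = h.val q then y else h.val o) =
      if h.val o' = h.val q then y else h.val o' := (Prod.mk.injEq _ _ _ _ ▸ hlab).2
    rw [if_neg (hno o ho hm'), if_neg (hno o' ho' (hmm.symm.trans hm'))] at hvv
    exact hd'.1 o ho o' ho' hm (by simp [History.lab, hmm, hvv])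
  · intro o ho o' ho' hm hv
    have hm' : h.meth o = .popEmpty := hm
    have hvv : (if h.val o = h.val q then y else h.val o) =
      if h.val o' = h.val q then y else h.val o' := hv
    have hoq : h.val o ≠ h.val q := by
      intro heq
      have := hd'.2 o ho q hq hm heq
      subst this
      rw [hm'] at hqm
      cases hqm
    rw [if_neg hoq] at hvv
    split_ifs at hvv with h1
    · exact absurd hvv (hy o ho hm')
    · exact hd'.2 o ho o' ho' hm hvv

theorem paint_rename {M : Type} {O : Type*} (ρ : ℕ → Fin 4) (r : ℕ → ℕ)
    (e : List (Action M ℕ O)) : paint ρ (rename r e) = paint (fun x => ρ (r x)) e := by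
  simp only [paint, rename, List.map_map, Function.comp_def, Action.map_map]

/-- A colouring may give a `Pop` without `Push` the colour of a pushed value. If no value is popped
twice, then this is the only `Pop` of the execution, because otherwise a renaming would identify its
value with that of another `Pop`; and it may be renamed to pop the pushed value. -/
theorem exists_all_pops_pushed {I : Set (List (Action StackMethod ℕ O))}
    (hI : stack.DataIndependent I) (hA : stack.AtMostOnce .pop I) (he : e ∈ I) (H : h.Of e)
    (hd : stack.Differentiated (events e)) (ρ : ℕ → Fin 4) {p : O} (hp : p ∈ h.ops)
    (hpm : h.meth p = .push) (hpk : ρ (h.val p) = 2) :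
    ∃ e' ∈ I, ∃ h' : History StackMethod O, h'.Of e' ∧ stack.Differentiated (events e') ∧
      paint ρ e' = paint ρ e ∧ ∀ q ∈ h'.ops, h'.meth q = .pop → ρ (h'.val q) = 2 →
        ∃ p' ∈ h'.ops, h'.meth p' = .push ∧ h'.val p' = h'.val q := by
  by_cases hall : ∀ q ∈ h.ops, h.meth q = .pop → ρ (h.val q) = 2 →
      ∃ p' ∈ h.ops, h.meth p' = .push ∧ h.val p' = h.val q
  · exact ⟨e, he, h, H, hd, rfl, hall⟩
  push Not at hall
  obtain ⟨q, hq, hqm, hqk, hno⟩ := hall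
  have hd' := (H.differentiated_iff stack).1 hd
  -- no `PopEmpty` has the value of an operation of another kind
  have hpe : ∀ o ∈ h.ops, h.meth o ≠ .popEmpty → ∀ p ∈ h.ops, h.meth p = .popEmpty →
      h.val p ≠ h.val o := by
    intro o ho hom p hp hpm heq
    have := hd'.2 p hp o ho (by rw [hpm]; rfl) heq
    subst this
    exact hom hpm
  have honly : ∀ q' ∈ h.ops, h.meth q' = .pop → q' = q := by
    intro q' hq' hqm'
    have hdr := differentiated_rename H hd hq hqm hno
      (hpe q' hq' (by rw [hqm']; simp))
    have := removalUnique_of_atMostOnce hA (hI.2 e he _) (H.rename _) hdr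
    refine this q' hq' q hq hqm' hqm ?_
    simp [History.rename]
  have hdr := differentiated_rename H hd hq hqm hno (hpe p hp (by rw [hpm]; simp))
  refine ⟨_, hI.2 e he _, _, H.rename _, hdr, ?_, ?_⟩
  · rw [paint_rename]
    congr 1
    funext x
    split_ifs with hx
    · rw [hx, hpk, hqk]
    · rfl
  · intro q' hq' hqm' _
    obtain rfl := honly q' hq' hqm'
    refine ⟨p, hp, hpm, ?_⟩
    simp [History.rename]

/-- The unmatched `Push` that returns first is covered by matched values only. -/
theorem stack_rPush : stack.CoRegularOn (O := O) (stack.AtMostOnce .pop) .rPush := by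
  classical
  refine coRegularOn_of_recognizable (P := fun w => MidWord .push .pop .push w ∧
    ¬ Has (fun m k => m = .pop ∧ k = 1) w ∧
    (Bounded .push .pop (fun k => k = 2) w ∧ bal .push .pop (fun k => k = 2) w = 0))
    ((recognizable_midWord _ _ _).and ((recognizable_has _).not.and
      (recognizable_bounded_and _ _ _ fun z => z = 0))) ?_ ?_
  · intro I hI _ hA e he hd hv
    obtain ⟨h, H⟩ := History.exists_of (hI e he)
    have hu := inputUnique_of_differentiated H hd (m := .push) rfl
    have hr := removalUnique_of_atMostOnce hA he H hd
    obtain ⟨D, hne, ⟨o₁, ho₁, hD₁, hm₁, hs₁⟩, hcov⟩ := (stack_violates_rPush_iff H hd).1 hv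
    obtain ⟨o, ho, hmin⟩ := Finset.exists_min_image (h.ops.filter fun o => h.val o ∈ D ∧
      h.meth o = .push ∧ ∀ o' ∈ h.ops, h.val o' = h.val o → o' = o) h.res
      ⟨o₁, Finset.mem_filter.2 ⟨ho₁, hD₁, hm₁, hs₁⟩⟩
    simp only [Finset.mem_filter, and_imp] at ho hmin
    obtain ⟨ho, hoD, hom, hsole⟩ := ho
    obtain ⟨ρ, hρ, hρ1, hbal⟩ := exists_midWord H hu hr ho hom hsole
      (D := {x | x ∈ D ∧ ∃ q ∈ h.ops, h.meth q = .pop ∧ h.val q = x}) (by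
        intro n hn hn'
        obtain ⟨p, hp, hpD, hpm, hpn, hq⟩ := hcov o ho hoD hom hsole n hn hn'
        refine ⟨p, hp, ⟨hpD, ?_⟩, hpm, hpn, hq⟩
        by_contra hcon
        have := hmin p hp hpD hpm fun p' hp' hv => by
          by_contra hne'
          exact hcon ⟨p', hp', stack_meth_of_val_eq H hd hp hp' hpm hne' hv, hv⟩
        omega)
    refine ⟨ρ, hρ, ?_, hρ.1, hbal fun p hp hpD _ _ => hpD.2⟩
    rw [has_paint H]
    rintro ⟨q, hq, hqm, hqk⟩
    have := hsole q hq ((hρ1 _).1 hqk)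
    subst this
    rw [hom] at hqm
    cases hqm
  · rintro I hI hDI hA e he hd ρ ⟨hmid, hpop, -, hbal⟩
    obtain ⟨h, H⟩ := History.exists_of (hI e he)
    have hpush : ∃ p ∈ h.ops, h.meth p = .push ∧ ρ (h.val p) = 2 := by
      obtain ⟨o, ho, hom, hk, hcov⟩ :=
        exists_covered_of_midWord H (inputUnique_of_differentiated H hd (m := .push) rfl) hmid
      obtain ⟨p, hp, hpD, hpm, -⟩ := hcov (h.res o) (H.inv_lt_res o ho) le_rfl
      exact ⟨p, hp, hpm, hpD.1⟩
    obtain ⟨p₀, hp₀, hpm₀, hpk₀⟩ := hpush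
    obtain ⟨e', he', h', H', hd', hpaint, hin⟩ :=
      exists_all_pops_pushed hDI hA he H hd ρ hp₀ hpm₀ hpk₀
    rw [← hpaint] at hmid hpop hbal
    have hu := inputUnique_of_differentiated H' hd' (m := .push) rfl
    have hr := removalUnique_of_atMostOnce hA he' H' hd'
    have hrem := fun {p : O} => exists_removal_of_bal_eq_zero H' hu hr (C := fun k => k = 2) hin
      hbal (p := p)
    obtain ⟨o, ho, hom, hk, hcov⟩ := exists_covered_of_midWord H' hu hmid
    have hsole : ∀ o' ∈ h'.ops, h'.val o' = h'.val o → o' = o := by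
      intro o' ho' hv
      by_contra hne
      rw [has_paint H'] at hpop
      exact hpop ⟨o', ho', stack_meth_of_val_eq H' hd' ho ho' hom hne hv, by rw [hv, hk]⟩
    refine ⟨e', he', hd', (stack_violates_rPush_iff H' hd').2
      ⟨insert (h'.val o) {x | ρ x = 2 ∧ ∃ p ∈ h'.ops, h'.meth p = .push ∧ h'.val p = x},
        ?_, ⟨o, ho, by simp, hom, hsole⟩, ?_⟩⟩
    · rintro ⟨s, hs, hsD, hsm⟩
      have hun := ((H'.differentiated_iff stack).1 hd').2 s hs
      rcases hsD with hv | ⟨-, p, hp, hpm, hpv⟩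
      · have := hun o ho (by rw [hsm]; rfl) hv
        subst this
        rw [hom] at hsm
        cases hsm
      · have := hun p hp (by rw [hsm]; rfl) hpv.symm
        subst this
        rw [hpm] at hsm
        cases hsm
    · rintro o' ho' hD' hom' hsole' n hn hn'
      have hoo : o' = o := by
        rcases hD' with hv | ⟨hk', -⟩
        · exact hsole o' ho' hv
        · obtain ⟨q, hq, hqm, hqv⟩ := hrem ho' hom' hk'
          have := hsole' q hq hqv
          subst this
          rw [hom'] at hqm
          cases hqm
      subst hoo
      exact (hcov n hn hn').mono (Set.subset_insert _ _)

end Push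

/-! ### The rule `PushPop` -/

section PushPop

variable {O : Type*}

theorem stack_last_rPushPop (u : List (Event StackMethod)) :
    stack.last u = .rPushPop ↔ ¬ Contains .popEmpty u ∧ Matched .push u ∧ Contains .pop u := by
  simp only [stack]
  split_ifs with h1 h2 h3 <;> simp [*]

/-- Each call of an operation satisfying `p` is preceded by the return of one satisfying `q`. -/
def CallAfterRet {M : Type} (p q : M → Fin 4 → Prop) (w : List (Action M (Fin 4) Unit)) : Prop :=
  ¬ ∃ n a, w[n]? = some a ∧ callOf p a ∧ ¬ ∃ b ∈ w.take n, retOf q b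

/-- Each call of an operation satisfying `p` is preceded by the call of one satisfying `q`. -/
def CallAfterCall {M : Type} (p q : M → Fin 4 → Prop) (w : List (Action M (Fin 4) Unit)) : Prop :=
  ¬ ∃ n a, w[n]? = some a ∧ callOf p a ∧ ¬ ∃ b ∈ w.take n, callOf q b

theorem recognizable_callAfterRet {M : Type} (p q : M → Fin 4 → Prop) :
    Recognizable (CallAfterRet p q) :=
  ((Recognizable.hasLetter _).not.before _).not

theorem recognizable_callAfterCall {M : Type} (p q : M → Fin 4 → Prop) :
    Recognizable (CallAfterCall p q) :=
  ((Recognizable.hasLetter _).not.before _).not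

theorem callAfterRet_paint {M : Type} {e : List (Action M ℕ O)} {h : History M O} (H : h.Of e)
    (ρ : ℕ → Fin 4) (p q : M → Fin 4 → Prop) :
    CallAfterRet p q (paint ρ e) ↔ ∀ o ∈ h.ops, p (h.meth o) (ρ (h.val o)) →
      ∃ o' ∈ h.ops, q (h.meth o') (ρ (h.val o')) ∧ h.res o' < h.inv o := by
  rw [CallAfterRet, before_callOf H ρ p fun w => ¬ ∃ b ∈ w, retOf q b]
  simp only [has_retOf_take H]
  push Not
  rfl

theorem callAfterCall_paint {M : Type} {e : List (Action M ℕ O)} {h : History M O} (H : h.Of e)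
    (ρ : ℕ → Fin 4) (p q : M → Fin 4 → Prop) :
    CallAfterCall p q (paint ρ e) ↔ ∀ o ∈ h.ops, p (h.meth o) (ρ (h.val o)) →
      ∃ o' ∈ h.ops, q (h.meth o') (ρ (h.val o')) ∧ h.inv o' < h.inv o := by
  rw [CallAfterCall, before_callOf H ρ p fun w => ¬ ∃ b ∈ w, callOf q b]
  simp only [has_callOf_take H]
  push Not
  rfl

/-- The coloured words in which colour `1` stands for a single value that is popped while values of
the colours `2` and `3` are in the stack; the values of colour `2` are pushed after an operation of
colour `1` has returned; and the stack is covered by values of the colours `2` and `3` from the call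
of the `Pop` of colour `1` until it and all `Pop`s of colour `3` have returned. -/
def PushPopWord (w : List (Action StackMethod (Fin 4) Unit)) : Prop :=
  (Bounded .push .pop (fun k => k = 2 ∨ k = 3) w ∧
    bal .push .pop (fun k => k = 2 ∨ k = 3) w = 0) ∧
  ¬ Two (fun m k => m = .push ∧ k = 1) w ∧
  Has (fun m k => m = .pop ∧ k = 1) w ∧
  CallAfterRet (fun m k => m = .push ∧ k = 2) (fun m k => (m = .push ∨ m = .pop) ∧ k = 1) w ∧
  CallAfterCall (fun m k => m = .pop ∧ (k = 2 ∨ k = 3)) (fun m k => m = .pop ∧ k = 1) w ∧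
  CoverWord .push .pop (fun k => k = 2 ∨ k = 3) (fun m k => m = .pop ∧ k = 1)
    (fun m k => m = .pop ∧ (k = 1 ∨ k = 3)) w

theorem recognizable_pushPopWord : Recognizable PushPopWord :=
  (recognizable_bounded_and _ _ _ fun z => z = 0).and ((recognizable_two _).not.and
    ((recognizable_has _).and ((recognizable_callAfterRet _ _).and
      ((recognizable_callAfterCall _ _).and (recognizable_coverWord _ _ _ _ _)))))

variable {e : List (Action StackMethod ℕ O)} {h : History StackMethod O}

/-- The operations of `A` contain, with each `Push`, another operation of the same value. -/
def History.MatchedIn (h : History StackMethod O) (A : List O) : Prop :=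
  ∀ p ∈ A, h.meth p = .push → ∃ p' ∈ A, p' ≠ p ∧ h.val p' = h.val p

/-- `L` is of the form `Push · A · Pop · B`, as required by the rule `PushPop`. -/
def History.PushPopForm (h : History StackMethod O) (L : List O) (a : O) (A : List O) (b : O)
    (B : List O) : Prop :=
  L = a :: (A ++ b :: B) ∧ h.meth a = .push ∧ h.meth b = .pop ∧ h.val b = h.val a ∧
    h.MatchedIn A ∧ h.MatchedIn B ∧ (∀ o ∈ A, h.val o ≠ h.val a) ∧ ∀ o ∈ B, h.val o ≠ h.val a

theorem stack_violates_rPushPop_iff (H : h.Of e) :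
    stack.Violates .rPushPop e ↔ ∃ D, (¬ ∃ o ∈ h.ops, h.val o ∈ D ∧ h.meth o = .popEmpty) ∧
      ((∀ o ∈ h.ops, h.val o ∈ D → h.meth o = .push →
          ∃ o' ∈ h.ops, o' ≠ o ∧ h.val o' = h.val o) ∧
        ∃ o ∈ h.ops, h.val o ∈ D ∧ h.meth o = .pop) ∧
      ∀ L, h.Lists D L → h.Respects L → ¬ ∃ a A b B, h.PushPopForm L a A b B := by
  refine exists_congr fun D => ?_
  rw [stack_last_rPushPop, H.contains_iff, H.contains_iff, H.matched_iff, and_assoc]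
  refine and_congr_right fun hne => and_congr Iff.rfl ?_
  rw [H.linearizable_proj_iff, not_exists]
  refine forall_congr' fun L => ?_
  rw [not_and, not_and]
  refine forall_congr' fun hL => forall_congr' fun _ => not_congr ?_
  change _ ∈ (Rule.mk 2 [.matched .push 0, .matched .push 1, .methods 0 {.push, .pop},
    .methods 1 {.push, .pop}] [.meth .push, .var 0, .meth .pop, .var 1] :
      Rule StackMethod).matchingSet ↔ _
  rw [mem_matchingSet_pair]
  simp only [List.mem_cons, List.not_mem_nil, or_false, forall_eq_or_imp, forall_eq,
    Atom.Holds]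
  have hmeth : ∀ o ∈ L, h.meth o ∈ ({.push, .pop} : Set StackMethod) := by
    intro o ho
    have ho' := (hL.2 o).1 ho
    cases hm : h.meth o
    · simp
    · simp
    · exact absurd ⟨o, ho'.1, ho'.2, hm⟩ hne
  constructor
  · rintro ⟨us, x, ⟨hg0, hg1, -⟩, hw, h0, h1⟩
    rw [List.map_eq_cons_iff] at hw
    obtain ⟨a, L', rfl, ha, hw⟩ := hw
    rw [List.map_eq_append_iff] at hw
    obtain ⟨A, L'', rfl, hA, hw⟩ := hw
    rw [List.map_eq_cons_iff] at hw
    obtain ⟨b, B, rfl, hb, hB⟩ := hw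
    obtain ⟨ham, rfl⟩ := History.lab_eq_iff.1 ha
    obtain ⟨hbm, hbv⟩ := History.lab_eq_iff.1 hb
    have hnd := List.nodup_append.1 (List.nodup_cons.1 hL.1).2
    rw [← hA] at hg0 h0
    rw [← hB] at hg1 h1
    rw [History.matched_map hnd.1] at hg0
    rw [History.matched_map (List.nodup_cons.1 hnd.2.1).2] at hg1
    exact ⟨a, A, b, B, rfl, ham, hbm, hbv, hg0, hg1, History.forall_mem_map_lab.1 h0,
      History.forall_mem_map_lab.1 h1⟩
  · rintro ⟨a, A, b, B, rfl, ham, hbm, hbv, hA, hB, h0, h1⟩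
    have hnd := List.nodup_append.1 (List.nodup_cons.1 hL.1).2
    refine ⟨fun i => if i = 0 then A.map h.lab else B.map h.lab, h.val a, ⟨?_, ?_, ?_, ?_⟩, ?_,
      History.forall_mem_map_lab.2 h0, History.forall_mem_map_lab.2 h1⟩
    · exact (History.matched_map hnd.1).2 hA
    · exact (History.matched_map (List.nodup_cons.1 hnd.2.1).2).2 hB
    · exact History.forall_mem_map_lab.2 fun o ho => hmeth o (by simp [ho])
    · exact History.forall_mem_map_lab.2 fun o ho => hmeth o (by simp [ho])
    · simp [History.lab, ham, hbm, hbv]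

theorem removalUnique_of_no_defect {M : Type} {h : History M O} {mi mr : M}
    (hno : ∀ x, ¬ h.Defect True mi mr x) : h.RemovalUnique mr := by
  intro q hq q' hq' hm hm' hv
  by_contra hne
  exact hno (h.val q) ⟨q, hq, hm, rfl, Or.inr (Or.inl ⟨trivial, q', hq', Ne.symm hne, hm', hv.symm⟩)⟩

/-- Without defects, a value `x` whose `Push` is not preceded by anything and whose `Pop` is not
covered can be pushed first and popped at an uncovered time: no other value is in the stack then,
so that each of them belongs either to `A` or to `B`. -/
theorem exists_pushPopForm (H : h.Of e) (hd : stack.Differentiated (events e))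
    (hno : ∀ x, ¬ h.Defect True .push .pop x) {D : Set ℕ}
    (hne : ¬ ∃ o ∈ h.ops, h.val o ∈ D ∧ h.meth o = .popEmpty)
    (hmat : ∀ o ∈ h.ops, h.val o ∈ D → h.meth o = .push →
      ∃ o' ∈ h.ops, o' ≠ o ∧ h.val o' = h.val o)
    {a b : O} (ha : a ∈ h.ops) (hb : b ∈ h.ops) (haD : h.val a ∈ D) (ham : h.meth a = .push)
    (hbm : h.meth b = .pop) (hv : h.val b = h.val a)
    (hfirst : ∀ o ∈ h.ops, h.val o ∈ D → ¬ h.res o < h.inv a) {n : ℕ} (hn : h.inv b < n)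
    (hn' : n ≤ h.res b) (hcov : ¬ h.Covered .push .pop D n) :
    ∃ L, h.Lists D L ∧ h.Respects L ∧ ∃ a A b B, h.PushPopForm L a A b B := by
  classical
  have hu := inputUnique_of_differentiated H hd (m := .push) rfl
  have hr := removalUnique_of_no_defect hno
  have hmeth : ∀ o ∈ h.ops, h.val o ∈ D → h.meth o = .push ∨ h.meth o = .pop := by
    intro o ho hD
    cases hm : h.meth o
    · exact Or.inl rfl
    · exact Or.inr rfl
    · exact absurd ⟨o, ho, hD, hm⟩ hne
  have hab : a ≠ b := by
    rintro rfl
    rw [ham] at hbm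
    cases hbm
  have hval : ∀ o ∈ h.ops, h.val o = h.val a → o = a ∨ o = b := by
    intro o ho hvo
    rcases hmeth o ho (by rwa [hvo]) with hm | hm
    · exact Or.inl (hu o ho a ha hm ham hvo)
    · exact Or.inr (hr o ho b hb hm hbm (hvo.trans hv.symm))
  -- the values all of whose operations are called before time `n`
  let S : O → Prop := fun o => ∀ o' ∈ h.ops, h.val o' = h.val o → h.inv o' < n
  have hS : ∀ o o', h.val o = h.val o' → S o → S o' := by
    intro o o' hoo hso p hp hpv
    exact hso p hp (hpv.trans hoo.symm)
  have hlate : ∀ o ∈ h.ops, h.val o ∈ D → ¬ S o → n ≤ h.res o := by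
    intro o ho hoD hns
    simp only [S] at hns
    push Not at hns
    obtain ⟨o', ho', hv', hle⟩ := hns
    have h1 := H.inv_lt_res o ho
    have h2 := H.inv_lt_res o' ho'
    rcases hmeth o ho hoD with hm | hm <;>
      rcases hmeth o' ho' (by rwa [hv']) with hm' | hm'
    · have := hu o ho o' ho' hm hm' hv'.symm
      subst this
      omega
    · by_contra hlt
      refine hcov ⟨o, ho, hoD, hm, not_le.1 hlt, fun q hq hqm hqv => ?_⟩
      rwa [hr q hq o' ho' hqm hm' (hqv.trans hv'.symm)]
    · by_contra hlt
      exact hno (h.val o) ⟨o, ho, hm, rfl, Or.inr (Or.inr ⟨o', ho', hm', hv', by omega⟩)⟩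
    · have := hr o ho o' ho' hm hm' hv'.symm
      subst this
      omega
  obtain ⟨A, hA1, hA2, hA3⟩ := H.exists_respects
    (h.ops.filter fun o => h.val o ∈ D ∧ h.val o ≠ h.val a ∧ S o) (Finset.filter_subset _ _)
  obtain ⟨B, hB1, hB2, hB3⟩ := H.exists_respects
    (h.ops.filter fun o => h.val o ∈ D ∧ h.val o ≠ h.val a ∧ ¬ S o) (Finset.filter_subset _ _)
  simp only [Finset.mem_filter] at hA2 hB2
  refine ⟨a :: (A ++ b :: B), ⟨?_, ?_⟩, ?_, a, A, b, B, rfl, ham, hbm, hv, ?_, ?_,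
    fun o ho => ((hA2 o).1 ho).2.2.1, fun o ho => ((hB2 o).1 ho).2.2.1⟩
  · rw [List.nodup_cons, List.nodup_append, List.nodup_cons]
    refine ⟨?_, hA1, ⟨?_, hB1⟩, ?_⟩
    · rw [List.mem_append, List.mem_cons, hA2, hB2]
      rintro (h1 | h1 | h1)
      · exact h1.2.2.1 rfl
      · exact hab h1
      · exact h1.2.2.1 rfl
    · rw [hB2]
      exact fun h1 => h1.2.2.1 hv
    · rintro o ho o' ho' rfl
      rw [List.mem_cons, hB2] at ho'
      rw [hA2] at ho
      rcases ho' with rfl | ho'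
      · exact ho.2.2.1 hv
      · exact ho'.2.2.2 ho.2.2.2
  · intro o
    rw [List.mem_cons, List.mem_append, List.mem_cons, hA2, hB2]
    constructor
    · rintro (rfl | h1 | rfl | h1)
      · exact ⟨ha, haD⟩
      · exact ⟨h1.1, h1.2.1⟩
      · exact ⟨hb, by rwa [hv]⟩
      · exact ⟨h1.1, h1.2.1⟩
    · rintro ⟨ho, hoD⟩
      by_cases hvo : h.val o = h.val a
      · rcases hval o ho hvo with rfl | rfl <;> simp
      · by_cases hs : S o
        · exact Or.inr (Or.inl ⟨ho, hoD, hvo, hs⟩)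
        · exact Or.inr (Or.inr (Or.inr ⟨ho, hoD, hvo, hs⟩))
  · rw [History.respects_cons]
    refine ⟨?_, History.respects_of_cut hA3 hB3 hn hn' ?_ ?_⟩
    · intro o ho
      rw [List.mem_append, List.mem_cons, hA2, hB2] at ho
      rcases ho with h1 | rfl | h1
      · exact hfirst o h1.1 h1.2.1
      · exact hfirst o hb (by rwa [hv])
      · exact hfirst o h1.1 h1.2.1
    · intro o ho
      have ho' := (hA2 o).1 ho
      exact ho'.2.2.2 o ho'.1 rfl
    · intro o ho
      have ho' := (hB2 o).1 ho
      exact hlate o ho'.1 ho'.2.1 ho'.2.2.2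
  · intro p hp hpm
    have hp' := (hA2 p).1 hp
    obtain ⟨p', hp'ops, hne', hv'⟩ := hmat p hp'.1 hp'.2.1 hpm
    exact ⟨p', (hA2 p').2 ⟨hp'ops, by rw [hv']; exact hp'.2.1, by rw [hv']; exact hp'.2.2.1,
      hS p p' hv'.symm hp'.2.2.2⟩, hne', hv'⟩
  · intro p hp hpm
    have hp' := (hB2 p).1 hp
    obtain ⟨p', hp'ops, hne', hv'⟩ := hmat p hp'.1 hp'.2.1 hpm
    exact ⟨p', (hB2 p').2 ⟨hp'ops, by rw [hv']; exact hp'.2.1, by rw [hv']; exact hp'.2.2.1,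
      fun hs => hp'.2.2.2 (hS p' p hv' hs)⟩, hne', hv'⟩

/-- Suppose that every value of `D` has a `Push` that is preceded by some operation, or a `Pop` that
is covered. Let `x₀` be the value with the first return, and let `E` be the first uncovered time
after the call of its `Pop`. Then `x₀` and a minimal cover of the time up to `E` give a coloured word:
colour `3` is for the values of the cover that are not pushed after the first return, so that their
`Pop`s are covered, hence return before `E`. -/
theorem exists_pushPopWord (H : h.Of e) (hd : stack.Differentiated (events e))
    (hno : ∀ x, ¬ h.Defect True .push .pop x) {D : Set ℕ}
    (hne : ¬ ∃ o ∈ h.ops, h.val o ∈ D ∧ h.meth o = .popEmpty)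
    (hmat : ∀ o ∈ h.ops, h.val o ∈ D → h.meth o = .push →
      ∃ o' ∈ h.ops, o' ≠ o ∧ h.val o' = h.val o)
    (hpop : ∃ o ∈ h.ops, h.val o ∈ D ∧ h.meth o = .pop)
    (hbad : ∀ a ∈ h.ops, ∀ b ∈ h.ops, h.val a ∈ D → h.meth a = .push → h.meth b = .pop →
      h.val b = h.val a → (∀ o ∈ h.ops, h.val o ∈ D → ¬ h.res o < h.inv a) →
      ∀ n, h.inv b < n → n ≤ h.res b → h.Covered .push .pop D n) :
    ∃ ρ, PushPopWord (paint ρ e) := by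
  classical
  have hu := inputUnique_of_differentiated H hd (m := .push) rfl
  have hr := removalUnique_of_no_defect hno
  have hmeth : ∀ o ∈ h.ops, h.val o ∈ D → h.meth o = .push ∨ h.meth o = .pop := by
    intro o ho hD
    cases hm : h.meth o
    · exact Or.inl rfl
    · exact Or.inr rfl
    · exact absurd ⟨o, ho, hD, hm⟩ hne
  have hpopof : ∀ p ∈ h.ops, h.val p ∈ D → h.meth p = .push →
      ∃ q ∈ h.ops, h.meth q = .pop ∧ h.val q = h.val p := by
    intro p hp hpD hpm
    obtain ⟨q, hq, hqp, hqv⟩ := hmat p hp hpD hpm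
    exact ⟨q, hq, stack_meth_of_val_eq H hd hp hq hpm hqp hqv, hqv⟩
  obtain ⟨t, ht⟩ := hr.exists_isRemovalTime e.length
  obtain ⟨o₁, ho₁, hD₁, -⟩ := hpop
  obtain ⟨o₀, ho₀, hmin⟩ := Finset.exists_min_image (h.ops.filter fun o => h.val o ∈ D) h.res
    ⟨o₁, by simp [ho₁, hD₁]⟩
  simp only [Finset.mem_filter, and_imp] at ho₀ hmin
  obtain ⟨ho₀, hD₀⟩ := ho₀
  obtain ⟨a₀, ha₀, ham₀, hav₀⟩ := exists_input_of_no_defect hno ho₀ (hmeth o₀ ho₀ hD₀)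
  obtain ⟨b₀, hb₀, hbm₀, hbv₀⟩ := hpopof a₀ ha₀ (by rwa [hav₀]) ham₀
  have hcovpop : ∀ a ∈ h.ops, ∀ b ∈ h.ops, h.val a ∈ D → h.meth a = .push → h.meth b = .pop →
      h.val b = h.val a → h.inv a < h.res o₀ → ∀ n, h.inv b < n → n ≤ h.res b →
        h.Covered .push .pop D n := by
    intro a ha b hb haD ham hbm hv hlt
    refine hbad a ha b hb haD ham hbm hv fun o ho hoD hlt' => ?_
    have := hmin o ho hoD
    omega
  have hfirst₀ : h.inv a₀ < h.res o₀ := by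
    rcases hmeth o₀ ho₀ hD₀ with hm | hm
    · rw [hu a₀ ha₀ o₀ ho₀ ham₀ hm hav₀]
      exact H.inv_lt_res o₀ ho₀
    · by_contra hlt
      have := H.inv_ne_res ha₀ ho₀
      exact hno (h.val o₀) ⟨o₀, ho₀, hm, rfl,
        Or.inr (Or.inr ⟨a₀, ha₀, ham₀, hav₀, by omega⟩)⟩
  -- at the end of the execution, nothing is covered
  have hend : h.inv b₀ < e.length ∧ ¬ h.Covered .push .pop D e.length := by
    refine ⟨(H.inv_lt_res b₀ hb₀).trans (H.res_lt_length hb₀), ?_⟩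
    rintro ⟨p, hp, hpD, hpm, -, hq⟩
    obtain ⟨q, hq', hqm, hqv⟩ := hpopof p hp hpD hpm
    have h1 := hq q hq' hqm hqv
    have h2 := H.inv_lt_res q hq'
    have h3 := H.res_lt_length hq'
    omega
  have hex : ∃ n, h.inv b₀ < n ∧ ¬ h.Covered .push .pop D n := ⟨_, hend⟩
  obtain ⟨E, ⟨hE1, hE2⟩, hEmin⟩ : ∃ E, (h.inv b₀ < E ∧ ¬ h.Covered .push .pop D E) ∧
      ∀ n, n < E → ¬ (h.inv b₀ < n ∧ ¬ h.Covered .push .pop D n) :=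
    ⟨Nat.find hex, Nat.find_spec hex, fun n hn => Nat.find_min hex hn⟩
  have hElen : E ≤ e.length := by
    by_contra hlt
    exact hEmin _ (not_le.1 hlt) hend
  have hcovE : ∀ n, h.inv b₀ < n → n < E → h.Covered .push .pop D n := by
    intro n hn hn'
    by_contra hcon
    exact hEmin n hn' ⟨hn, hcon⟩
  obtain ⟨Z, hZ, hZD, hZcov, hcard⟩ := exists_cover ht (lo := h.inv b₀) (hi := E - 1)
    (by omega) fun n hn hn' => hcovE n hn (by omega)
  have htZ : ∀ z ∈ Z, h.inv b₀ < t z ∧ t z < E := by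
    intro z hz
    obtain ⟨hzD, n, h1, h2, h3, h4⟩ := hZD z hz
    refine ⟨by omega, ?_⟩
    by_contra hlt
    exact hE2 ((ht.covered_iff hElen).2
      ⟨z, (hZ z hz).1, ⟨hzD, (hZ z hz).2.1⟩, by omega, not_lt.1 hlt⟩)
  have hZ₀ : ∀ z ∈ Z, h.val z ≠ h.val o₀ := by
    intro z hz hv
    have h1 := (ht z).1 b₀ hb₀ hbm₀ (hbv₀.trans (hav₀.trans hv.symm))
    have h2 := (htZ z hz).1
    omega
  let ρ : ℕ → Fin 4 := fun x => if x = h.val o₀ then 1 else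
    if ∃ z ∈ Z, h.val z = x ∧ ¬ h.inv z < h.res o₀ then 2 else
    if ∃ z ∈ Z, h.val z = x then 3 else 0
  have hρ1 : ∀ x, ρ x = 1 ↔ x = h.val o₀ := by
    intro x
    simp only [ρ]
    split_ifs with h1 h2 h3 <;> simp [h1]
  have hρ2 : ∀ x, ρ x = 2 → ∃ z ∈ Z, h.val z = x ∧ ¬ h.inv z < h.res o₀ := by
    intro x
    simp only [ρ]
    split_ifs with h1 h2 h3
    · simp
    · exact fun _ => h2
    · simp
    · simp
  have hρ3 : ∀ x, ρ x = 3 → ∃ z ∈ Z, h.val z = x ∧ h.inv z < h.res o₀ := by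
    intro x
    simp only [ρ]
    split_ifs with h1 h2 h3
    · simp
    · simp
    · obtain ⟨z, hz, hv⟩ := h3
      intro _
      refine ⟨z, hz, hv, ?_⟩
      by_contra hlt
      exact h2 ⟨z, hz, hv, hlt⟩
    · simp
  have hC : ∀ x, (ρ x = 2 ∨ ρ x = 3) ↔ ∃ z ∈ Z, h.val z = x := by
    intro x
    constructor
    · rintro (hx | hx)
      · obtain ⟨z, hz, hv, -⟩ := hρ2 x hx
        exact ⟨z, hz, hv⟩
      · obtain ⟨z, hz, hv, -⟩ := hρ3 x hx
        exact ⟨z, hz, hv⟩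
    · rintro ⟨z, hz, hv⟩
      simp only [ρ]
      rw [if_neg (fun h1 => hZ₀ z hz (hv.trans h1))]
      split_ifs with h2 h3
      · exact Or.inl rfl
      · exact Or.inr rfl
      · exact absurd ⟨z, hz, hv⟩ h3
  have hb : Bounded .push .pop (fun k => k = 2 ∨ k = 3) (paint ρ e) :=
    bounded_of_card_le H hu hr ht hZ (C := fun k => k = 2 ∨ k = 3) hC hcard
  refine ⟨ρ, ⟨hb, ?_⟩, not_two_input H hu fun x => (hρ1 x).1, ?_, ?_, ?_, ?_⟩
  · have h1 := bal_eq_card H hu hr ht hZ (C := fun k => k = 2 ∨ k = 3) hC (n := e.length) le_rfl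
    rw [List.take_of_length_le (by simp [paint])] at h1
    rw [h1, Nat.cast_eq_zero, Finset.card_eq_zero, Finset.filter_eq_empty_iff]
    rintro z hz ⟨-, hle⟩
    have := (htZ z hz).2
    omega
  · rw [has_paint H]
    exact ⟨b₀, hb₀, hbm₀, (hρ1 _).2 (hbv₀.trans hav₀)⟩
  · rw [callAfterRet_paint H]
    rintro o ho ⟨hom, hk⟩
    obtain ⟨z, hz, hv, hlt⟩ := hρ2 _ hk
    obtain rfl := hu z (hZ z hz).1 o ho (hZ z hz).2.1 hom hv
    have := H.inv_ne_res ho ho₀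
    exact ⟨o₀, ho₀, ⟨hmeth o₀ ho₀ hD₀, (hρ1 _).2 rfl⟩, by omega⟩
  · rw [callAfterCall_paint H]
    rintro o ho ⟨hom, hk⟩
    obtain ⟨z, hz, hv⟩ := (hC _).1 hk
    refine ⟨b₀, hb₀, ⟨hbm₀, (hρ1 _).2 (hbv₀.trans hav₀)⟩, ?_⟩
    rw [← (ht z).1 o ho hom hv.symm]
    exact (htZ z hz).1
  · rw [coverWord_paint H hb]
    rintro o ho ⟨hom, hk⟩ o' ho' ⟨hom', hk'⟩ n hn hn'
    obtain rfl : o' = b₀ :=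
      hr o' ho' b₀ hb₀ hom' hbm₀ (((hρ1 _).1 hk').trans (hbv₀.trans hav₀).symm)
    -- the `Pop`s of the colours `1` and `3` are covered, hence return before `E`
    have hres : h.res o < E := by
      by_contra hlt
      rcases hk with hk | hk
      · obtain rfl : o = o' :=
          hr o ho o' hb₀ hom hbm₀ (((hρ1 _).1 hk).trans (hbv₀.trans hav₀).symm)
        exact hE2 (hcovpop a₀ ha₀ o hb₀ (by rwa [hav₀]) ham₀ hbm₀ hbv₀ hfirst₀ E hE1
          (not_lt.1 hlt))
      · obtain ⟨z, hz, hv, hzlt⟩ := hρ3 _ hk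
        have h1 := (htZ z hz).2
        rw [(ht z).1 o ho hom hv.symm] at h1
        exact hE2 (hcovpop z (hZ z hz).1 o ho (hZD z hz).1 (hZ z hz).2.1 hom hv.symm hzlt E h1
          (not_lt.1 hlt))
    rw [bal_eq_card H hu hr ht hZ (C := fun k => k = 2 ∨ k = 3) hC (by omega)]
    obtain ⟨z, hz, hz1, hz2⟩ := hZcov n hn (by omega)
    have : 0 < (Z.filter fun z => h.res z < n ∧ n ≤ t z).card :=
      Finset.card_pos.2 ⟨z, by simp [hz, hz1, hz2]⟩
    omega

theorem violates_of_pushPopWord (H : h.Of e) (hd : stack.Differentiated (events e))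
    (hno : ∀ x, ¬ h.Defect True .push .pop x) {ρ : ℕ → Fin 4} (hw : PushPopWord (paint ρ e)) :
    stack.Violates .rPushPop e := by
  have hu := inputUnique_of_differentiated H hd (m := .push) rfl
  have hr := removalUnique_of_no_defect hno
  obtain ⟨⟨hb, hbal⟩, htwo, hhas, hret, hcall, hcov⟩ := hw
  have hrem := fun {p : O} => exists_removal_of_bal_eq_zero H hu hr (C := fun k => k = 2 ∨ k = 3)
    (fun q hq hqm _ => exists_input_of_no_defect hno hq (Or.inr hqm)) hbal (p := p)
  rw [has_paint H] at hhas
  rw [callAfterRet_paint H] at hret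
  rw [callAfterCall_paint H] at hcall
  rw [coverWord_paint H hb] at hcov
  obtain ⟨q₁, hq₁, hqm₁, hqk₁⟩ := hhas
  set Y : Set ℕ :=
    {x | (ρ x = 2 ∨ ρ x = 3) ∧ ∃ p ∈ h.ops, h.meth p = .push ∧ h.val p = x} with hY
  have hpushed : ∀ x ∈ insert (h.val q₁) Y, ∃ p ∈ h.ops, h.meth p = .push ∧ h.val p = x := by
    rintro x (rfl | hx)
    · exact exists_input_of_no_defect hno hq₁ (Or.inr hqm₁)
    · exact hx.2
  have hne : ¬ ∃ o ∈ h.ops, h.val o ∈ insert (h.val q₁) Y ∧ h.meth o = .popEmpty := by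
    rintro ⟨o, ho, hoD, hom⟩
    obtain ⟨p, hp, hpm, hpv⟩ := hpushed _ hoD
    have := ((H.differentiated_iff stack).1 hd).2 o ho p hp (by rw [hom]; rfl) hpv.symm
    subst this
    rw [hom] at hpm
    cases hpm
  refine (stack_violates_rPushPop_iff H).2 ⟨insert (h.val q₁) Y, hne, ⟨?_, ?_⟩, ?_⟩
  · rintro o ho (hv | ⟨hk, -⟩) hom
    · refine ⟨q₁, hq₁, ?_, hv.symm⟩
      rintro rfl
      rw [hom] at hqm₁
      cases hqm₁
    · obtain ⟨q, hq, hqm, hqv⟩ := hrem ho hom hk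
      refine ⟨q, hq, ?_, hqv⟩
      rintro rfl
      rw [hom] at hqm
      cases hqm
  · exact ⟨q₁, hq₁, by simp, hqm₁⟩
  rintro L hL hR ⟨a, A, b, B, rfl, ham, hbm, hbv, hA, hB, -, -⟩
  have ha := (hL.2 a).1 (by simp)
  have hbops := (hL.2 b).1 (by simp)
  have hk : ρ (h.val a) = 2 ∨ (ρ (h.val b) = 1 ∨ ρ (h.val b) = 3) := by
    rw [hbv]
    rcases ha.2 with hv | ⟨hk | hk, -⟩
    · rw [hv]
      exact Or.inr (Or.inl hqk₁)
    · exact Or.inl hk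
    · exact Or.inr (Or.inr hk)
  rcases hk with hk | hk
  · -- an operation of colour `1` has returned before the `Push` of a value of colour `2`
    obtain ⟨o, ho, ⟨hom, hok⟩, hlt⟩ := hret a ha.1 ⟨ham, hk⟩
    have hov := val_eq_of_not_two H hno htwo ho hq₁ hom (Or.inr hqm₁) hok hqk₁
    have hoL := (hL.2 o).2 ⟨ho, by simp [hov]⟩
    rw [List.mem_cons] at hoL
    rcases hoL with rfl | hoL
    · rw [hok] at hk
      exact absurd hk (by decide)
    · exact (History.respects_cons.1 hR).1 o hoL hlt
  · -- the time when the `Pop` takes effect is covered by some value, which is pushed but not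
    -- popped before
    have hmem : ∀ q ∈ a :: (A ++ b :: B), q ∈ h.ops := fun q hq => ((hL.2 q).1 hq).1
    obtain ⟨n, hn, hn', hnA, hnB⟩ := H.exists_cut (A := a :: A) (o := b) (B := B)
      (fun q hq => hmem q (by
        rw [List.mem_cons] at hq
        rcases hq with rfl | hq
        · simp
        · simp [hq]))
      hbops.1 (fun q hq => hmem q (by simp [hq])) hR
    have hcall₁ : ∃ o' ∈ h.ops, (h.meth o' = .pop ∧ ρ (h.val o') = 1) ∧ h.inv o' < n := by
      rcases hk with hk | hk
      · exact ⟨b, hbops.1, ⟨hbm, hk⟩, hn⟩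
      · obtain ⟨o', ho', hq', hlt⟩ := hcall b hbops.1 ⟨hbm, Or.inr hk⟩
        exact ⟨o', ho', hq', hlt.trans hn⟩
    obtain ⟨o', ho', hq', hlt'⟩ := hcall₁
    obtain ⟨p, hp, hpD, hpm, hpn, hq⟩ := covered_of_bal_pos H hu
      (C := fun k => k = 2 ∨ k = 3) (hcov b hbops.1 ⟨hbm, hk⟩ o' ho' hq' n hlt' hn')
    have hpL := (hL.2 p).2 ⟨hp, Or.inr hpD⟩
    rw [List.mem_cons, List.mem_append, List.mem_cons] at hpL
    rcases hpL with rfl | hpA | rfl | hpB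
    · have := hq b hbops.1 hbm hbv
      omega
    · obtain ⟨p', hp', hne', hv'⟩ := hA p hpA hpm
      have hp'ops := hmem p' (by simp [hp'])
      have h1 := hq p' hp'ops (stack_meth_of_val_eq H hd hp hp'ops hpm hne' hv') hv'
      have h2 := hnA p' (by simp [hp'])
      omega
    · rw [hpm] at hbm
      cases hbm
    · have := hnB p hpB
      omega

theorem violates_of_defect (H : h.Of e) (hd : stack.Differentiated (events e)) {x : ℕ}
    (hx : h.Defect True .push .pop x) : stack.Violates .rPushPop e := by
  obtain ⟨q, hq, hqm, hqx, -⟩ := id hx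
  refine (stack_violates_rPushPop_iff H).2 ⟨{x}, ?_, ⟨?_, q, hq, hqx, hqm⟩, ?_⟩
  · rintro ⟨o, ho, hox, hom⟩
    have := ((H.differentiated_iff stack).1 hd).2 o ho q hq (by rw [hom]; rfl)
      (Eq.trans hox hqx.symm)
    subst this
    rw [hom] at hqm
    cases hqm
  · intro o ho hox hom
    refine ⟨q, hq, ?_, hqx.trans (Eq.symm hox)⟩
    rintro rfl
    rw [hom] at hqm
    cases hqm
  · rintro L hL hR ⟨a, A, b, B, rfl, ham, hbm, -, -, -, hA, hB⟩
    have ha := ((hL.2 a).1 (by simp)).2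
    have hAnil : A = [] := by
      rw [List.eq_nil_iff_forall_not_mem]
      intro o ho
      exact hA o ho (((hL.2 o).1 (by simp [ho])).2.trans ha.symm)
    have hBnil : B = [] := by
      rw [List.eq_nil_iff_forall_not_mem]
      intro o ho
      exact hB o ho (((hL.2 o).1 (by simp [ho])).2.trans ha.symm)
    subst hAnil hBnil
    exact hx.not_pair (by simp) ham hbm hL hR

theorem stack_rPushPop : stack.CoRegular O .rPushPop := by
  refine coRegular_of_recognizable
    ((recognizable_defectWord True .push .pop).or recognizable_pushPopWord)
    fun e h H hd => ⟨fun hv => ?_, fun ρ hρ => ?_⟩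
  · by_cases hdef : ∃ x, h.Defect True .push .pop x
    · obtain ⟨x, hx⟩ := hdef
      obtain ⟨ρ, hρ⟩ :=
        exists_defectWord H (inputUnique_of_differentiated H hd (m := .push) rfl) hx
      exact ⟨ρ, Or.inl hρ⟩
    push Not at hdef
    obtain ⟨D, hne, ⟨hmat, hpop⟩, hlin⟩ := (stack_violates_rPushPop_iff H).1 hv
    obtain ⟨ρ, hρ⟩ := exists_pushPopWord H hd hdef hne hmat hpop (by
      intro a ha b hb haD ham hbm hvab hfirst n hn hn'
      by_contra hcov
      obtain ⟨L, hL, hR, hform⟩ := exists_pushPopForm H hd hdef hne hmat ha hb haD ham hbm hvab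
        hfirst hn hn' hcov
      exact hlin L hL hR hform)
    exact ⟨ρ, Or.inr hρ⟩
  · by_cases hdef : ∃ x, h.Defect True .push .pop x
    · obtain ⟨x, hx⟩ := hdef
      exact violates_of_defect H hd hx
    rcases hρ with hρ | hρ
    · exact absurd (exists_defect_of_word H hρ) hdef
    push Not at hdef
    exact violates_of_pushPopWord H hd hdef hρ

end PushPop

end CoReg

theorem mainTheorem2 (O : Type*) :
    (CoReg.queue.CoRegular O .r0 ∧
      CoReg.queue.CoRegular O .rEnq ∧
      CoReg.queue.CoRegular O .rEnqDeq ∧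
      CoReg.queue.CoRegularOn (O := O) (CoReg.queue.AtMostOnce .deq) .rDeqEmpty) ∧
    (CoReg.stack.CoRegular O .r0 ∧
      CoReg.stack.CoRegular O .rPushPop ∧
      CoReg.stack.CoRegularOn (O := O) (CoReg.stack.AtMostOnce .pop) .rPush ∧
      CoReg.stack.CoRegularOn (O := O) (CoReg.stack.AtMostOnce .pop) .rPopEmpty) ∧
    (CoReg.register.CoRegular O .r0 ∧
      CoReg.register.CoRegular O .rWR) ∧
    (CoReg.mutex.CoRegular O .r0 ∧
      CoReg.mutex.CoRegular O .rLock ∧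
      CoReg.mutex.CoRegular O .rLU) := by
  exact ⟨⟨CoReg.queue_r0, CoReg.queue_rEnq, CoReg.queue_rEnqDeq, CoReg.queue_rDeqEmpty⟩,
    ⟨CoReg.stack_r0, CoReg.stack_rPushPop, CoReg.stack_rPush, CoReg.stack_rPopEmpty⟩,
    ⟨CoReg.register_r0, CoReg.register_rWR⟩,
    ⟨CoReg.mutex_r0, CoReg.mutex_rLock, CoReg.mutex_rLU⟩⟩
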